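/- Let $K$ be a field, $S=K[x_1,\dots,x_n]$, and let $\beta_{i,j}(S/J)=\dim_K \mathrm{Tor}_i^S(S/J,K)_j$ be the graded Betti numbers of $S/J$ for a homogeneous ideal $J$; they form the Betti diagram $\beta(S/J)$, with $\beta_{i,j}$ in column $i$ and row $j-i$. Say that $J$ has a $D$-linear resolution if for all $i\ge 1$ one has $\beta_{i,j}(S/J)=0$ unless $j=D+i-1$. For a degree sequence $\mathbf d=(0=d_0<d_1<\dots<d_p)$ of integers, the normalised pure diagram $\pi_{\mathbf d}$ has the entry $\prod_{r\ne 0,i} d_r/|d_r-d_i|$ at $(i,d_i)$ for $0\le i\le p$ (so the entry at $(0,0)$ is $1$), and all other entries are $0$. A decomposition of a diagram $\beta$ is an expression $\beta=\sum_{\mathbf d} w_{\mathbf d}\,\pi_{\mathbf d}$ with finitely many non-zero weights $w_{\mathbf d}$, all of them non-negative real numbers. A translation of a pure diagram is a family of normalised pure diagrams $\pi(k)$, $k\ge 1$, all of the same length $p$, such that for some integers $a,b$ and some non-negative integers $c_1,\dots,c_p$ independent of $k$ the non-zero position of $\pi(k)$ in column $i$ is in row $l(k)+c_i$ for $1\le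 i\le p$, where $l(k)=ak+b$. Let $I\subseteq S$ be a monomial ideal generated by monomials of one degree $d$, and suppose that for all sufficiently large $k$ the power $I^k$ has a $dk$-linear resolution. Then there are $k_0$, $m$, translations of pure diagrams $\pi_1(k),\dots,\pi_m(k)$, and real rational functions $h_1,\dots,h_m$ such that for all $k>k_0$: 1. $\pi_1(k),\dots,\pi_m(k)$ are pairwise distinct, and they are exactly the pure diagrams that occur with positive weight in some decomposition of $\beta(S/I^k)$; in particular every decomposition of $\beta(S/I^k)$ has the form $w_1\pi_1(k)+\dots+w_m\pi_m(k)$. 2. No $h_s$ has a pole at $k$, and the polytope of Betti diagram decompositions $$P_k=\{w\in\mathbb R_{\ge 0}^m : w_1\pi_1(k)+\dots+w_m\pi_m(k)=\beta(S/I^k)\}$$ is the single point $(h_1(k),\dots,h_m(k))$. -/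

import Mathlib

noncomputable section

namespace BettiPowers

open MvPolynomial

/-- `I` is a monomial ideal all of whose generators have degree `d`. -/
def IsMonomialGeneratedInDegree {K : Type*} [Field K] {n : ℕ}
    (I : Ideal (MvPolynomial (Fin n) K)) (d : ℕ) : Prop :=
  ∃ A : Set (Fin n →₀ ℕ), (∀ a ∈ A, a.degree = d) ∧
    I = Ideal.span ((fun a => monomial a (1 : K)) '' A)

/-! ### Graded Betti numbers

`β_{i,j}(S/J) = dim_K Tor_i^S(S/J, K)_j`, where `S = K[x_1, …, x_n]` and `Tor` is computed with the
Koszul complex, the graded free resolution of `K = S/(x_1, …, x_n)` over `S`, tensored with `S/J`.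
A Koszul chain is `∑_A c(A) e_A`, with `A` running over the subsets of the variables and
`c(A) ∈ S/J`; the basis element `e_A` has homological degree `#A` and internal degree `#A`. -/

/-- The space `⊕_A (S/J) e_A` of all Koszul chains with coefficients in `S/J`. -/
abbrev KoszulChain {K : Type*} [Field K] {n : ℕ} (J : Ideal (MvPolynomial (Fin n) K)) : Type _ :=
  Finset (Fin n) → MvPolynomial (Fin n) K ⧸ J

/-- The Koszul differential `e_A ↦ ∑_{a ∈ A} (-1)^{#{b ∈ A : b < a}} x_a e_{A \ {a}}`, written
through the coefficient of each `e_B` in the image. -/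
def koszulDifferential {K : Type*} [Field K] {n : ℕ} (J : Ideal (MvPolynomial (Fin n) K)) :
    KoszulChain J →ₗ[K] KoszulChain J where
  toFun c B := ∑ a ∈ Bᶜ, (-1) ^ (B.filter (· < a)).card *
    (Ideal.Quotient.mk J (X a) * c (insert a B))
  map_add' c c' := by
    funext B
    simp only [Pi.add_apply, mul_add, Finset.sum_add_distrib]
  map_smul' r c := by
    funext B
    simp only [Pi.smul_apply, mul_smul_comm, Finset.smul_sum, RingHom.id_apply]

/-- The Koszul differential squares to zero. -/
theorem koszulDifferential_comp_self {K : Type*} [Field K] {n : ℕ}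
    (J : Ideal (MvPolynomial (Fin n) K)) (c : KoszulChain J) :
    koszulDifferential J (koszulDifferential J c) = 0 := by
  funext B
  have key : ∀ a b : Fin n, a ∉ B → b ∉ B → a < b →
      ((-1 : MvPolynomial (Fin n) K ⧸ J) ^ (B.filter (· < a)).card *
        (-1) ^ ((insert a B).filter (· < b)).card) =
      - ((-1) ^ (B.filter (· < b)).card * (-1) ^ ((insert b B).filter (· < a)).card) := by
    intro a b ha hb hab
    rw [Finset.filter_insert, Finset.filter_insert, if_pos hab, if_neg (not_lt.mpr hab.le),
      Finset.card_insert_of_notMem (by simp [ha])]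
    ring
  simp only [koszulDifferential, LinearMap.coe_mk, AddHom.coe_mk, Pi.zero_apply, Finset.mul_sum]
  rw [Finset.sum_sigma']
  refine Finset.sum_involution (fun z _ => ⟨z.2, z.1⟩) ?_ ?_ ?_ ?_
  · rintro ⟨a, b⟩ h
    simp only [Finset.mem_sigma, Finset.mem_compl, Finset.mem_insert, not_or] at h
    obtain ⟨ha, hba, hb⟩ := h
    rw [Finset.insert_comm b a B]
    rcases lt_or_gt_of_ne hba with hlt | hlt
    · linear_combination (Ideal.Quotient.mk J (X a) * Ideal.Quotient.mk J (X b) *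
        c (insert a (insert b B))) * key b a hb ha hlt
    · linear_combination (Ideal.Quotient.mk J (X a) * Ideal.Quotient.mk J (X b) *
        c (insert a (insert b B))) * key a b ha hb hlt
  · rintro ⟨a, b⟩ h _ heq
    simp only [Finset.mem_sigma, Finset.mem_compl, Finset.mem_insert, not_or] at h
    simp only [Sigma.mk.injEq] at heq
    exact h.2.1 heq.1
  · rintro ⟨a, b⟩ h
    simp only [Finset.mem_sigma, Finset.mem_compl, Finset.mem_insert, not_or] at h ⊢
    exact ⟨h.2.2, fun e => h.2.1 e.symm, h.1⟩
  · rintro ⟨a, b⟩ h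
    rfl

/-- The degree `e` part `(S/J)_e` of `S/J`. -/
def quotientDegree {K : Type*} [Field K] {n : ℕ} (J : Ideal (MvPolynomial (Fin n) K)) (e : ℕ) :
    Submodule K (MvPolynomial (Fin n) K ⧸ J) :=
  (homogeneousSubmodule (Fin n) K e).map (Ideal.Quotient.mkₐ K J).toLinearMap

/-- The Koszul chains of homological degree `i` and internal degree `j`:
combinations of the `e_A` with `#A = i` and coefficients in `(S/J)_{j-i}` (zero if `j < i`). -/
def koszulChains {K : Type*} [Field K] {n : ℕ} (J : Ideal (MvPolynomial (Fin n) K)) (i j : ℕ) :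
    Submodule K (KoszulChain J) :=
  Submodule.pi Set.univ fun A =>
    if A.card = i ∧ i ≤ j then quotientDegree J (j - i) else ⊥

/-- Koszul cycles of homological degree `i` and internal degree `j`. -/
def koszulCycles {K : Type*} [Field K] {n : ℕ} (J : Ideal (MvPolynomial (Fin n) K)) (i j : ℕ) :
    Submodule K (KoszulChain J) :=
  koszulChains J i j ⊓ LinearMap.ker (koszulDifferential J)

/-- Koszul boundaries of homological degree `i` and internal degree `j`. -/
def koszulBoundaries {K : Type*} [Field K] {n : ℕ} (J : Ideal (MvPolynomial (Fin n) K)) (i j : ℕ) :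
    Submodule K (KoszulChain J) :=
  (koszulChains J (i + 1) j).map (koszulDifferential J)

/-- Boundaries are cycles, so that the quotient below is the Koszul homology. -/
theorem koszulBoundaries_le_koszulCycles {K : Type*} [Field K] {n : ℕ}
    (J : Ideal (MvPolynomial (Fin n) K)) (i j : ℕ) :
    koszulBoundaries J i j ≤ koszulCycles J i j := by
  rintro _ ⟨c, hc, rfl⟩
  refine ⟨?_, koszulDifferential_comp_self J c⟩
  simp only [koszulChains, SetLike.mem_coe, Submodule.mem_pi, Set.mem_univ, true_implies] at hc ⊢
  intro B
  refine Submodule.sum_mem _ fun a ha => ?_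
  have haB : a ∉ B := Finset.mem_compl.mp ha
  have h := hc (insert a B)
  rw [Finset.card_insert_of_notMem haB] at h
  by_cases hB : B.card = i ∧ i + 1 ≤ j
  · rw [if_pos ⟨by omega, hB.2⟩] at h
    rw [if_pos ⟨hB.1, by omega⟩]
    obtain ⟨f, hf, hfc⟩ := h
    refine ⟨(-1) ^ (B.filter (· < a)).card * (X a * f), ?_, ?_⟩
    · have h1 : (X a * f : MvPolynomial (Fin n) K).IsHomogeneous (j - i) := by
        have := (isHomogeneous_X K a).mul ((mem_homogeneousSubmodule _ _).mp hf)
        rwa [show 1 + (j - (i + 1)) = j - i by omega] at this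
      rcases neg_one_pow_eq_or (MvPolynomial (Fin n) K) (B.filter (· < a)).card with e | e <;> rw [e]
      · simpa using h1
      · simpa using h1
    · rw [← hfc]
      simp
  · rw [if_neg (by omega), Submodule.mem_bot] at h
    rw [h, mul_zero, mul_zero]
    exact Submodule.zero_mem _

/-- The graded Betti number `β_{i,j}(S/J) = dim_K Tor_i^S(S/J, K)_j`. -/
def betti {K : Type*} [Field K] {n : ℕ} (J : Ideal (MvPolynomial (Fin n) K)) (i j : ℕ) : ℕ :=
  Module.finrank K (koszulCycles J i j ⧸ (koszulBoundaries J i j).submoduleOf (koszulCycles J i j))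

/-- The Betti diagram of `S/J`, with `β_{i,j}` at `(i, j)`, i.e. in column `i` and row `j - i`. -/
def bettiDiagram {K : Type*} [Field K] {n : ℕ} (J : Ideal (MvPolynomial (Fin n) K)) :
    ℕ → ℕ → ℝ :=
  fun i j => betti J i j

/-- `J` has a `D`-linear resolution: for `i ≥ 1` the `i`-th module in the minimal graded free
resolution of `S/J` is generated in degree `D + i - 1`. -/
def HasLinearResolution {K : Type*} [Field K] {n : ℕ} (J : Ideal (MvPolynomial (Fin n) K))
    (D : ℕ) : Prop :=
  ∀ i j, 1 ≤ i → betti J i j ≠ 0 → j + 1 = D + i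

/-! ### Pure diagrams and decompositions -/

/-- A degree sequence `0 = d_0 < d_1 < ⋯ < d_p`, with `p = length`: the non-zero positions
`(i, d_i)` of a pure diagram whose top left corner is non-zero. -/
@[ext]
structure DegreeSequence where
  length : ℕ
  deg : Fin (length + 1) → ℕ
  strictMono : StrictMono deg
  deg_zero : deg 0 = 0

/-- The pure diagram of a degree sequence, normalised to have `1` in the top left corner; its entry
at `(i, d_i)` is `∏_{r ≠ 0, i} d_r / |d_r - d_i|`. -/
def DegreeSequence.pureDiagram (d : DegreeSequence) (i j : ℕ) : ℝ :=
  if h : i < d.length + 1 then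
    if j = d.deg ⟨i, h⟩ then
      ∏ r ∈ Finset.univ.filter (fun r => r ≠ 0 ∧ r ≠ ⟨i, h⟩),
        (d.deg r : ℝ) / |(d.deg r : ℝ) - (d.deg ⟨i, h⟩ : ℝ)|
    else 0
  else 0

/-- The decompositions of a diagram `β` as a finite sum `∑ w_d π_d` of normalised pure diagrams
with non-negative real weights. -/
def decompositions (β : ℕ → ℕ → ℝ) : Set (DegreeSequence →₀ ℝ) :=
  {w | (∀ d, 0 ≤ w d) ∧ ∀ i j, (w.sum fun d c => c * d.pureDiagram i j) = β i j}

/-- The pure diagrams that occur with positive weight in some decomposition of `β`. -/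
def occurringPure (β : ℕ → ℕ → ℝ) : Set DegreeSequence :=
  {d | ∃ w ∈ decompositions β, 0 < w d}

/-- The polytope in `ℝ^m` of weight vectors of the decompositions of `β` into the pure diagrams
`π_1, …, π_m`. -/
def decompositionPolytope {m : ℕ} (β : ℕ → ℕ → ℝ) (π : Fin m → DegreeSequence) :
    Set (Fin m → ℝ) :=
  {v | (∀ s, 0 ≤ v s) ∧ ∀ i j, ∑ s, v s * (π s).pureDiagram i j = β i j}

/-- A translation of a pure diagram: apart from the top left corner, the non-zero positions of
`π(k)` have a fixed shape (in column `i ≥ 1` the row `shape i`, counted from row `l(k)`) that is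
moved down to the row `l(k) = a k + b`. The row of the position `(i, d_i)` is `d_i - i`. -/
def IsTranslation (π : ℕ → DegreeSequence) : Prop :=
  ∃ (p : ℕ) (a b : ℤ) (shape : ℕ → ℕ), ∀ k : ℕ, 1 ≤ k →
    (π k).length = p ∧
    ∀ i : Fin ((π k).length + 1), i ≠ 0 →
      ((π k).deg i : ℤ) - (i : ℕ) = (a * k + b) + shape i

end BettiPowers

end

open BettiPowers

/-!
For large `k` the ideal `J = I ^ k` has a `D`-linear resolution with `D = d * k = c + 1`, so apart
from the corner `β (S/J)` consists of the strand `b i = β i (c + i)`. A pure diagram in a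
decomposition must then belong to one of the degree sequences `0 < c + 1 < ⋯ < c + p`. Multiplying
Betti numbers by their degrees turns the pure diagram of length `q + 1` into a multiple of the
coefficient sequence of `(1 + X) ^ q`. Hence a decomposition amounts to the Taylor expansion at
`-1` of `∑ s, (c + 1 + s) * b (s + 1) * X ^ s`, which shows uniqueness, and existence once the
Taylor coefficients are known to be non-negative.

Multiplying by degrees is also what `t * d / dt` does to the K-polynomial of `J`. Counting exponents
variable by variable, the derivative is the sum of the K-polynomials of the modules `J / J'`, where
`J'` is generated by the monomials of `J` whose exponent in some variable is at most some bound.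
These modules again have linear resolutions. A generic linear form, over the field `K(T)`, cuts a
linear module down to a linear module in one variable less, up to a space in the lowest degree.
Therefore the Hilbert series of a linear module is a non-negative combination of the series
`(1 - t) ^ (-j)`, and this is the non-negativity of the Taylor coefficients. The same argument for
`S / J` in degrees at least `c` bounds the total weight of the pure diagrams of positive length
by `1`.

Finally, the Hilbert function of `I ^ k` in degree `d * k + e` counts, by lexicographically smallest
factorisations into generators, the elements of degree `k` in complements of upper sets of `ℕ ^ r`.
It is thus eventually a polynomial in `k`, so the Betti numbers of `I ^ k` are too, and the weights
are eventually rational functions of `k`.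
-/

noncomputable section

namespace BettiPowers

/-! ### Exterior operators -/

section ExteriorOperators

variable {ι : Type*} [LinearOrder ι] {R : Type*} [CommRing R]
  {W W' W'' Z Z' : Type*} [AddCommGroup W] [Module R W] [AddCommGroup W'] [Module R W']
  [AddCommGroup W''] [Module R W''] [AddCommGroup Z] [Module R Z] [AddCommGroup Z'] [Module R Z']

/-- The sign of `e_v ∧ e_B` against `e_{B ∪ {v}}`, for `v ∉ B`. -/
def koszulSign (B : Finset ι) (v : ι) : ℤ := (-1) ^ (B.filter (· < v)).card

theorem koszulSign_mul_self (B : Finset ι) (v : ι) : koszulSign B v * koszulSign B v = 1 := by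
  rw [koszulSign, ← mul_pow]; simp

theorem koszulSign_insert {B : Finset ι} {v w : ι} (hw : w ∉ B) :
    koszulSign (insert w B) v = if w < v then -koszulSign B v else koszulSign B v := by
  unfold koszulSign
  rw [Finset.filter_insert]
  split_ifs with h
  · rw [Finset.card_insert_of_notMem (by simp [hw]), pow_succ]; ring
  · rfl

theorem koszulSign_mul_koszulSign_insert {B : Finset ι} {v w : ι} (hv : v ∉ B) (hw : w ∉ B)
    (hvw : v ≠ w) :
    koszulSign B v * koszulSign (insert v B) w = -(koszulSign B w * koszulSign (insert w B) v) := by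
  rcases lt_or_gt_of_ne hvw with h | h <;>
    rw [koszulSign_insert hv, koszulSign_insert hw, if_pos h, if_neg h.not_gt] <;> ring

theorem koszulSign_insert_mul_koszulSign_insert {B : Finset ι} {v w : ι} (hv : v ∉ B) (hw : w ∉ B)
    (hvw : v ≠ w) :
    koszulSign (insert w B) v * koszulSign (insert v B) w =
      -(koszulSign B w * koszulSign B v) := by
  rcases lt_or_gt_of_ne hvw with h | h <;>
    rw [koszulSign_insert hv, koszulSign_insert hw, if_pos h, if_neg h.not_gt] <;> ring

variable (R) in
/-- Contraction of exterior chains `∑_B c(B) e_B` with the dual of the basis vector `e_v`. -/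
def contract (v : ι) : (Finset ι → W) →ₗ[R] (Finset ι → W) where
  toFun c B := if v ∈ B then 0 else koszulSign B v • c (insert v B)
  map_add' c c' := by funext B; by_cases h : v ∈ B <;> simp [h]
  map_smul' r c := by funext B; by_cases h : v ∈ B <;> simp [h, smul_comm r]

variable (R) in
/-- Exterior multiplication of chains `∑_B c(B) e_B` with the basis vector `e_v`. -/
def wedge (v : ι) : (Finset ι → W) →ₗ[R] (Finset ι → W) where
  toFun c B := if v ∈ B then koszulSign (B.erase v) v • c (B.erase v) else 0
  map_add' c c' := by funext B; by_cases h : v ∈ B <;> simp [h]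
  map_smul' r c := by funext B; by_cases h : v ∈ B <;> simp [h, smul_comm r]

theorem contract_apply_of_mem {v : ι} {B : Finset ι} (h : v ∈ B) (c : Finset ι → W) :
    contract R v c B = 0 := if_pos h

theorem contract_apply_of_notMem {v : ι} {B : Finset ι} (h : v ∉ B) (c : Finset ι → W) :
    contract R v c B = koszulSign B v • c (insert v B) := if_neg h

theorem wedge_apply_of_notMem {v : ι} {B : Finset ι} (h : v ∉ B) (c : Finset ι → W) :
    wedge R v c B = 0 := if_neg h

theorem wedge_apply_of_mem {v : ι} {B : Finset ι} (h : v ∈ B) (c : Finset ι → W) :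
    wedge R v c B = koszulSign (B.erase v) v • c (B.erase v) := if_pos h

theorem wedge_apply_insert {v : ι} {B : Finset ι} (h : v ∉ B) (c : Finset ι → W) :
    wedge R v c (insert v B) = koszulSign B v • c B := by
  rw [wedge_apply_of_mem (Finset.mem_insert_self v B), Finset.erase_insert h]

theorem contract_contract_self (v : ι) (c : Finset ι → W) :
    contract R v (contract R v c) = 0 := by
  funext B
  by_cases h : v ∈ B <;>
    simp [contract_apply_of_mem, contract_apply_of_notMem, h]

theorem contract_contract (v w : ι) (c : Finset ι → W) :
    contract R v (contract R w c) = -contract R w (contract R v c) := by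
  rcases eq_or_ne v w with rfl | hvw
  · simp only [contract_contract_self, neg_zero]
  funext B
  by_cases hB : v ∉ B ∧ w ∉ B
  · obtain ⟨hv, hw⟩ := hB
    rw [Pi.neg_apply, contract_apply_of_notMem hv, contract_apply_of_notMem hw,
      contract_apply_of_notMem (by simp [hw, hvw.symm]),
      contract_apply_of_notMem (by simp [hv, hvw]), smul_smul, smul_smul, ← neg_smul,
      koszulSign_mul_koszulSign_insert hv hw hvw, Finset.insert_comm w v]
  · by_cases hv : v ∈ B <;> by_cases hw : w ∈ B <;>
      simp_all [contract_apply_of_mem, contract_apply_of_notMem]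

theorem contract_wedge_self (v : ι) (c : Finset ι → W) :
    contract R v (wedge R v c) + wedge R v (contract R v c) = c := by
  funext B
  simp only [Pi.add_apply]
  by_cases hv : v ∈ B
  · rw [contract_apply_of_mem hv, wedge_apply_of_mem hv,
      contract_apply_of_notMem (Finset.notMem_erase v B), Finset.insert_erase hv, smul_smul,
      koszulSign_mul_self, one_smul, zero_add]
  · rw [contract_apply_of_notMem hv, wedge_apply_of_notMem hv, wedge_apply_insert hv, smul_smul,
      koszulSign_mul_self, one_smul, add_zero]

theorem contract_wedge_of_ne {v w : ι} (hvw : v ≠ w) (c : Finset ι → W) :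
    contract R v (wedge R w c) = -wedge R w (contract R v c) := by
  funext B
  simp only [Pi.neg_apply]
  by_cases hw : w ∈ B
  · obtain ⟨B, hw', rfl⟩ : ∃ B', w ∉ B' ∧ B = insert w B' :=
      ⟨B.erase w, Finset.notMem_erase w B, (Finset.insert_erase hw).symm⟩
    rw [wedge_apply_insert hw']
    by_cases hv : v ∈ B
    · rw [contract_apply_of_mem (Finset.mem_insert_of_mem hv), contract_apply_of_mem hv, smul_zero,
        neg_zero]
    · rw [contract_apply_of_notMem (by simp [hv, hvw]), contract_apply_of_notMem hv,
        Finset.insert_comm v w, wedge_apply_insert (by simp [hw', hvw.symm]), smul_smul, smul_smul,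
        koszulSign_insert_mul_koszulSign_insert hv hw' hvw, neg_smul]
  · rw [wedge_apply_of_notMem hw, neg_zero]
    by_cases hv : v ∈ B
    · rw [contract_apply_of_mem hv]
    · rw [contract_apply_of_notMem hv, wedge_apply_of_notMem (by simp [hw, hvw.symm]), smul_zero]

theorem contract_comp (f : W →ₗ[R] W') (v : ι) (c : Finset ι → W) :
    contract R v (f ∘ c) = f ∘ contract R v c := by
  funext B
  by_cases h : v ∈ B <;> simp [contract_apply_of_mem, contract_apply_of_notMem, h]

theorem wedge_comp (f : W →ₗ[R] W') (v : ι) (c : Finset ι → W) :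
    wedge R v (f ∘ c) = f ∘ wedge R v c := by
  funext B
  by_cases h : v ∈ B <;> simp [wedge_apply_of_mem, wedge_apply_of_notMem, h]

/-- The Koszul differential `∑_B c(B) e_B ↦ ∑_B ∑_{v ∈ S} x_v(c(B)) (e_v)^* ⌟ e_B` of operators
`x_v`, for `v` in `S`. The source and the target of the operators may differ, since on a graded
module they raise the degree. -/
def bdry (S : Finset ι) (x : ι → W →ₗ[R] W') : (Finset ι → W) →ₗ[R] (Finset ι → W') :=
  ∑ v ∈ S, ((x v).compLeft (Finset ι)) ∘ₗ contract R v

theorem bdry_apply (S : Finset ι) (x : ι → W →ₗ[R] W') (c : Finset ι → W) :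
    bdry S x c = ∑ v ∈ S, x v ∘ contract R v c := by
  simp only [bdry, LinearMap.sum_apply]; rfl

theorem bdry_apply_apply (S : Finset ι) (x : ι → W →ₗ[R] W') (c : Finset ι → W) (B : Finset ι) :
    bdry S x c B = ∑ v ∈ S, x v (contract R v c B) := by
  rw [bdry_apply, Finset.sum_apply]; rfl

theorem bdry_insert {S : Finset ι} {w : ι} (hw : w ∉ S) (x : ι → W →ₗ[R] W') (c : Finset ι → W) :
    bdry (insert w S) x c = x w ∘ contract R w c + bdry S x c := by
  rw [bdry_apply, bdry_apply, Finset.sum_insert hw]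

theorem bdry_insert_of_contract_eq_zero {S : Finset ι} {w : ι} (hw : w ∉ S) (x : ι → W →ₗ[R] W')
    {c : Finset ι → W} (hc : contract R w c = 0) : bdry (insert w S) x c = bdry S x c := by
  rw [bdry_insert hw, hc]
  funext B
  simp

theorem bdry_comp {S : Finset ι} {x : ι → W →ₗ[R] W'} {x' : ι → Z →ₗ[R] Z'} (f : W →ₗ[R] Z)
    (f' : W' →ₗ[R] Z') (h : ∀ v ∈ S, ∀ a, x' v (f a) = f' (x v a)) (c : Finset ι → W) :
    bdry S x' (f ∘ c) = f' ∘ bdry S x c := by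
  funext B
  rw [bdry_apply_apply, Function.comp_apply, bdry_apply_apply, map_sum]
  refine Finset.sum_congr rfl fun v hv => ?_
  rw [contract_comp, Function.comp_apply, h v hv]

theorem contract_bdry (S : Finset ι) (x : ι → W →ₗ[R] W') (w : ι) (c : Finset ι → W) :
    contract R w (bdry S x c) = -bdry S x (contract R w c) := by
  rw [bdry_apply, bdry_apply, map_sum, ← Finset.sum_neg_distrib]
  refine Finset.sum_congr rfl fun v _ => ?_
  rw [contract_comp, contract_contract]
  funext B
  simp

theorem bdry_bdry (S : Finset ι) {x : ι → W →ₗ[R] W'} {x' : ι → W' →ₗ[R] W''}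
    (hx : ∀ v w a, x' v (x w a) = x' w (x v a)) (c : Finset ι → W) :
    bdry S x' (bdry S x c) = 0 := by
  induction S using Finset.induction_on with
  | empty => rfl
  | insert w S hw ih =>
    have hcomm : bdry S x' (x w ∘ contract R w c) = x' w ∘ bdry S x (contract R w c) :=
      bdry_comp (x w) (x' w) (fun v _ a => hx v w a) _
    rw [bdry_insert hw x, map_add, bdry_insert hw, bdry_insert hw, contract_comp,
      contract_contract_self, contract_bdry, hcomm, ih]
    funext B
    simp

theorem bdry_wedge (S : Finset ι) (x : ι → W →ₗ[R] W') (w : ι) (c : Finset ι → W) :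
    bdry S x (wedge R w c) = (if w ∈ S then x w ∘ c else 0) - wedge R w (bdry S x c) := by
  have hterm (v : ι) : x v ∘ contract R v (wedge R w c) =
      (if w = v then x w ∘ c else 0) - wedge R w (x v ∘ contract R v c) := by
    rw [wedge_comp]
    split_ifs with hvw
    · subst hvw
      rw [eq_sub_of_add_eq (contract_wedge_self (R := R) w c)]
      funext B
      simp
    · rw [contract_wedge_of_ne (Ne.symm hvw)]
      funext B
      simp
  simp only [bdry_apply, map_sum, hterm, Finset.sum_sub_distrib, Finset.sum_ite_eq]

/-- Exterior multiplication with the vector `∑_{v ∈ S} a_v e_v`. -/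
def wedgeSum (S : Finset ι) (a : ι → R) : (Finset ι → W) →ₗ[R] (Finset ι → W) :=
  ∑ v ∈ S, a v • wedge R v

theorem bdry_wedgeSum (S : Finset ι) (a : ι → R) (x : ι → W →ₗ[R] W') (c : Finset ι → W) :
    bdry S x (wedgeSum S a c) =
      ⇑(∑ v ∈ S, a v • x v) ∘ c - wedgeSum S a (bdry S x c) := by
  have hterm : ∀ v ∈ S, a v • bdry S x (wedge R v c) + a v • wedge R v (bdry S x c) =
      a v • (x v ∘ c) := by
    intro v hv
    rw [bdry_wedge, if_pos hv, ← smul_add, sub_add_cancel]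
  simp only [wedgeSum, LinearMap.sum_apply, LinearMap.smul_apply, map_sum, map_smul]
  rw [eq_sub_iff_add_eq, ← Finset.sum_add_distrib, Finset.sum_congr rfl hterm]
  funext B
  simp [Finset.sum_apply]

theorem contract_wedgeSum {S : Finset ι} {a : ι → R} {w : ι} (hw : w ∈ S) (haw : a w = 1)
    (c : Finset ι → W) :
    contract R w (wedgeSum S a c) = c - wedgeSum S a (contract R w c) := by
  simp only [wedgeSum, LinearMap.sum_apply, LinearMap.smul_apply, map_sum, map_smul]
  rw [eq_sub_iff_add_eq, ← Finset.sum_add_distrib, Finset.sum_eq_single_of_mem w hw]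
  · rw [haw, one_smul, one_smul, contract_wedge_self]
  · intro v _ hv
    rw [contract_wedge_of_ne hv.symm, smul_neg, neg_add_cancel]

end ExteriorOperators

/-! ### Modules with a linear resolution -/

section LinearModules

universe u w

variable {ι : Type w} {K : Type u} [Field K] {V : ℕ → Type u}
  [∀ e, AddCommGroup (V e)] [∀ e, Module K (V e)] {x : (e : ℕ) → ι → V e →ₗ[K] V (e + 1)}
  {y : (e : ℕ) → V e →ₗ[K] V (e + 1)}

/-- The operators `x_v` commute, so that they make `⨁ V e` a graded module over the polynomial
ring in the variables `ι`. Such a module is encoded here by its graded pieces and these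
operators. -/
def PairwiseCommute (x : (e : ℕ) → ι → V e →ₗ[K] V (e + 1)) : Prop :=
  ∀ e v w m, x (e + 1) v (x e w m) = x (e + 1) w (x e v m)

/-- The action of the linear form `∑_{v ∈ S} a_v x_v` on a graded module. -/
def linearForm (S : Finset ι) (a : ι → K) (x : (e : ℕ) → ι → V e →ₗ[K] V (e + 1)) (e : ℕ) :
    V e →ₗ[K] V (e + 1) :=
  ∑ v ∈ S, a v • x e v

theorem PairwiseCommute.apply_linearForm (hx : PairwiseCommute x) (S : Finset ι) (a : ι → K)
    (e : ℕ) (v : ι) (m : V e) :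
    x (e + 1) v (linearForm S a x e m) = linearForm S a x (e + 1) (x e v m) := by
  simp only [linearForm, LinearMap.sum_apply, LinearMap.smul_apply, map_sum, map_smul, hx e v]

/-- The graded submodule `(0 :_{V 0} y) + y V`. The elements of `V 0` killed by `y` are included
because they are the only obstruction to `y` being a nonzerodivisor on a linear module. -/
def multiplesSubmodule (y : (e : ℕ) → V e →ₗ[K] V (e + 1)) : (e : ℕ) → Submodule K (V e)
  | 0 => LinearMap.ker (y 0)
  | e + 1 => LinearMap.range (y e)

theorem multiplesSubmodule_le_comap
    (hxy : ∀ e v a, x (e + 1) v (y e a) = y (e + 1) (x e v a))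
    (hinj : ∀ e, Function.Injective (y (e + 1))) (v : ι) :
    ∀ e, multiplesSubmodule y e ≤ (multiplesSubmodule y (e + 1)).comap (x e v)
  | 0 => by
    intro a (ha : y 0 a = 0)
    have : x 0 v a = 0 := hinj 0 (by rw [← hxy, ha, map_zero, map_zero])
    rw [Submodule.mem_comap, this]
    exact Submodule.zero_mem _
  | e + 1 => by
    rintro _ ⟨a, rfl⟩
    exact ⟨x e v a, (hxy e v a).symm⟩

/-- The operators that `x` induces on the quotient by `multiplesSubmodule y`. -/
def quotientOperators (hxy : ∀ e v a, x (e + 1) v (y e a) = y (e + 1) (x e v a))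
    (hinj : ∀ e, Function.Injective (y (e + 1))) (e : ℕ) (v : ι) :
    (V e ⧸ multiplesSubmodule y e) →ₗ[K] (V (e + 1) ⧸ multiplesSubmodule y (e + 1)) :=
  Submodule.mapQ _ _ (x e v) (multiplesSubmodule_le_comap hxy hinj v e)

theorem PairwiseCommute.quotientOperators (hx : PairwiseCommute x)
    (hxy : ∀ e v a, x (e + 1) v (y e a) = y (e + 1) (x e v a))
    (hinj : ∀ e, Function.Injective (y (e + 1))) :
    PairwiseCommute (quotientOperators hxy hinj) := by
  intro e v w m
  obtain ⟨m, rfl⟩ := Submodule.mkQ_surjective _ m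
  exact congrArg (multiplesSubmodule y (e + 1 + 1)).mkQ (hx e v w m)

variable [LinearOrder ι] {S : Finset ι}

/-- A graded module `⨁ V e` over the polynomial ring in the variables `S` has a linear resolution:
its Koszul homology is concentrated in chains with coefficients in `V 0`. -/
def IsLinear (S : Finset ι) (x : (e : ℕ) → ι → V e →ₗ[K] V (e + 1)) : Prop :=
  ∀ e (z : Finset ι → V (e + 1)), bdry S (x (e + 1)) z = 0 → ∃ u, bdry S (x e) u = z

/-- Such an element `m` gives the cycle `m e_S`, which is not a boundary unless it is zero. -/
theorem IsLinear.eq_zero_of_forall_mul_eq_zero (h : IsLinear S x) {e : ℕ} {m : V (e + 1)}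
    (hm : ∀ v ∈ S, x (e + 1) v m = 0) : m = 0 := by
  have hcycle : bdry S (x (e + 1)) (Pi.single S m) = 0 := by
    funext B
    rw [bdry_apply_apply, Pi.zero_apply]
    refine Finset.sum_eq_zero fun v hv => ?_
    by_cases hB : v ∈ B
    · rw [contract_apply_of_mem hB, map_zero]
    · by_cases hS : insert v B = S
      · rw [contract_apply_of_notMem hB, hS, Pi.single_eq_same, map_zsmul, hm v hv, smul_zero]
      · rw [contract_apply_of_notMem hB, Pi.single_eq_of_ne hS, smul_zero, map_zero]
  obtain ⟨u, hu⟩ := h e _ hcycle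
  calc m = bdry S (x e) u S := by rw [hu, Pi.single_eq_same]
    _ = 0 := by
      rw [bdry_apply_apply]
      exact Finset.sum_eq_zero fun v hv => by rw [contract_apply_of_mem hv, map_zero]

variable {ω : ι} {a : ι → K}

/-- If `∂z = y z'`, then `z - (∑ a_v e_v) ∧ z'` is a cycle. -/
theorem IsLinear.exists_lift_of_contract_eq_zero (h : IsLinear (insert ω S) x)
    (hx : PairwiseCommute x) (hω : ω ∉ S) (haω : a ω = 1)
    (hinj : ∀ e, Function.Injective (linearForm (insert ω S) a x (e + 1))) {e : ℕ}
    {z : Finset ι → V (e + 1)} (hzω : contract K ω z = 0)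
    (hz : ∀ B, bdry S (x (e + 1)) z B ∈ LinearMap.range (linearForm (insert ω S) a x (e + 1))) :
    ∃ u t, z = bdry S (x e) u + linearForm (insert ω S) a x e ∘ t := by
  set y := linearForm (insert ω S) a x
  have hωS := Finset.mem_insert_self ω S
  have eq_zero_of_comp {e : ℕ} {c : Finset ι → V (e + 1)} (hc : y (e + 1) ∘ c = 0) : c = 0 :=
    funext fun B => hinj e (by simpa using congrFun hc B)
  choose z' hz' using hz
  replace hz' : y (e + 1) ∘ z' = bdry S (x (e + 1)) z := funext hz'
  have hz'ω : contract K ω z' = 0 :=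
    eq_zero_of_comp (by rw [← contract_comp, hz', contract_bdry, hzω, map_zero, neg_zero])
  have hbdry_z' : bdry S (x (e + 1)) z' = 0 :=
    eq_zero_of_comp (by
      rw [← bdry_comp (x' := x (e + 1 + 1)) (y (e + 1)) (y (e + 1 + 1))
        (fun v _ m => hx.apply_linearForm _ a _ v m), hz', bdry_bdry _ (hx _)])
  have hcycle : bdry (insert ω S) (x (e + 1)) (z - wedgeSum (insert ω S) a z') = 0 := by
    rw [map_sub, bdry_wedgeSum, bdry_insert_of_contract_eq_zero hω _ hzω,
      bdry_insert_of_contract_eq_zero hω _ hz'ω, hbdry_z', ← hz', map_zero, sub_zero]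
    exact sub_self _
  obtain ⟨u, hu⟩ := h e _ hcycle
  have hbdry_u : bdry (insert ω S) (x e) (contract K ω u) = z' := by
    rw [← neg_eq_iff_eq_neg.mpr (contract_bdry (insert ω S) (x e) ω u), hu, map_sub, hzω,
      contract_wedgeSum hωS haω, hz'ω]
    simp
  refine ⟨u - wedgeSum (insert ω S) a (contract K ω u), contract K ω u, ?_⟩
  rw [← bdry_insert_of_contract_eq_zero hω, map_sub, bdry_wedgeSum, hu, hbdry_u]
  · exact (by abel : z = z - wedgeSum (insert ω S) a z' -
      (y e ∘ contract K ω u - wedgeSum (insert ω S) a z') + y e ∘ contract K ω u)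
  · rw [map_sub, contract_wedgeSum hωS haω, contract_contract_self]
    simp

theorem IsLinear.exists_bdry_quotientOperators_eq (h : IsLinear (insert ω S) x)
    (hx : PairwiseCommute x) (hω : ω ∉ S) (haω : a ω = 1)
    (hinj : ∀ e, Function.Injective (linearForm (insert ω S) a x (e + 1))) {e : ℕ}
    {z : Finset ι → V (e + 1)} (hzω : contract K ω z = 0)
    (hz : ∀ B, bdry S (x (e + 1)) z B ∈ LinearMap.range (linearForm (insert ω S) a x (e + 1))) :
    ∃ u, bdry S (quotientOperators (hx.apply_linearForm _ a) hinj e) u =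
      (multiplesSubmodule (linearForm (insert ω S) a x) (e + 1)).mkQ ∘ z := by
  obtain ⟨u, t, rfl⟩ := h.exists_lift_of_contract_eq_zero hx hω haω hinj hzω hz
  set y := linearForm (insert ω S) a x
  refine ⟨(multiplesSubmodule y e).mkQ ∘ u, ?_⟩
  rw [bdry_comp (multiplesSubmodule y e).mkQ (multiplesSubmodule y (e + 1)).mkQ (fun v _ m => rfl)]
  funext B
  have hyt : (multiplesSubmodule y (e + 1)).mkQ (y e (t B)) = 0 :=
    (Submodule.Quotient.mk_eq_zero _).mpr ⟨t B, rfl⟩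
  rw [Function.comp_apply, Function.comp_apply, Pi.add_apply, map_add, Function.comp_apply, hyt,
    add_zero]

/-- A cycle `z` is split as `ω^* ⌟ (ω ∧ z) + ω ∧ (ω^* ⌟ z)`, and both contractions lift. -/
theorem IsLinear.quotient (h : IsLinear (insert ω S) x) (hx : PairwiseCommute x) (hω : ω ∉ S)
    (haω : a ω = 1) (hinj : ∀ e, Function.Injective (linearForm (insert ω S) a x (e + 1))) :
    IsLinear S (quotientOperators (hx.apply_linearForm _ a) hinj) := by
  set y := linearForm (insert ω S) a x
  intro e z hz
  choose z₁ hz₁ using fun B => (multiplesSubmodule y (e + 1)).mkQ_surjective (z B)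
  obtain rfl : (multiplesSubmodule y (e + 1)).mkQ ∘ z₁ = z := funext hz₁
  rw [bdry_comp (multiplesSubmodule y (e + 1)).mkQ (multiplesSubmodule y (e + 1 + 1)).mkQ
      (fun v _ m => rfl)] at hz
  have hmem : ∀ B, bdry S (x (e + 1)) z₁ B ∈ LinearMap.range (y (e + 1)) := fun B =>
    (Submodule.Quotient.mk_eq_zero (multiplesSubmodule y (e + 1 + 1))).mp (congrFun hz B)
  choose t ht using hmem
  replace ht : bdry S (x (e + 1)) z₁ = y (e + 1) ∘ t := (funext ht).symm
  have hcontract (c : Finset ι → V (e + 1)) : bdry S (x (e + 1)) (contract K ω c) =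
      -contract K ω (bdry S (x (e + 1)) c) := by rw [contract_bdry, neg_neg]
  obtain ⟨b, hb⟩ := h.exists_bdry_quotientOperators_eq hx hω haω hinj
    (contract_contract_self ω z₁) fun B => ⟨-contract K ω t B, by
      rw [hcontract, ht, contract_comp]; simp [y]⟩
  obtain ⟨c, hc⟩ := h.exists_bdry_quotientOperators_eq hx hω haω hinj
    (contract_contract_self ω (wedge K ω z₁)) fun B => ⟨contract K ω (wedge K ω t) B, by
      rw [hcontract, bdry_wedge, if_neg hω, ht, wedge_comp, zero_sub, map_neg, neg_neg,
        contract_comp, Function.comp_apply]⟩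
  refine ⟨c - wedge K ω b, ?_⟩
  rw [map_sub, hc, bdry_wedge, if_neg hω, hb, zero_sub, sub_neg_eq_add, ← contract_comp,
    ← wedge_comp, ← contract_comp, contract_wedge_self]

end LinearModules

/-! ### Generic linear forms -/

section GenericLinearForm

universe u w

open TensorProduct

variable {ι : Type w} {K : Type u} [Field K] {V : ℕ → Type u}
  [∀ e, AddCommGroup (V e)] [∀ e, Module K (V e)] {W W' : Type u} [AddCommGroup W] [Module K W]
  [AddCommGroup W'] [Module K W'] {S : Finset ι} {f : ι → ℕ}

theorem leadingCoeff_mul_leadingCoeff_eq_zero {x : ι → W →ₗ[K] W'} (hf : Set.InjOn f S)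
    {g : ℕ → W} {N : ℕ} (hg : ∀ j, N < j → g j = 0) {v : ι} (hv : v ∈ S)
    (hx : ∀ w ∈ S, f v < f w → ∀ j, x w (g j) = 0)
    (hmul : ∑ w ∈ S, (if f w ≤ f v + N then x w (g (f v + N - f w)) else 0) = 0) :
    x v (g N) = 0 := by
  rwa [Finset.sum_eq_single_of_mem v hv, if_pos (Nat.le_add_right _ _),
    Nat.add_sub_cancel_left] at hmul
  intro w hw hwv
  split_ifs with hle
  · rcases lt_or_gt_of_ne (hf.ne hw hv hwv) with hlt | hlt
    · rw [hg _ (by omega), map_zero]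
    · exact hx w hw hlt _
  · rfl

/-- The generic linear form `∑ T ^ f v * x v` does not kill `∑ T ^ j * g j`: otherwise, for the
largest `f v` such that `x v * g ≠ 0`, it kills `x v * g`, which has smaller degree in `T`. -/
theorem eq_zero_of_generic_mul_eq_zero {x : (e : ℕ) → ι → V e →ₗ[K] V (e + 1)}
    (hx : PairwiseCommute x) (hf : Set.InjOn f S)
    (hsoc : ∀ e (m : V (e + 1)), (∀ v ∈ S, x (e + 1) v m = 0) → m = 0) (N : ℕ) :
    ∀ (e : ℕ) (g : ℕ → V (e + 1)), (∀ j, N ≤ j → g j = 0) →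
      (∀ j, ∑ v ∈ S, (if f v ≤ j then x (e + 1) v (g (j - f v)) else 0) = 0) → ∀ j, g j = 0 := by
  classical
  induction N with
  | zero => intro e g hg _ j; exact hg j (Nat.zero_le j)
  | succ N ih =>
    intro e g hg hmul j
    refine hsoc e _ ?_
    by_contra! ⟨v₀, hv₀, hne₀⟩
    obtain ⟨v, hv, hmax⟩ := Finset.exists_max_image (S.filter fun v => ∃ j, x (e + 1) v (g j) ≠ 0) f
      ⟨v₀, Finset.mem_filter.mpr ⟨hv₀, j, hne₀⟩⟩
    obtain ⟨hvS, i, hne⟩ := Finset.mem_filter.mp hv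
    have hlarger : ∀ w ∈ S, f v < f w → ∀ j, x (e + 1) w (g j) = 0 := by
      intro w hw hvw j
      by_contra hne
      exact hvw.not_ge (hmax w (Finset.mem_filter.mpr ⟨hw, j, hne⟩))
    refine hne (ih (e + 1) (fun j => x (e + 1) v (g j)) (fun j hj => ?_) (fun j => ?_) i)
    · rcases hj.eq_or_lt with rfl | hlt
      · exact leadingCoeff_mul_leadingCoeff_eq_zero hf hg hvS hlarger (hmul _)
      · rw [hg j hlt, map_zero]
    · have hmul_v := congrArg (x (e + 1 + 1) v) (hmul j)
      rw [map_zero, map_sum] at hmul_v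
      refine Eq.trans (Finset.sum_congr rfl fun w _ => ?_) hmul_v
      split_ifs
      · exact hx _ _ _ _
      · rw [map_zero]

/-- `∑ T ^ j ⊗ g j`, as an element of the base change of `W` along `K → K(T)`. -/
def polynomialTensor (K : Type u) [Field K] (W : Type u) [AddCommGroup W] [Module K W] :
    (ℕ →₀ W) →ₗ[K] RatFunc K ⊗[K] W :=
  (Finsupp.linearCombination K fun j : ℕ => (RatFunc.X : RatFunc K) ^ j).rTensor W ∘ₗ
    (TensorProduct.finsuppScalarLeft K W ℕ).symm.toLinearMap

theorem polynomialTensor_single (j : ℕ) (m : W) :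
    polynomialTensor K W (Finsupp.single j m) = ((RatFunc.X : RatFunc K) ^ j) ⊗ₜ m := by
  simp [polynomialTensor, TensorProduct.finsuppScalarLeft_symm_apply_single]

theorem linearIndependent_ratFunc_X_pow :
    LinearIndependent K fun j : ℕ => (RatFunc.X : RatFunc K) ^ j := by
  have h := (Polynomial.basisMonomials K).linearIndependent.map_injOn
    (IsScalarTower.toAlgHom K (Polynomial K) (RatFunc K)).toLinearMap
    (RatFunc.algebraMap_injective K).injOn
  convert h using 1
  funext j
  simp [← Polynomial.X_pow_eq_monomial]

theorem polynomialTensor_injective : Function.Injective (polynomialTensor K W) := by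
  refine (Module.Flat.rTensor_preserves_injective_linearMap _ ?_).comp (LinearEquiv.injective _)
  exact linearIndependent_ratFunc_X_pow

theorem polynomial_tmul_mem_range_polynomialTensor (p : Polynomial K) (m : W) :
    algebraMap (Polynomial K) (RatFunc K) p ⊗ₜ m ∈ LinearMap.range (polynomialTensor K W) := by
  rw [Polynomial.as_sum_range_C_mul_X_pow p, map_sum, TensorProduct.sum_tmul]
  refine Submodule.sum_mem _ fun j _ => ⟨Finsupp.single j (p.coeff j • m), ?_⟩
  rw [polynomialTensor_single, map_mul, map_pow, RatFunc.algebraMap_C, RatFunc.algebraMap_X,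
    TensorProduct.tmul_smul, TensorProduct.smul_tmul', ← RatFunc.algebraMap_eq_C, Algebra.smul_def]

theorem exists_smul_mem_range_polynomialTensor (m : RatFunc K ⊗[K] W) :
    ∃ q : RatFunc K, q ≠ 0 ∧ q • m ∈ LinearMap.range (polynomialTensor K W) := by
  classical
  obtain ⟨s, rfl⟩ := TensorProduct.exists_finset m
  obtain ⟨q, hq⟩ := IsLocalization.exist_integer_multiples (nonZeroDivisors (Polynomial K)) s
    fun i => i.1
  refine ⟨algebraMap (Polynomial K) (RatFunc K) q,
    RatFunc.algebraMap_ne_zero (nonZeroDivisors.ne_zero q.2), ?_⟩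
  rw [Finset.smul_sum]
  refine Submodule.sum_mem _ fun i hi => ?_
  obtain ⟨p, hp⟩ := hq i hi
  rw [TensorProduct.smul_tmul', smul_eq_mul, ← Algebra.smul_def]
  exact hp ▸ polynomial_tmul_mem_range_polynomialTensor p i.2

theorem baseChange_polynomialTensor (φ : W →ₗ[K] W') (i : ℕ) (g : ℕ →₀ W) :
    (RatFunc.X : RatFunc K) ^ i • φ.baseChange (RatFunc K) (polynomialTensor K W g) =
      polynomialTensor K W' ((g.mapRange φ (map_zero φ)).mapDomain (i + ·)) := by
  induction g using Finsupp.induction_linear with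
  | zero => simp
  | add g g' h h' =>
    rw [map_add, map_add, smul_add, h, h', Finsupp.mapRange_add (map_add φ), Finsupp.mapDomain_add,
      map_add]
  | single j m =>
    rw [polynomialTensor_single, LinearMap.baseChange_tmul, Finsupp.mapRange_single,
      Finsupp.mapDomain_single, polynomialTensor_single, TensorProduct.smul_tmul', pow_add,
      smul_eq_mul]

theorem mapDomain_add_left_apply (g : ℕ →₀ W) (i j : ℕ) :
    g.mapDomain (i + ·) j = if i ≤ j then g (j - i) else 0 := by
  split_ifs with hle
  · obtain ⟨j, rfl⟩ := Nat.exists_eq_add_of_le hle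
    rw [Nat.add_sub_cancel_left, Finsupp.mapDomain_apply (add_right_injective i)]
  · rw [Finsupp.mapDomain_of_notMem_range]
    rintro ⟨j, rfl⟩
    exact hle (Nat.le_add_right _ _)

theorem linearForm_baseChange_injective {x : (e : ℕ) → ι → V e →ₗ[K] V (e + 1)}
    (hx : PairwiseCommute x) (hf : Set.InjOn f S)
    (hsoc : ∀ e (m : V (e + 1)), (∀ v ∈ S, x (e + 1) v m = 0) → m = 0) (e : ℕ) :
    Function.Injective (linearForm (V := fun e => RatFunc K ⊗[K] V e) S
      (fun v => (RatFunc.X : RatFunc K) ^ f v) (fun e v => (x e v).baseChange (RatFunc K))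
      (e + 1)) := by
  rw [injective_iff_map_eq_zero]
  intro m hm
  obtain ⟨q, hq, g, hg⟩ := exists_smul_mem_range_polynomialTensor m
  have hmul : ∑ v ∈ S, polynomialTensor K (V (e + 1 + 1))
      ((g.mapRange (x (e + 1) v) (map_zero _)).mapDomain (f v + ·)) = 0 := by
    simp only [← baseChange_polynomialTensor, hg, map_smul, smul_comm _ q, ← Finset.smul_sum]
    simpa [linearForm, hq] using hm
  rw [← map_sum, map_eq_zero_iff _ polynomialTensor_injective] at hmul
  obtain ⟨N, hN⟩ := g.support.bddAbove
  have hg_zero : g = 0 := by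
    ext j
    refine eq_zero_of_generic_mul_eq_zero hx hf hsoc (N + 1) e g (fun j hj => ?_) (fun j => ?_) j
    · by_contra hne
      exact absurd (hN (Finsupp.mem_support_iff.mpr hne)) (by omega)
    · simpa [Finsupp.finsetSum_apply, mapDomain_add_left_apply] using DFunLike.congr_fun hmul j
  rw [hg_zero, map_zero] at hg
  exact (smul_eq_zero.mp hg.symm).resolve_left hq

end GenericLinearForm

/-! ### Hilbert series of linear modules -/

section HilbertSeries

universe u w

open TensorProduct

variable {ι : Type w} {K : Type u} [Field K] {V : ℕ → Type u}
  [∀ e, AddCommGroup (V e)] [∀ e, Module K (V e)] {x : (e : ℕ) → ι → V e →ₗ[K] V (e + 1)}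

theorem PairwiseCommute.baseChange (hx : PairwiseCommute x) (L : Type u) [Field L] [Algebra K L] :
    PairwiseCommute (V := fun e => L ⊗[K] V e) (fun e v => (x e v).baseChange L) := by
  intro e v w m
  induction m using TensorProduct.induction_on with
  | zero => simp
  | add a b ha hb => simp only [map_add, ha, hb]
  | tmul l m => simp only [LinearMap.baseChange_tmul, hx e v w m]

/-- The Hilbert series `∑ dim (V e) t ^ e` of a graded vector space. -/
def hilbertSeries (K : Type u) [Field K] (V : ℕ → Type u) [∀ e, AddCommGroup (V e)]
    [∀ e, Module K (V e)] : PowerSeries ℤ :=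
  PowerSeries.mk fun e => (Module.finrank K (V e) : ℤ)

theorem hilbertSeries_quotient_multiplesSubmodule [∀ e, FiniteDimensional K (V e)]
    {y : (e : ℕ) → V e →ₗ[K] V (e + 1)} (hinj : ∀ e, Function.Injective (y (e + 1))) :
    hilbertSeries K (fun e => V e ⧸ multiplesSubmodule y e) =
      (1 - PowerSeries.X) * (hilbertSeries K V -
        PowerSeries.C (Module.finrank K (LinearMap.ker (y 0)) : ℤ)) := by
  have hquot := fun e => (multiplesSubmodule y e).finrank_quotient_add_finrank
  ext e
  rw [hilbertSeries, hilbertSeries, sub_mul, one_mul, map_sub]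
  match e with
  | 0 =>
    have hquot_zero : _ + Module.finrank K (LinearMap.ker (y 0)) = _ := hquot 0
    simp only [PowerSeries.coeff_mk, PowerSeries.coeff_zero_X_mul, map_sub,
      PowerSeries.coeff_zero_C]
    omega
  | 1 =>
    have hquot_one : _ + Module.finrank K (LinearMap.range (y 0)) = _ := hquot 1
    have hrank := (y 0).finrank_range_add_finrank_ker
    simp only [PowerSeries.coeff_succ_X_mul, PowerSeries.coeff_mk, map_sub, PowerSeries.coeff_C,
      one_ne_zero, if_false, if_true]
    omega
  | e + 2 =>
    have hquot_succ : _ + Module.finrank K (LinearMap.range (y (e + 1))) = _ := hquot (e + 2)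
    have hrank := (y (e + 1)).finrank_range_add_finrank_ker
    rw [LinearMap.ker_eq_bot.mpr (hinj e), finrank_bot] at hrank
    simp only [PowerSeries.coeff_succ_X_mul, PowerSeries.coeff_mk, map_sub, PowerSeries.coeff_C,
      Nat.add_eq_zero_iff, one_ne_zero, OfNat.ofNat_ne_zero, and_false, if_false]
    omega

variable [LinearOrder ι] {S : Finset ι}

theorem IsLinear.subsingleton (h : IsLinear ∅ x) (e : ℕ) : Subsingleton (V (e + 1)) :=
  subsingleton_of_forall_eq 0 fun _ => h.eq_zero_of_forall_mul_eq_zero (by simp)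

theorem contract_tmul {W : Type u} [AddCommGroup W] [Module K W] (L : Type u) [Field L]
    [Algebra K L] (v : ι) (l : L) (c : Finset ι → W) (B : Finset ι) :
    contract L v (fun B => l ⊗ₜ[K] c B) B = l ⊗ₜ contract K v c B := by
  by_cases hv : v ∈ B
  · rw [contract_apply_of_mem hv, contract_apply_of_mem hv, tmul_zero]
  · rw [contract_apply_of_notMem hv, contract_apply_of_notMem hv]
    exact (map_zsmul (TensorProduct.mk K L W l) _ _).symm

theorem bdry_baseChange_piRight [Fintype ι] {W W' : Type u} [AddCommGroup W] [Module K W]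
    [AddCommGroup W'] [Module K W'] (L : Type u) [Field L] [Algebra K L] (S : Finset ι)
    (x : ι → W →ₗ[K] W') (c : L ⊗[K] (Finset ι → W)) :
    bdry (R := L) S (fun v => (x v).baseChange L) (piRight K K L (fun _ => W) c) =
      piRight K K L (fun _ => W') ((bdry S x).lTensor L c) := by
  induction c using TensorProduct.induction_on with
  | zero => simp
  | add a b ha hb => rw [map_add, map_add, ha, hb, map_add, map_add]
  | tmul l c =>
    funext B
    rw [LinearMap.lTensor_tmul, piRight_apply, piRight_apply, piRightHom_tmul, piRightHom_tmul,
      bdry_apply_apply]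
    simp only [bdry_apply_apply, tmul_sum, contract_tmul, LinearMap.baseChange_tmul]

variable [Finite ι]

theorem IsLinear.baseChange (h : IsLinear S x) (hx : PairwiseCommute x) (L : Type u) [Field L]
    [Algebra K L] : IsLinear (V := fun e => L ⊗[K] V e) S (fun e v => (x e v).baseChange L) := by
  have := Fintype.ofFinite ι
  intro e z hz
  have hexact : Function.Exact (bdry S (x e)) (bdry S (x (e + 1))) := fun c =>
    ⟨h e c, by rintro ⟨u, rfl⟩; exact bdry_bdry S (hx e) u⟩
  obtain ⟨c, rfl⟩ := (piRight K K L (fun _ : Finset ι => V (e + 1))).surjective z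
  rw [bdry_baseChange_piRight, LinearEquiv.map_eq_zero_iff] at hz
  obtain ⟨u, rfl⟩ := (Module.Flat.lTensor_exact L hexact c).mp hz
  exact ⟨piRight K K L (fun _ => V e) u, bdry_baseChange_piRight L S (x e) u⟩

/-- Over `K(T)` a generic linear form cuts a linear module down to a linear module in one variable
less. -/
theorem IsLinear.exists_quotient [∀ e, FiniteDimensional K (V e)] {ω : ι}
    (h : IsLinear (insert ω S) x) (hx : PairwiseCommute x) (hω : ω ∉ S) :
    ∃ (L : Type u) (_ : Field L) (V' : ℕ → Type u) (_ : ∀ e, AddCommGroup (V' e))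
      (_ : ∀ e, Module L (V' e)) (_ : ∀ e, FiniteDimensional L (V' e))
      (x' : (e : ℕ) → ι → V' e →ₗ[L] V' (e + 1)) (k : ℕ), PairwiseCommute x' ∧ IsLinear S x' ∧
        hilbertSeries L V' = (1 - PowerSeries.X) * (hilbertSeries K V - PowerSeries.C (k : ℤ)) := by
  obtain ⟨g, hg⟩ := Set.countable_iff_exists_injOn.mp (insert ω S).countable_toSet
  let f : ι → ℕ := fun v => Equiv.swap (g ω) 0 (g v)
  have hf : Set.InjOn f (insert ω S : Finset ι) := fun v hv w hw hvw =>
    hg hv hw ((Equiv.swap (g ω) 0).injective hvw)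
  have hfω : (RatFunc.X : RatFunc K) ^ f ω = 1 := by simp [f]
  have hinj := linearForm_baseChange_injective hx hf
    fun e m hm => h.eq_zero_of_forall_mul_eq_zero (e := e) hm
  have hxL := hx.baseChange (RatFunc K)
  have hseries := hilbertSeries_quotient_multiplesSubmodule hinj
  rw [show hilbertSeries (RatFunc K) (fun e => RatFunc K ⊗[K] V e) = hilbertSeries K V by
    simp only [hilbertSeries, Module.finrank_baseChange]] at hseries
  exact ⟨RatFunc K, inferInstance, _, _, _, inferInstance, _, _,
    hxL.quotientOperators (hxL.apply_linearForm _ _) hinj,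
    (h.baseChange hx (RatFunc K)).quotient hxL hω hfω hinj, hseries⟩

/-- The Hilbert series of a linear module is a non-negative combination of the Hilbert series
`1 / (1 - t) ^ j` of polynomial rings; `P` has the multiplicities as coefficients, reversed. -/
theorem IsLinear.exists_one_sub_X_pow_mul_hilbertSeries_eq (s : ℕ) :
    ∀ (K : Type u) [Field K] (V : ℕ → Type u) [∀ e, AddCommGroup (V e)] [∀ e, Module K (V e)]
      [∀ e, FiniteDimensional K (V e)] (S : Finset ι) (x : (e : ℕ) → ι → V e →ₗ[K] V (e + 1)),
      S.card = s → PairwiseCommute x → IsLinear S x →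
      ∃ P : Polynomial ℕ, (1 - PowerSeries.X) ^ s * hilbertSeries K V =
        ((P.map (Nat.castRingHom ℤ)).comp (1 - Polynomial.X)).toPowerSeries := by
  induction s with
  | zero =>
    intro K _ V _ _ _ S x hS _ h
    obtain rfl := Finset.card_eq_zero.mp hS
    have hV : hilbertSeries K V = PowerSeries.C (Module.finrank K (V 0) : ℤ) := by
      ext e
      match e with
      | 0 => simp [hilbertSeries]
      | e + 1 =>
        have := h.subsingleton e
        rw [hilbertSeries, PowerSeries.coeff_mk, PowerSeries.coeff_C_of_ne_zero e.succ_ne_zero,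
          Module.finrank_zero_of_subsingleton, Nat.cast_zero]
    exact ⟨Polynomial.C (Module.finrank K (V 0)), by
      rw [pow_zero, one_mul, hV, Polynomial.map_C, Polynomial.C_comp, Polynomial.coe_C, eq_natCast]⟩
  | succ s ih =>
    intro K _ V _ _ _ S x hS hx h
    obtain ⟨ω, S, hω, rfl, hS'⟩ := Finset.card_eq_succ.mp hS
    obtain ⟨L, _, V', _, _, _, x', k, hx', h', hV'⟩ := h.exists_quotient hx hω
    obtain ⟨P, hP⟩ := ih L V' S x' hS' hx' h'
    refine ⟨P + Polynomial.C k * Polynomial.X ^ (s + 1), ?_⟩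
    simp only [Polynomial.map_add, Polynomial.map_mul, Polynomial.map_C, Polynomial.map_pow,
      Polynomial.map_X, Nat.coe_castRingHom, Polynomial.add_comp, Polynomial.mul_comp,
      Polynomial.C_comp, Polynomial.X_pow_comp, Polynomial.coe_add, Polynomial.coe_mul,
      Polynomial.coe_C, Polynomial.coe_pow, Polynomial.coe_sub, Polynomial.coe_one,
      Polynomial.coe_X, ← hP, hV']
    ring

end HilbertSeries

/-! ### Koszul complexes of monomial ideals -/

section MonomialIdeals

universe u

open MvPolynomial

variable {K : Type u} [Field K] {n : ℕ}

theorem isHomogeneous_iff_degree {p : MvPolynomial (Fin n) K} {e : ℕ} :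
    p.IsHomogeneous e ↔ ∀ u, coeff u p ≠ 0 → u.degree = e := by
  rw [← mem_homogeneousSubmodule, homogeneousSubmodule_eq_finsupp_supported]
  exact ⟨fun h _ hu => h (mem_support_iff.mpr hu), fun h u hu => h u (mem_support_iff.mp hu)⟩

theorem mem_restrictSupport_iff_coeff {Y : Set (Fin n →₀ ℕ)} {p : MvPolynomial (Fin n) K} :
    p ∈ restrictSupport K Y ↔ ∀ u, coeff u p ≠ 0 → u ∈ Y :=
  ⟨fun h _ hu => h (mem_support_iff.mpr hu), fun h u hu => h u (mem_support_iff.mp hu)⟩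

variable (K n) in
/-- The Koszul differential of the polynomial ring, on not necessarily homogeneous chains. -/
def polyBdry : (Finset (Fin n) → MvPolynomial (Fin n) K) →ₗ[K]
    (Finset (Fin n) → MvPolynomial (Fin n) K) :=
  bdry Finset.univ fun v => LinearMap.mulLeft K (X v)

theorem polyBdry_polyBdry (c : Finset (Fin n) → MvPolynomial (Fin n) K) :
    polyBdry K n (polyBdry K n c) = 0 :=
  bdry_bdry _ (fun v w a => mul_left_comm (X v) (X w) a) c

theorem polyBdry_mul (p : MvPolynomial (Fin n) K) (c : Finset (Fin n) → MvPolynomial (Fin n) K)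
    (B : Finset (Fin n)) : polyBdry K n (fun B => p * c B) B = p * polyBdry K n c B :=
  congrFun (bdry_comp (LinearMap.mulLeft K p) (LinearMap.mulLeft K p)
    (fun v _ a => mul_left_comm (X v) p a) c) B

theorem polyBdry_wedge (v : Fin n) (c : Finset (Fin n) → MvPolynomial (Fin n) K)
    (B : Finset (Fin n)) :
    polyBdry K n (wedge K v c) B = X v * c B - wedge K v (polyBdry K n c) B := by
  rw [polyBdry, bdry_wedge, if_pos (Finset.mem_univ v)]
  rfl

theorem contract_mem (W : Submodule K (MvPolynomial (Fin n) K))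
    {c : Finset (Fin n) → MvPolynomial (Fin n) K} (hc : ∀ B, c B ∈ W) (v : Fin n)
    (B : Finset (Fin n)) : contract K v c B ∈ W := by
  by_cases hv : v ∈ B
  · rw [contract_apply_of_mem hv]; exact W.zero_mem
  · rw [contract_apply_of_notMem hv]; exact zsmul_mem (hc _) _

theorem wedge_mem (W : Submodule K (MvPolynomial (Fin n) K))
    {c : Finset (Fin n) → MvPolynomial (Fin n) K} (hc : ∀ B, c B ∈ W) (v : Fin n)
    (B : Finset (Fin n)) : wedge K v c B ∈ W := by
  by_cases hv : v ∈ B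
  · rw [wedge_apply_of_mem hv]; exact zsmul_mem (hc _) _
  · rw [wedge_apply_of_notMem hv]; exact W.zero_mem

theorem polyBdry_mem {W W' : Submodule K (MvPolynomial (Fin n) K)}
    (hW : ∀ v, ∀ p ∈ W, X v * p ∈ W') {c : Finset (Fin n) → MvPolynomial (Fin n) K}
    (hc : ∀ B, c B ∈ W) (B : Finset (Fin n)) : polyBdry K n c B ∈ W' := by
  rw [polyBdry, bdry_apply_apply]
  exact Submodule.sum_mem _ fun v _ => hW v _ (contract_mem W hc v B)

/-- The degree `e` part of an ideal. -/
def degreePart (J : Ideal (MvPolynomial (Fin n) K)) (e : ℕ) :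
    Submodule K (MvPolynomial (Fin n) K) :=
  J.restrictScalars K ⊓ homogeneousSubmodule (Fin n) K e

variable {J J' : Ideal (MvPolynomial (Fin n) K)} {U : Set (Fin n →₀ ℕ)} {D e : ℕ}

theorem mem_degreePart {p : MvPolynomial (Fin n) K} :
    p ∈ degreePart J e ↔ p ∈ J ∧ p.IsHomogeneous e := Iff.rfl

theorem degreePart_mono (h : J' ≤ J) (e : ℕ) : degreePart J' e ≤ degreePart J e :=
  inf_le_inf_right _ h

theorem polyBdry_mem_ideal {c : Finset (Fin n) → MvPolynomial (Fin n) K} (hc : ∀ B, c B ∈ J)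
    (B : Finset (Fin n)) : polyBdry K n c B ∈ J :=
  polyBdry_mem (W := J.restrictScalars K) (W' := J.restrictScalars K)
    (fun v _ hp => J.mul_mem_left (X v) hp) hc B

theorem X_mul_mem_degreePart (v : Fin n) {p : MvPolynomial (Fin n) K} (hp : p ∈ degreePart J e) :
    X v * p ∈ degreePart J (e + 1) :=
  ⟨J.mul_mem_left _ hp.1, add_comm 1 e ▸ (isHomogeneous_X K v).mul hp.2⟩

/-- Multiplication by a variable on the graded pieces of an ideal. -/
def mulVariable (J : Ideal (MvPolynomial (Fin n) K)) (e : ℕ) (v : Fin n) :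
    degreePart J e →ₗ[K] degreePart J (e + 1) :=
  (LinearMap.mulLeft K (X v)).restrict fun _ hp => X_mul_mem_degreePart v hp

theorem coe_bdry_mulVariable (c : Finset (Fin n) → degreePart J e) (B : Finset (Fin n)) :
    (bdry Finset.univ (mulVariable J e) c B : MvPolynomial (Fin n) K) =
      polyBdry K n (fun B => c B) B :=
  (congrFun (bdry_comp (degreePart J e).subtype (degreePart J (e + 1)).subtype
    (fun _ _ _ => rfl) c) B).symm

/-- The degree `D + e` part of `J / J'`. It is meant for `J' ≤ J`, and in general it is the
degree `D + e` part of `J / (J ⊓ J')`. -/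
def RelativePart (J J' : Ideal (MvPolynomial (Fin n) K)) (D e : ℕ) : Type u :=
  degreePart J (D + e) ⧸ (degreePart J' (D + e)).submoduleOf (degreePart J (D + e))

instance : AddCommGroup (RelativePart J J' D e) :=
  inferInstanceAs (AddCommGroup (_ ⧸ (degreePart J' (D + e)).submoduleOf (degreePart J (D + e))))

instance : Module K (RelativePart J J' D e) :=
  inferInstanceAs (Module K (_ ⧸ (degreePart J' (D + e)).submoduleOf (degreePart J (D + e))))

variable (J J' D e) in
/-- The projection of the degree `D + e` part of `J` to that of `J / J'`. -/
def toRelativePart : degreePart J (D + e) →ₗ[K] RelativePart J J' D e :=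
  Submodule.mkQ _

theorem toRelativePart_surjective : Function.Surjective (toRelativePart J J' D e) :=
  Submodule.mkQ_surjective _

theorem toRelativePart_eq_zero_iff {p : degreePart J (D + e)} :
    toRelativePart J J' D e p = 0 ↔ (p : MvPolynomial (Fin n) K) ∈ J' :=
  (Submodule.Quotient.mk_eq_zero _).trans (and_iff_left p.2.2)

/-- Multiplication by a variable on the graded pieces of `J / J'`. -/
def relativeMul (J J' : Ideal (MvPolynomial (Fin n) K)) (D e : ℕ) (v : Fin n) :
    RelativePart J J' D e →ₗ[K] RelativePart J J' D (e + 1) :=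
  Submodule.mapQ _ _ (mulVariable J (D + e) v) fun _ hp => X_mul_mem_degreePart v hp

theorem relativeMul_toRelativePart (v : Fin n) (p : degreePart J (D + e)) :
    relativeMul J J' D e v (toRelativePart J J' D e p) =
      toRelativePart J J' D (e + 1) (mulVariable J (D + e) v p) := rfl

theorem pairwiseCommute_relativeMul (J J' : Ideal (MvPolynomial (Fin n) K)) (D : ℕ) :
    PairwiseCommute (relativeMul J J' D) := by
  intro e v w m
  obtain ⟨p, rfl⟩ := toRelativePart_surjective m
  simp only [relativeMul_toRelativePart]
  exact congrArg _ (Subtype.ext (mul_left_comm (X v) (X w) (p : MvPolynomial (Fin n) K)))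

theorem bdry_relativeMul (c : Finset (Fin n) → degreePart J (D + e)) (B : Finset (Fin n)) :
    bdry Finset.univ (relativeMul J J' D e) (toRelativePart J J' D e ∘ c) B =
      toRelativePart J J' D (e + 1) (bdry Finset.univ (mulVariable J (D + e)) c B) :=
  congrFun (bdry_comp (toRelativePart J J' D e) (toRelativePart J J' D (e + 1))
    (fun v _ => relativeMul_toRelativePart v) c) B

/-- The Koszul complex of `J / J'` is exact at the chains with coefficients of degree `> D`. -/
def KoszulExactAbove (J J' : Ideal (MvPolynomial (Fin n) K)) (D : ℕ) : Prop :=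
  ∀ e, D ≤ e → ∀ c : Finset (Fin n) → MvPolynomial (Fin n) K,
    (∀ B, c B ∈ degreePart J (e + 1)) → (∀ B, polyBdry K n c B ∈ J') →
    ∃ b : Finset (Fin n) → MvPolynomial (Fin n) K,
      (∀ B, b B ∈ degreePart J e) ∧ ∀ B, c B - polyBdry K n b B ∈ J'

theorem KoszulExactAbove.isLinear (h : KoszulExactAbove J J' D) :
    IsLinear Finset.univ (relativeMul J J' D) := by
  intro e z hz
  obtain ⟨c, rfl⟩ : ∃ c, toRelativePart J J' D (e + 1) ∘ c = z :=
    toRelativePart_surjective.comp_left z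
  have hcycle (B : Finset (Fin n)) : polyBdry K n (fun B => c B) B ∈ J' := by
    rw [← coe_bdry_mulVariable, ← toRelativePart_eq_zero_iff (D := D) (e := e + 2)]
    exact (bdry_relativeMul c B).symm.trans (congrFun hz B)
  obtain ⟨b, hb, hcb⟩ := h (D + e) (Nat.le_add_right D e) (fun B => c B) (fun B => (c B).2) hcycle
  refine ⟨toRelativePart J J' D e ∘ fun B => ⟨b B, hb B⟩, ?_⟩
  funext B
  rw [bdry_relativeMul, Function.comp_apply, eq_comm, ← sub_eq_zero, ← map_sub,
    toRelativePart_eq_zero_iff, AddSubgroupClass.coe_sub, coe_bdry_mulVariable]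
  exact hcb B

/-- `J` is the monomial ideal spanned by the monomials with exponents in the upper set `U`. -/
def IsMonomialIdealOf (J : Ideal (MvPolynomial (Fin n) K)) (U : Set (Fin n →₀ ℕ)) : Prop :=
  IsUpperSet U ∧ ∀ p, p ∈ J ↔ ∀ u, coeff u p ≠ 0 → u ∈ U

theorem isMonomialIdealOf_restrictSupportIdeal (hU : IsUpperSet U) :
    IsMonomialIdealOf (restrictSupportIdeal K U hU) U :=
  ⟨hU, fun _ => mem_restrictSupport_iff_coeff⟩

theorem IsMonomialIdealOf.le {U' : Set (Fin n →₀ ℕ)} (hJ : IsMonomialIdealOf J U)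
    (hJ' : IsMonomialIdealOf J' U') (h : U' ⊆ U) : J' ≤ J := fun p hp =>
  (hJ.2 p).mpr fun u hu => h ((hJ'.2 p).mp hp u hu)

/-- The exponents of the monomials in the ideal generated by the monomials with exponents in `U`
whose degree in the variable `v` is at most `c`. -/
def generatedUpTo (U : Set (Fin n →₀ ℕ)) (v : Fin n) (c : ℕ) : Set (Fin n →₀ ℕ) :=
  {u | ∃ u₀ ∈ U, u₀ ≤ u ∧ u₀ v ≤ c}

theorem generatedUpTo_subset (hU : IsUpperSet U) (v : Fin n) (c : ℕ) : generatedUpTo U v c ⊆ U := by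
  rintro u ⟨u₀, h₀, hle, -⟩
  exact hU hle h₀

theorem isUpperSet_generatedUpTo (v : Fin n) (c : ℕ) : IsUpperSet (generatedUpTo U v c) := by
  rintro u u' huu' ⟨u₀, h₀, hle, hc⟩
  exact ⟨u₀, h₀, hle.trans huu', hc⟩

theorem mem_generatedUpTo_of_single_add {v : Fin n} {c : ℕ} {u : Fin n →₀ ℕ} (hc : c ≤ u v)
    (h : Finsupp.single v 1 + u ∈ generatedUpTo U v c) : u ∈ generatedUpTo U v c := by
  obtain ⟨u₀, h₀, hle, hle_c⟩ := h
  refine ⟨u₀, h₀, fun w => ?_, hle_c⟩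
  rcases eq_or_ne w v with rfl | hwv
  · exact hle_c.trans hc
  · simpa [Finsupp.single_apply, hwv.symm] using hle w

theorem mem_generatedUpTo_iff_of_le {v : Fin n} {c : ℕ} {u : Fin n →₀ ℕ} (hU : IsUpperSet U)
    (hu : u v ≤ c) : u ∈ generatedUpTo U v c ↔ u ∈ U :=
  ⟨fun h => generatedUpTo_subset hU v c h, fun h => ⟨u, h, le_rfl, hu⟩⟩

theorem IsMonomialIdealOf.exists_sub_X_mul_mem {v : Fin n} {c : ℕ} (hJ : IsMonomialIdealOf J U)
    (hJ' : IsMonomialIdealOf J' (generatedUpTo U v c)) {p : MvPolynomial (Fin n) K}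
    (hp : p ∈ degreePart J (e + 1)) :
    ∃ q : MvPolynomial (Fin n) K, q ∈ Ideal.span {monomial (Finsupp.single v c) (1 : K)} ∧
      q.IsHomogeneous e ∧ p - X v * q ∈ J' := by
  classical
  set s : Fin n →₀ ℕ := Finsupp.single v (c + 1)
  have hs : s = Finsupp.single v 1 + Finsupp.single v c := by rw [← Finsupp.single_add, add_comm]
  refine ⟨monomial (Finsupp.single v c) 1 * p.divMonomial s,
    Ideal.mul_mem_right _ _ (Ideal.mem_span_singleton_self _), ?_, ?_⟩
  · refine isHomogeneous_iff_degree.mpr fun u hu => ?_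
    rw [coeff_monomial_mul', one_mul] at hu
    split_ifs at hu with hle
    · rw [coeff_divMonomial, hs, add_assoc, add_tsub_cancel_of_le hle] at hu
      have hdeg := isHomogeneous_iff_degree.mp hp.2 _ hu
      rw [map_add, Finsupp.degree_single] at hdeg
      omega
    · exact absurd rfl hu
  · have hmod : p - X v * (monomial (Finsupp.single v c) 1 * p.divMonomial s) =
        p.modMonomial s := by
      rw [sub_eq_iff_eq_add', ← mul_assoc, X, monomial_mul, one_mul, ← hs,
        divMonomial_add_modMonomial]
    rw [hmod, hJ'.2]
    intro u hu
    have hlt : ¬ s ≤ u := fun hle => hu (coeff_modMonomial_of_le p hle)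
    rw [coeff_modMonomial_of_not_le p hlt] at hu
    exact ⟨u, (hJ.2 p).mp hp.1 u hu, le_rfl,
      Nat.lt_succ_iff.mp (not_le.mp fun h => hlt (Finsupp.single_le_iff.mpr h))⟩

theorem IsMonomialIdealOf.mem_of_X_mul_mem {v : Fin n} {c : ℕ}
    (hJ' : IsMonomialIdealOf J' (generatedUpTo U v c)) {p : MvPolynomial (Fin n) K}
    (hp : p ∈ Ideal.span {monomial (Finsupp.single v c) (1 : K)}) (h : X v * p ∈ J') : p ∈ J' := by
  classical
  obtain ⟨q, rfl⟩ := Ideal.mem_span_singleton.mp hp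
  refine (hJ'.2 _).mpr fun u hu => ?_
  have hle : Finsupp.single v c ≤ u := by
    by_contra hle
    exact hu (by rw [coeff_monomial_mul', if_neg hle])
  exact mem_generatedUpTo_of_single_add (Finsupp.single_le_iff.mp hle)
    ((hJ'.2 _).mp h _ (by rwa [coeff_X_mul]))

/-- A cycle `z` of `J / J'` is `X v * z'` modulo `J'`, hence also the differential of `e_v ∧ z'`;
exactness of the Koszul complex of `S / J` moves `e_v ∧ z'` into `J`. -/
theorem KoszulExactAbove.of_generatedUpTo {v : Fin n} {c : ℕ} (h : KoszulExactAbove ⊤ J D)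
    (hJ : IsMonomialIdealOf J U) (hJ' : IsMonomialIdealOf J' (generatedUpTo U v c)) :
    KoszulExactAbove J J' (D + 1) := by
  intro e he z hz hzJ'
  obtain ⟨E, rfl⟩ : ∃ E, e = E + 1 := ⟨e - 1, by omega⟩
  have hJ'J : J' ≤ J := hJ.le hJ' (generatedUpTo_subset hJ.1 v c)
  choose z' hz'span hz'deg hzz' using fun B => hJ.exists_sub_X_mul_mem hJ' (hz B)
  have hz'cycle (B : Finset (Fin n)) : polyBdry K n z' B ∈ J' := by
    refine hJ'.mem_of_X_mul_mem (polyBdry_mem_ideal hz'span B) ?_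
    rw [← polyBdry_mul]
    have := J'.sub_mem (hzJ' B) (polyBdry_mem_ideal hzz' B)
    rwa [show (fun B => z B - X v * z' B) = z - fun B => X v * z' B from rfl, map_sub,
      Pi.sub_apply, sub_sub_cancel] at this
  have hwedge (B : Finset (Fin n)) : z B - polyBdry K n (wedge K v z') B ∈ J' := by
    rw [polyBdry_wedge, ← sub_add]
    exact J'.add_mem (hzz' B) (wedge_mem (J'.restrictScalars K) hz'cycle v B)
  have hwedge_deg := wedge_mem (homogeneousSubmodule (Fin n) K (E + 1)) hz'deg v
  obtain ⟨b, hb, hwb⟩ := h E (by omega) (wedge K v z') (fun B => ⟨trivial, hwedge_deg B⟩)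
    fun B => (J.sub_mem_iff_right (hz B).1).mp (hJ'J (hwedge B))
  refine ⟨wedge K v z' - polyBdry K n b, fun B => ⟨hwb B, ?_⟩, fun B => ?_⟩
  · exact (hwedge_deg B).sub (polyBdry_mem (W' := degreePart ⊤ (E + 1))
      (fun v _ hp => X_mul_mem_degreePart v hp) hb B).2
  · rw [map_sub, polyBdry_polyBdry, sub_zero]
    exact hwedge B

end MonomialIdeals

/-! ### Betti numbers and Hilbert series -/

section KoszulHomology

universe u

open MvPolynomial

variable {K : Type u} [Field K] {n : ℕ} {J J' : Ideal (MvPolynomial (Fin n) K)} {D e i j : ℕ}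

instance : FiniteDimensional K (homogeneousSubmodule (Fin n) K e) :=
  Module.Finite.iff_fg.mpr (homogeneousSubmodule_fg (Fin n) K e)

instance : FiniteDimensional K (degreePart J e) :=
  Submodule.finiteDimensional_of_le inf_le_right

instance : FiniteDimensional K (RelativePart J J' D e) :=
  Module.Finite.of_surjective _ toRelativePart_surjective

instance : FiniteDimensional K (quotientDegree J e) := by
  unfold quotientDegree
  infer_instance

theorem finrank_relativePart (h : J' ≤ J) :
    Module.finrank K (RelativePart J J' D e) + Module.finrank K (degreePart J' (D + e)) =
      Module.finrank K (degreePart J (D + e)) := by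
  rw [← (Submodule.submoduleOfEquivOfLe (degreePart_mono h (D + e))).finrank_eq]
  exact Submodule.finrank_quotient_add_finrank _

theorem finrank_map_add_finrank_inf_ker {M M' : Type*} [AddCommGroup M] [Module K M]
    [AddCommGroup M'] [Module K M'] (f : M →ₗ[K] M') (W : Submodule K M) [FiniteDimensional K W] :
    Module.finrank K (W.map f) + Module.finrank K (W ⊓ LinearMap.ker f : Submodule K M) =
      Module.finrank K W := by
  have h := (f.domRestrict W).finrank_range_add_finrank_ker
  rw [LinearMap.range_domRestrict, LinearMap.ker_domRestrict] at h
  rw [← h, ← (Submodule.comapSubtypeEquivOfLe inf_le_left).finrank_eq, Submodule.comap_inf,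
    Submodule.comap_subtype_self, top_inf_eq]

theorem finrank_quotientDegree (J : Ideal (MvPolynomial (Fin n) K)) (e : ℕ) :
    Module.finrank K (quotientDegree J e) + Module.finrank K (degreePart J e) =
      Module.finrank K (degreePart (⊤ : Ideal (MvPolynomial (Fin n) K)) e) := by
  have hker : LinearMap.ker (Ideal.Quotient.mkₐ K J).toLinearMap = J.restrictScalars K :=
    Submodule.ext fun _ => Ideal.Quotient.eq_zero_iff_mem
  have htop : degreePart (⊤ : Ideal (MvPolynomial (Fin n) K)) e = homogeneousSubmodule _ K e :=
    top_inf_eq _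
  have h := finrank_map_add_finrank_inf_ker (Ideal.Quotient.mkₐ K J).toLinearMap
    (homogeneousSubmodule (Fin n) K e)
  rw [hker, inf_comm] at h
  rw [htop]
  exact h

/-- The Hilbert series of an ideal. -/
def idealSeries (J : Ideal (MvPolynomial (Fin n) K)) : PowerSeries ℤ :=
  hilbertSeries K fun e => degreePart J e

theorem coeff_idealSeries (J : Ideal (MvPolynomial (Fin n) K)) (e : ℕ) :
    PowerSeries.coeff e (idealSeries J) = Module.finrank K (degreePart J e) :=
  PowerSeries.coeff_mk e fun e => (Module.finrank K (degreePart J e) : ℤ)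

/-- A product of submodules is the product of the underlying modules. -/
def submodulePiEquiv {R ι M : Type*} [CommRing R] [AddCommGroup M] [Module R M]
    (p : ι → Submodule R M) : Submodule.pi Set.univ p ≃ₗ[R] ((i : ι) → p i) where
  toFun c i := ⟨c.1 i, c.2 i trivial⟩
  invFun c := ⟨fun i => c i, fun i _ => (c i).2⟩
  map_add' _ _ := rfl
  map_smul' _ _ := rfl
  left_inv _ := rfl
  right_inv _ := rfl

instance (A : Finset (Fin n)) : FiniteDimensional K
    (if A.card = i ∧ i ≤ j then quotientDegree J (j - i) else ⊥ : Submodule K _) := by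
  by_cases h : A.card = i ∧ i ≤ j
  · rw [if_pos h]; infer_instance
  · rw [if_neg h]; infer_instance

instance : FiniteDimensional K (koszulChains J i j) :=
  Module.Finite.equiv (submodulePiEquiv _).symm

instance : FiniteDimensional K (koszulCycles J i j) :=
  Submodule.finiteDimensional_of_le inf_le_left

theorem mem_koszulChains {c : KoszulChain J} :
    c ∈ koszulChains J i j ↔
      ∀ A, c A ∈ (if A.card = i ∧ i ≤ j then quotientDegree J (j - i) else ⊥ : Submodule K _) := by
  simp only [koszulChains, Submodule.mem_pi, Set.mem_univ, true_implies]

theorem finrank_koszulChains (J : Ideal (MvPolynomial (Fin n) K)) (i j : ℕ) :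
    Module.finrank K (koszulChains J i j) =
      if i ≤ j then n.choose i * Module.finrank K (quotientDegree J (j - i)) else 0 := by
  have hterm (A : Finset (Fin n)) : Module.finrank K
      (if A.card = i ∧ i ≤ j then quotientDegree J (j - i) else ⊥ : Submodule K _) =
      if A.card = i then
        if i ≤ j then Module.finrank K (quotientDegree J (j - i)) else 0
      else 0 := by
    rw [← ite_and]
    by_cases h : A.card = i ∧ i ≤ j
    · rw [if_pos h, if_pos h]
    · rw [if_neg h, if_neg h, finrank_bot]
  rw [koszulChains, (submodulePiEquiv _).finrank_eq, Module.finrank_pi_fintype,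
    Finset.sum_congr rfl fun A _ => hterm A, ← Finset.sum_filter, Finset.univ_filter_card_eq,
    Finset.sum_const, Finset.card_powersetCard, Finset.card_univ, Fintype.card_fin, smul_eq_mul,
    mul_ite, mul_zero]

theorem koszulChains_eq_bot_of_lt (h : j < i) : koszulChains J i j = ⊥ := by
  rw [← Submodule.finrank_eq_zero, finrank_koszulChains, if_neg (by omega)]

theorem koszulChains_eq_bot_of_card_lt (h : n < i) (j : ℕ) : koszulChains J i j = ⊥ := by
  rw [← Submodule.finrank_eq_zero, finrank_koszulChains, Nat.choose_eq_zero_of_lt h, zero_mul,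
    ite_self]

theorem map_koszulDifferential_koszulChains_zero (j : ℕ) :
    (koszulChains J 0 j).map (koszulDifferential J) = ⊥ := by
  rw [eq_bot_iff]
  rintro _ ⟨c, hc, rfl⟩
  refine (Submodule.mem_bot K).mpr (funext fun B => Finset.sum_eq_zero fun a _ => ?_)
  have hzero := mem_koszulChains.mp hc (insert a B)
  rw [if_neg (fun h => (Finset.insert_nonempty a B).card_ne_zero h.1), Submodule.mem_bot] at hzero
  rw [hzero, mul_zero, mul_zero]

theorem betti_add_finrank_koszulBoundaries (J : Ideal (MvPolynomial (Fin n) K)) (i j : ℕ) :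
    betti J i j + Module.finrank K (koszulBoundaries J i j) =
      Module.finrank K (koszulCycles J i j) := by
  rw [← (Submodule.submoduleOfEquivOfLe (koszulBoundaries_le_koszulCycles J i j)).finrank_eq]
  exact Submodule.finrank_quotient_add_finrank _

theorem betti_eq_zero_iff : betti J i j = 0 ↔ koszulCycles J i j ≤ koszulBoundaries J i j := by
  have hle := koszulBoundaries_le_koszulCycles J i j
  have hadd := betti_add_finrank_koszulBoundaries J i j
  refine ⟨fun h => (Submodule.eq_of_le_of_finrank_eq hle (by omega)).ge, fun h => ?_⟩
  rw [le_antisymm h hle] at hadd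
  omega

theorem betti_eq_zero_of_koszulChains_eq_bot (h : koszulChains J i j = ⊥) : betti J i j = 0 :=
  betti_eq_zero_iff.mpr (by rw [koszulCycles, h, bot_inf_eq]; exact bot_le)

theorem sum_finrank_koszulChains (J : Ideal (MvPolynomial (Fin n) K)) (j N : ℕ) :
    ∑ i ∈ Finset.range (N + 1), (-1 : ℤ) ^ i * Module.finrank K (koszulChains J i j) =
      ∑ i ∈ Finset.range (N + 1), (-1 : ℤ) ^ i * betti J i j +
        (-1) ^ N * Module.finrank K (koszulBoundaries J N j) := by
  have hrank (i : ℕ) : Module.finrank K ((koszulChains J i j).map (koszulDifferential J)) +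
      (betti J i j + Module.finrank K (koszulBoundaries J i j)) =
        Module.finrank K (koszulChains J i j) := by
    rw [betti_add_finrank_koszulBoundaries, koszulCycles, finrank_map_add_finrank_inf_ker]
  induction N with
  | zero =>
    rw [Finset.sum_range_one, Finset.sum_range_one, ← hrank,
      map_koszulDifferential_koszulChains_zero, finrank_bot]
    push_cast
    ring
  | succ N ih =>
    rw [Finset.sum_range_succ, ih, Finset.sum_range_succ _ (N + 1), ← hrank (N + 1),
      ← koszulBoundaries]
    push_cast
    ring

theorem coeff_one_sub_X_pow_mul {R : Type*} [CommRing R] (f : PowerSeries R) (n j : ℕ) :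
    PowerSeries.coeff j ((1 - PowerSeries.X) ^ n * f) = ∑ i ∈ Finset.range (n + 1),
      (-1) ^ i * (if i ≤ j then n.choose i * PowerSeries.coeff (j - i) f else 0) := by
  have hterm (i : ℕ) :
      (-PowerSeries.X : PowerSeries R) ^ i * 1 ^ (n - i) * (n.choose i : PowerSeries R) * f =
      PowerSeries.C ((-1) ^ i * (n.choose i : R)) * (PowerSeries.X ^ i * f) := by
    rw [neg_pow, one_pow, map_mul, map_pow, map_neg, map_one, map_natCast]
    ring
  rw [sub_eq_neg_add, add_pow, Finset.sum_mul, map_sum]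
  refine Finset.sum_congr rfl fun i _ => ?_
  rw [hterm, PowerSeries.coeff_C_mul, PowerSeries.coeff_X_pow_mul', mul_assoc, mul_ite, mul_zero]

theorem sum_neg_one_pow_mul_betti (J : Ideal (MvPolynomial (Fin n) K)) (j : ℕ) :
    ∑ i ∈ Finset.range (n + 1), (-1 : ℤ) ^ i * betti J i j =
      PowerSeries.coeff j ((1 - PowerSeries.X) ^ n *
        (idealSeries (⊤ : Ideal (MvPolynomial (Fin n) K)) - idealSeries J)) := by
  have hsum := sum_finrank_koszulChains J j n
  rw [koszulBoundaries, koszulChains_eq_bot_of_card_lt (J := J) n.lt_succ_self, Submodule.map_bot,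
    finrank_bot, Nat.cast_zero, mul_zero, add_zero] at hsum
  rw [← hsum, coeff_one_sub_X_pow_mul]
  refine Finset.sum_congr rfl fun i _ => ?_
  rw [finrank_koszulChains, map_sub, coeff_idealSeries, coeff_idealSeries,
    ← finrank_quotientDegree J (j - i)]
  push_cast
  rw [add_sub_cancel_right]

variable (J) in
/-- The reduction modulo `J` of a chain with polynomial coefficients. -/
def mkChain : (Finset (Fin n) → MvPolynomial (Fin n) K) →ₗ[K] KoszulChain J :=
  (Ideal.Quotient.mkₐ K J).toLinearMap.compLeft (Finset (Fin n))

theorem mkChain_apply (c : Finset (Fin n) → MvPolynomial (Fin n) K) (A : Finset (Fin n)) :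
    mkChain J c A = Ideal.Quotient.mk J (c A) := rfl

theorem mkChain_eq_mkChain_iff {c c' : Finset (Fin n) → MvPolynomial (Fin n) K} :
    mkChain J c = mkChain J c' ↔ ∀ B, c B - c' B ∈ J :=
  funext_iff.trans (forall_congr' fun _ => Ideal.Quotient.mk_eq_mk_iff_sub_mem _ _)

theorem koszulDifferential_mkChain (c : Finset (Fin n) → MvPolynomial (Fin n) K) :
    koszulDifferential J (mkChain J c) = mkChain J (polyBdry K n c) := by
  funext B
  rw [mkChain_apply, polyBdry, bdry_apply_apply, map_sum]
  refine Finset.sum_subset_zero_on_sdiff (Finset.subset_univ Bᶜ) (fun a ha => ?_) fun a ha => ?_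
  · rw [contract_apply_of_mem (by simpa using ha), map_zero, map_zero]
  · rw [contract_apply_of_notMem (Finset.mem_compl.mp ha), LinearMap.mulLeft_apply, koszulSign,
      zsmul_eq_mul, map_mul, map_mul, map_intCast, Int.cast_pow, Int.cast_neg, Int.cast_one,
      mul_left_comm]
    rfl

/-- The component of homological degree `i` of a chain. -/
def homologicalPart {M : Type*} [Zero M] (i : ℕ) (c : Finset (Fin n) → M) : Finset (Fin n) → M :=
  fun A => if A.card = i then c A else 0

theorem sum_homologicalPart {M : Type*} [AddCommMonoid M] (c : Finset (Fin n) → M) :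
    ∑ i ∈ Finset.range (n + 1), homologicalPart i c = c := by
  funext A
  have hA : A.card < n + 1 := Nat.lt_succ_of_le (card_finset_fin_le A)
  simp only [Finset.sum_apply, homologicalPart, Finset.sum_ite_eq, Finset.mem_range, if_pos hA]

theorem polyBdry_homologicalPart_apply (i : ℕ) (c : Finset (Fin n) → MvPolynomial (Fin n) K)
    (B : Finset (Fin n)) :
    polyBdry K n (homologicalPart i c) B = if B.card + 1 = i then polyBdry K n c B else 0 := by
  have hcontract (v : Fin n) : contract K v (homologicalPart i c) B =
      if B.card + 1 = i then contract K v c B else 0 := by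
    by_cases hv : v ∈ B
    · rw [contract_apply_of_mem hv, contract_apply_of_mem hv, ite_self]
    · rw [contract_apply_of_notMem hv, contract_apply_of_notMem hv, homologicalPart,
        Finset.card_insert_of_notMem hv, smul_ite, smul_zero]
  simp only [polyBdry, bdry_apply_apply, hcontract]
  split_ifs
  · rfl
  · simp only [map_zero, Finset.sum_const_zero]

theorem mem_koszulChains_add_iff {c : KoszulChain J} : c ∈ koszulChains J i (i + e) ↔
    ∃ f, (∀ A, (f A).IsHomogeneous e) ∧ mkChain J (homologicalPart i f) = c := by
  rw [mem_koszulChains]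
  simp only [Nat.le_add_right, and_true, Nat.add_sub_cancel_left]
  constructor
  · intro hc
    have hlift (A : Finset (Fin n)) : ∃ f : MvPolynomial (Fin n) K, f.IsHomogeneous e ∧
        Ideal.Quotient.mk J (if A.card = i then f else 0) = c A := by
      have hcA := hc A
      split_ifs at hcA ⊢ with hA
      · exact hcA
      · exact ⟨0, isHomogeneous_zero _ _ _, (map_zero _).trans ((Submodule.mem_bot K).mp hcA).symm⟩
    choose f hf hfc using hlift
    exact ⟨f, hf, funext hfc⟩
  · rintro ⟨f, hf, rfl⟩ A
    rw [mkChain_apply, homologicalPart]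
    split_ifs with hA
    · exact ⟨f A, hf A, rfl⟩
    · rw [map_zero]; exact Submodule.zero_mem _

theorem polyBdry_single_singleton (v : Fin n) (q : MvPolynomial (Fin n) K) :
    polyBdry K n (Pi.single {v} q) = Pi.single ∅ (X v * q) := by
  funext B
  have hcontract (w : Fin n) (hwB : ¬ (w = v ∧ B = ∅)) :
      contract K w (Pi.single {v} q) B = 0 := by
    by_cases hw : w ∈ B
    · exact contract_apply_of_mem hw _
    · have hne : insert w B ≠ {v} := by
        intro h
        obtain rfl : w = v := Finset.mem_singleton.mp (h ▸ Finset.mem_insert_self w B)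
        refine hwB ⟨rfl, ?_⟩
        rw [← Finset.erase_insert hw, h, Finset.erase_singleton]
      rw [contract_apply_of_notMem hw, Pi.single_eq_of_ne hne, smul_zero]
  rw [polyBdry, bdry_apply_apply, Finset.sum_eq_single v
    (fun w _ hw => by rw [hcontract w fun h => hw h.1, map_zero])
    fun h => absurd (Finset.mem_univ v) h]
  rcases B.eq_empty_or_nonempty with rfl | hB
  · rw [contract_apply_of_notMem (Finset.notMem_empty v), insert_empty_eq, Pi.single_eq_same,
      Pi.single_eq_same, koszulSign, Finset.filter_empty, Finset.card_empty, pow_zero, one_smul]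
    rfl
  · rw [hcontract v fun h => hB.ne_empty h.2, map_zero, Pi.single_eq_of_ne hB.ne_empty]

theorem mkChain_single_mem_koszulChains {q : MvPolynomial (Fin n) K} (hq : q.IsHomogeneous e)
    (A : Finset (Fin n)) : mkChain J (Pi.single A q) ∈ koszulChains J A.card (A.card + e) := by
  refine mem_koszulChains_add_iff.mpr ⟨Pi.single A q, fun B => ?_, congrArg _ (funext fun B => ?_)⟩
  · rcases eq_or_ne B A with rfl | hBA
    · rwa [Pi.single_eq_same]
    · rw [Pi.single_eq_of_ne hBA]; exact isHomogeneous_zero _ _ _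
  · rcases eq_or_ne B A with rfl | hBA
    · exact if_pos rfl
    · rw [homologicalPart, Pi.single_eq_of_ne hBA, ite_self]

theorem betti_zero_eq_zero (hj : 1 ≤ j) : betti J 0 j = 0 := by
  obtain ⟨e, rfl⟩ : ∃ e, j = 0 + (e + 1) := ⟨j - 1, by omega⟩
  have hboundary : homogeneousSubmodule (Fin n) K (e + 1) ≤
      (koszulBoundaries J 0 (0 + (e + 1))).comap (mkChain J ∘ₗ LinearMap.single K _ ∅) := by
    rw [← homogeneousSubmodule_one_pow, pow_succ', homogeneousSubmodule_one_pow,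
      homogeneousSubmodule_one_eq_span_X, ← Submodule.span_eq (homogeneousSubmodule (Fin n) K e),
      Submodule.span_mul_span, Submodule.span_le]
    rintro _ ⟨_, ⟨v, rfl⟩, q, hq, rfl⟩
    refine ⟨mkChain J (Pi.single {v} q), ?_, ?_⟩
    · have := mkChain_single_mem_koszulChains (J := J) hq {v}
      rwa [Finset.card_singleton, add_comm 1 e, ← zero_add 1, ← zero_add (e + (0 + 1))] at this
    · rw [koszulDifferential_mkChain, polyBdry_single_singleton]
      rfl
  refine betti_eq_zero_iff.mpr fun c hc => ?_
  obtain ⟨f, hf, rfl⟩ := mem_koszulChains_add_iff.mp hc.1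
  have hsingle : homologicalPart 0 f = Pi.single ∅ (f ∅) := by
    funext A
    rcases A.eq_empty_or_nonempty with rfl | hA
    · rw [Pi.single_eq_same]; rfl
    · rw [Pi.single_eq_of_ne hA.ne_empty, homologicalPart, if_neg hA.card_ne_zero]
  rw [hsingle]
  exact hboundary (hf ∅)

theorem HasLinearResolution.koszulExactAbove {c : ℕ} (h : HasLinearResolution J (c + 1)) :
    KoszulExactAbove ⊤ J c := by
  intro e he z hz hzJ
  have hboundary (i : ℕ) : ∃ b : Finset (Fin n) → MvPolynomial (Fin n) K,
      (∀ B, (b B).IsHomogeneous e) ∧ ∀ B, homologicalPart i z B - polyBdry K n b B ∈ J := by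
    have hcycle : mkChain J (homologicalPart i z) ∈ koszulCycles J i (i + (e + 1)) := by
      refine ⟨mem_koszulChains_add_iff.mpr ⟨z, fun A => (hz A).2, rfl⟩, ?_⟩
      rw [SetLike.mem_coe, LinearMap.mem_ker, koszulDifferential_mkChain, ← map_zero (mkChain J),
        mkChain_eq_mkChain_iff]
      intro B
      rw [polyBdry_homologicalPart_apply, Pi.zero_apply, sub_zero]
      split_ifs
      · exact hzJ B
      · exact J.zero_mem
    have hbetti : betti J i (i + (e + 1)) = 0 := by
      by_contra hne
      rcases Nat.eq_zero_or_pos i with rfl | hi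
      · exact hne (betti_zero_eq_zero (by omega))
      · have := h i _ hi hne
        omega
    obtain ⟨_, hchain, hbz⟩ := betti_eq_zero_iff.mp hbetti hcycle
    rw [← add_assoc, add_right_comm] at hchain
    obtain ⟨b, hb, rfl⟩ := mem_koszulChains_add_iff.mp hchain
    refine ⟨homologicalPart (i + 1) b, fun B => ?_, ?_⟩
    · rw [homologicalPart]
      split_ifs
      · exact hb B
      · exact isHomogeneous_zero _ _ _
    · rw [← mkChain_eq_mkChain_iff, ← koszulDifferential_mkChain, hbz]
  choose b hb hzb using hboundary
  refine ⟨∑ i ∈ Finset.range (n + 1), b i, fun B => ⟨trivial, ?_⟩, fun B => ?_⟩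
  · rw [Finset.sum_apply]
    exact IsHomogeneous.sum _ _ _ fun i _ => hb i B
  · rw [← congrFun (sum_homologicalPart z) B, map_sum, Finset.sum_apply, Finset.sum_apply,
      ← Finset.sum_sub_distrib]
    exact J.sum_mem fun i _ => hzb i B

end KoszulHomology

/-! ### K-polynomials of monomial ideals -/

section KPolynomials

universe u

open MvPolynomial

variable {K : Type u} [Field K] {n : ℕ} {J : Ideal (MvPolynomial (Fin n) K)}
  {U : Set (Fin n →₀ ℕ)}

theorem mem_finsuppAntidiag_univ {u : Fin n →₀ ℕ} {e : ℕ} :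
    u ∈ Finset.univ.finsuppAntidiag e ↔ u.degree = e := by
  rw [Finset.mem_finsuppAntidiag, Finsupp.degree_eq_sum]
  exact and_iff_left (Finset.subset_univ _)

open Classical in
/-- The exponents of degree `e` in `U`. For the exponents of a monomial ideal their number is the
Hilbert function. -/
def exponentsOfDegree (U : Set (Fin n →₀ ℕ)) (e : ℕ) : Finset (Fin n →₀ ℕ) :=
  (Finset.univ.finsuppAntidiag e).filter (· ∈ U)

theorem mem_exponentsOfDegree {u : Fin n →₀ ℕ} {e : ℕ} :
    u ∈ exponentsOfDegree U e ↔ u.degree = e ∧ u ∈ U := by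
  classical
  rw [exponentsOfDegree, Finset.mem_filter, mem_finsuppAntidiag_univ]

theorem IsMonomialIdealOf.finrank_degreePart (hJ : IsMonomialIdealOf J U) (e : ℕ) :
    Module.finrank K (degreePart J e) = (exponentsOfDegree U e).card := by
  have heq : degreePart J e = restrictSupport K (exponentsOfDegree U e : Set _) := by
    ext p
    rw [mem_degreePart, hJ.2, isHomogeneous_iff_degree, mem_restrictSupport_iff_coeff,
      ← forall_and]
    simp only [Finset.mem_coe, mem_exponentsOfDegree, ← imp_and, and_comm]
  rw [heq, Module.finrank_eq_nat_card_basis (basisRestrictSupport K _), Nat.card_coe_set_eq,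
    Set.ncard_coe_finset]

/-- The exponent of the squarefree monomial with support `A`. -/
def squarefreeExponent (A : Finset (Fin n)) : Fin n →₀ ℕ :=
  ∑ v ∈ A, Finsupp.single v 1

theorem degree_squarefreeExponent (A : Finset (Fin n)) :
    (squarefreeExponent A).degree = A.card := by
  simp only [squarefreeExponent, map_sum, Finsupp.degree_single, Finset.sum_const, smul_eq_mul,
    mul_one]

theorem squarefreeExponent_insert {v : Fin n} {B : Finset (Fin n)} (hv : v ∉ B) :
    squarefreeExponent (insert v B) = Finsupp.single v 1 + squarefreeExponent B :=
  Finset.sum_insert hv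

theorem squarefreeExponent_apply_of_notMem {v : Fin n} {B : Finset (Fin n)} (hv : v ∉ B) :
    squarefreeExponent B v = 0 := by
  rw [squarefreeExponent, Finsupp.finsetSum_apply]
  exact Finset.sum_eq_zero fun w hw => Finsupp.single_eq_of_ne fun h => hv (h ▸ hw)

open Classical in
/-- The coefficient of the monomial with exponent `α` in the multigraded K-polynomial
`∏ v, (1 - X v) * ∑ u ∈ U, X ^ u` of a monomial ideal. -/
def multigradedKCoeff (U : Set (Fin n →₀ ℕ)) (α : Fin n →₀ ℕ) : ℤ :=
  ∑ A : Finset (Fin n), if ∃ u ∈ U, squarefreeExponent A + u = α then (-1) ^ A.card else 0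

/-- Multigraded version of the fact that the K-polynomial only depends on the monomials up to the
degrees of the generators: restricting the generators truncates it. -/
theorem multigradedKCoeff_generatedUpTo (hU : IsUpperSet U) (v : Fin n) (c : ℕ) (α : Fin n →₀ ℕ) :
    multigradedKCoeff (generatedUpTo U v c) α = if α v ≤ c then multigradedKCoeff U α else 0 := by
  classical
  split_ifs with hα
  · refine Finset.sum_congr rfl fun A _ => ?_
    have hiff (u : Fin n →₀ ℕ) (hu : squarefreeExponent A + u = α) :
        u ∈ generatedUpTo U v c ↔ u ∈ U :=
      mem_generatedUpTo_iff_of_le hU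
        ((le_add_self.trans (DFunLike.congr_fun hu v).le).trans hα)
    simp only [and_comm (a := _ ∈ _), and_congr_right (hiff _)]
  · have hcancel (B : Finset (Fin n)) (hv : v ∉ B) :
        (∃ u ∈ generatedUpTo U v c, squarefreeExponent (insert v B) + u = α) ↔
          ∃ u ∈ generatedUpTo U v c, squarefreeExponent B + u = α := by
      rw [squarefreeExponent_insert hv]
      constructor
      · rintro ⟨u, hu, rfl⟩
        exact ⟨Finsupp.single v 1 + u, isUpperSet_generatedUpTo v c le_add_self hu, by abel⟩
      · rintro ⟨u, hu, rfl⟩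
        rw [Finsupp.add_apply, squarefreeExponent_apply_of_notMem hv, zero_add, not_le] at hα
        obtain ⟨u', rfl⟩ := exists_add_of_le
          (Finsupp.single_le_iff.mpr (show 1 ≤ u v by omega))
        rw [Finsupp.add_apply, Finsupp.single_eq_same] at hα
        exact ⟨u', mem_generatedUpTo_of_single_add (by omega) hu, by abel⟩
    rw [multigradedKCoeff, ← Finset.powerset_univ, ← Finset.insert_erase (Finset.mem_univ v),
      Finset.sum_powerset_insert (Finset.notMem_erase v _), ← Finset.sum_add_distrib]
    refine Finset.sum_eq_zero fun B hB => ?_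
    have hv : v ∉ B := fun h => Finset.notMem_erase v _ (Finset.mem_powerset.mp hB h)
    simp only [hcancel B hv, Finset.card_insert_of_notMem hv, pow_succ]
    split_ifs <;> ring

/-- The K-polynomial of an ideal, that is, the numerator of its Hilbert series. -/
def kPolynomial (J : Ideal (MvPolynomial (Fin n) K)) : PowerSeries ℤ :=
  (1 - PowerSeries.X) ^ n * idealSeries J

open Classical in
theorem card_filter_squarefreeExponent_add (U : Set (Fin n →₀ ℕ)) (A : Finset (Fin n)) (j : ℕ) :
    ((Finset.univ.finsuppAntidiag j).filter fun α => ∃ u ∈ U, squarefreeExponent A + u = α).card =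
      if A.card ≤ j then (exponentsOfDegree U (j - A.card)).card else 0 := by
  split_ifs with hA
  · refine (Finset.card_bij (fun u _ => squarefreeExponent A + u) (fun u hu => ?_)
      (fun _ _ _ _ h => add_left_cancel h) fun α hα => ?_).symm
    · rw [mem_exponentsOfDegree] at hu
      rw [Finset.mem_filter, mem_finsuppAntidiag_univ, map_add, degree_squarefreeExponent, hu.1]
      exact ⟨by omega, u, hu.2, rfl⟩
    · obtain ⟨hα, u, hu, rfl⟩ := Finset.mem_filter.mp hα
      rw [mem_finsuppAntidiag_univ, map_add, degree_squarefreeExponent] at hα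
      exact ⟨u, mem_exponentsOfDegree.mpr ⟨by omega, hu⟩, rfl⟩
  · refine Finset.card_eq_zero.mpr (Finset.filter_eq_empty_iff.mpr ?_)
    rintro _ hα ⟨u, -, rfl⟩
    rw [mem_finsuppAntidiag_univ, map_add, degree_squarefreeExponent] at hα
    omega

theorem IsMonomialIdealOf.coeff_kPolynomial (hJ : IsMonomialIdealOf J U) (j : ℕ) :
    PowerSeries.coeff j (kPolynomial J) =
      ∑ α ∈ Finset.univ.finsuppAntidiag j, multigradedKCoeff U α := by
  classical
  simp only [multigradedKCoeff]
  rw [Finset.sum_comm]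
  simp only [← Finset.sum_filter, Finset.sum_const, card_filter_squarefreeExponent_add,
    ← hJ.finrank_degreePart]
  rw [← Finset.powerset_univ, Finset.sum_powerset_apply_card fun i =>
    (if i ≤ j then Module.finrank K (degreePart J (j - i)) else 0) • (-1 : ℤ) ^ i, Finset.card_fin,
    kPolynomial, coeff_one_sub_X_pow_mul]
  refine Finset.sum_congr rfl fun i _ => ?_
  split_ifs
  · rw [coeff_idealSeries, nsmul_eq_mul, nsmul_eq_mul]
    ring
  · rw [zero_smul, smul_zero, mul_zero]

/-- Both sides sum `α v` times the multigraded K-polynomial: its coefficient at `α` survives in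
the truncation at `c` in the variable `v` unless `c < α v`. -/
theorem IsMonomialIdealOf.sum_coeff_kPolynomial_sub {C : ℕ} (hJ : IsMonomialIdealOf J U)
    (hC : ∀ v, generatedUpTo U v C = U) {J' : Fin n → ℕ → Ideal (MvPolynomial (Fin n) K)}
    (hJ' : ∀ v c, IsMonomialIdealOf (J' v c) (generatedUpTo U v c)) (j : ℕ) :
    ∑ v, ∑ c ∈ Finset.range C,
      (PowerSeries.coeff j (kPolynomial J) - PowerSeries.coeff j (kPolynomial (J' v c))) =
        j * PowerSeries.coeff j (kPolynomial J) := by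
  have hsub (v : Fin n) (c : ℕ) (α : Fin n →₀ ℕ) : multigradedKCoeff U α -
      multigradedKCoeff (generatedUpTo U v c) α = if c < α v then multigradedKCoeff U α else 0 := by
    rw [multigradedKCoeff_generatedUpTo hJ.1]
    split_ifs <;> omega
  have hcount (v : Fin n) (α : Fin n →₀ ℕ) :
      ∑ c ∈ Finset.range C, (if c < α v then multigradedKCoeff U α else 0) =
        α v * multigradedKCoeff U α := by
    rcases le_or_gt (α v) C with hα | hα
    · have hfilter : (Finset.range C).filter (· < α v) = Finset.range (α v) := by
        ext c
        simp only [Finset.mem_filter, Finset.mem_range]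
        omega
      rw [← Finset.sum_filter, hfilter, Finset.sum_const, Finset.card_range, nsmul_eq_mul]
    · have hzero : multigradedKCoeff U α = 0 := by
        rw [← hC v, multigradedKCoeff_generatedUpTo hJ.1, if_neg hα.not_ge]
      simp only [hzero, ite_self, Finset.sum_const_zero, mul_zero]
  simp only [hJ.coeff_kPolynomial, (hJ' _ _).coeff_kPolynomial, ← Finset.sum_sub_distrib, hsub]
  simp only [Finset.sum_comm (s := Finset.range C), hcount]
  rw [Finset.sum_comm, Finset.mul_sum]
  refine Finset.sum_congr rfl fun α hα => ?_
  rw [← Finset.sum_mul, ← mem_finsuppAntidiag_univ.mp hα, Finsupp.degree_eq_sum, Nat.cast_sum]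

theorem isMonomialIdealOf_top :
    IsMonomialIdealOf (⊤ : Ideal (MvPolynomial (Fin n) K)) Set.univ :=
  ⟨isUpperSet_univ, fun _ => iff_of_true trivial fun _ _ => trivial⟩

theorem kPolynomial_top : kPolynomial (⊤ : Ideal (MvPolynomial (Fin n) K)) = 1 := by
  have huniv (v : Fin n) (c : ℕ) : generatedUpTo Set.univ v c = Set.univ :=
    Set.eq_univ_of_forall fun u => ⟨0, trivial, zero_le, Nat.zero_le c⟩
  have hmul (j : ℕ) := isMonomialIdealOf_top.sum_coeff_kPolynomial_sub (C := 0) (huniv · 0)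
    (J' := fun _ _ => (⊤ : Ideal (MvPolynomial (Fin n) K)))
    (fun v c => (huniv v c).symm ▸ isMonomialIdealOf_top) j
  ext j
  rcases Nat.eq_zero_or_pos j with rfl | hj
  · rw [kPolynomial, PowerSeries.coeff_mul, Finset.Nat.antidiagonal_zero, Finset.sum_singleton,
      coeff_idealSeries, isMonomialIdealOf_top.finrank_degreePart]
    simp [exponentsOfDegree]
  · rw [PowerSeries.coeff_one, if_neg hj.ne']
    simpa [hj.ne'] using hmul j

end KPolynomials

/-! ### Betti numbers of linear resolutions -/

section LinearBetti

universe u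

open MvPolynomial

variable {K : Type u} [Field K] {n : ℕ} {J J' : Ideal (MvPolynomial (Fin n) K)}
  {U : Set (Fin n →₀ ℕ)}

theorem coeff_comp_one_sub_X (P : Polynomial ℕ) (i : ℕ) :
    ((P.map (Nat.castRingHom ℤ)).comp (1 - Polynomial.X)).coeff i =
      (-1) ^ i * (Polynomial.taylor 1 P).coeff i := by
  have hcomp : (P.map (Nat.castRingHom ℤ)).comp (1 - Polynomial.X) =
      ((Polynomial.taylor 1 P).map (Nat.castRingHom ℤ)).comp
        (Polynomial.C (-1) * Polynomial.X) := by
    rw [Polynomial.taylor_apply, Polynomial.map_comp, Polynomial.comp_assoc, Polynomial.map_add,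
      Polynomial.map_X, Polynomial.map_C, map_one, Polynomial.C_1, Polynomial.add_comp,
      Polynomial.X_comp, Polynomial.one_comp, map_neg, Polynomial.C_1, neg_one_mul,
      ← sub_eq_neg_add]
  rw [hcomp, Polynomial.comp_C_mul_X_coeff, Polynomial.coeff_map, mul_comm]
  rfl

theorem betti_eq_zero_of_card_lt {i : ℕ} (h : n < i) (j : ℕ) : betti J i j = 0 :=
  betti_eq_zero_of_koszulChains_eq_bot (koszulChains_eq_bot_of_card_lt h j)

theorem betti_eq_zero_of_lt {i j : ℕ} (h : j < i) : betti J i j = 0 :=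
  betti_eq_zero_of_koszulChains_eq_bot (koszulChains_eq_bot_of_lt h)

theorem coeff_one_sub_kPolynomial (J : Ideal (MvPolynomial (Fin n) K)) (j : ℕ) :
    PowerSeries.coeff j (1 - kPolynomial J) =
      ∑ i ∈ Finset.range (n + 1), (-1 : ℤ) ^ i * betti J i j := by
  rw [sum_neg_one_pow_mul_betti, mul_sub, ← kPolynomial, ← kPolynomial, kPolynomial_top]

theorem betti_zero_zero_add_finrank_degreePart :
    (betti J 0 0 + Module.finrank K (degreePart J 0) : ℤ) = 1 := by
  have h := coeff_one_sub_kPolynomial J 0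
  rw [Finset.sum_eq_single_of_mem 0 (Finset.mem_range.mpr n.succ_pos) fun i _ hi => by
      rw [betti_eq_zero_of_lt (Nat.pos_of_ne_zero hi), Nat.cast_zero, mul_zero], pow_zero, one_mul,
    map_sub, kPolynomial, PowerSeries.coeff_mul, Finset.Nat.antidiagonal_zero,
    Finset.sum_singleton, coeff_idealSeries] at h
  simp only [map_pow, PowerSeries.coeff_zero_eq_constantCoeff, map_sub, map_one,
    PowerSeries.constantCoeff_X, sub_zero, one_pow, one_mul] at h
  rw [← h, sub_add_cancel]

theorem HasLinearResolution.betti_succ_eq_zero {D : ℕ} (h : HasLinearResolution J D) {i j : ℕ}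
    (hj : j ≠ D + i) : betti J (i + 1) j = 0 := by
  by_contra hne
  have := h (i + 1) j i.succ_pos hne
  omega

theorem HasLinearResolution.kPolynomial_eq {c : ℕ} (h : HasLinearResolution J (c + 1))
    (h0 : betti J 0 0 = 1) : kPolynomial J = ((Polynomial.X ^ (c + 1) *
      ∑ i ∈ Finset.range n, Polynomial.C ((-1) ^ i * (betti J (i + 1) (c + 1 + i) : ℤ)) *
        Polynomial.X ^ i : Polynomial ℤ) : PowerSeries ℤ) := by
  rw [← sub_sub_cancel 1 (kPolynomial J), sub_eq_iff_eq_add, ← sub_eq_iff_eq_add']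
  ext j
  rw [coeff_one_sub_kPolynomial, map_sub, PowerSeries.coeff_one, Polynomial.coeff_coe,
    Finset.mul_sum, Polynomial.finsetSum_coeff, Finset.sum_range_succ', sub_eq_neg_add,
    ← Finset.sum_neg_distrib, pow_zero, one_mul]
  congr 1
  · refine Finset.sum_congr rfl fun i _ => ?_
    rw [mul_left_comm, ← pow_add, Polynomial.coeff_C_mul_X_pow]
    split_ifs with hj
    · rw [hj, pow_succ]
      ring
    · rw [h.betti_succ_eq_zero hj, Nat.cast_zero, mul_zero, neg_zero]
  · split_ifs with hj
    · rw [hj, h0, Nat.cast_one]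
    · rw [betti_zero_eq_zero (Nat.pos_of_ne_zero hj), Nat.cast_zero]

theorem HasLinearResolution.coeff_kPolynomial {c : ℕ} (h : HasLinearResolution J (c + 1))
    (h0 : betti J 0 0 = 1) (i : ℕ) :
    PowerSeries.coeff (c + 1 + i) (kPolynomial J) = (-1) ^ i * betti J (i + 1) (c + 1 + i) := by
  rw [h.kPolynomial_eq h0, Polynomial.coeff_coe, Polynomial.coeff_X_pow_mul', if_pos (by omega),
    Nat.add_sub_cancel_left, Polynomial.finsetSum_coeff]
  simp only [Polynomial.coeff_C_mul_X_pow, Finset.sum_ite_eq, Finset.mem_range]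
  split_ifs with hi
  · rfl
  · rw [betti_eq_zero_of_card_lt (by omega), Nat.cast_zero, mul_zero]

theorem idealSeries_sub_idealSeries (h : J' ≤ J) (D : ℕ) :
    idealSeries J - idealSeries J' = PowerSeries.X ^ D * hilbertSeries K (RelativePart J J' D) +
      (PowerSeries.trunc D (idealSeries J - idealSeries J') : PowerSeries ℤ) := by
  conv_lhs => rw [PowerSeries.eq_X_pow_mul_shift_add_trunc D (idealSeries J - idealSeries J')]
  congr 2
  ext e
  rw [PowerSeries.coeff_mk, map_sub, coeff_idealSeries, coeff_idealSeries, add_comm e D,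
    ← finrank_relativePart h, Nat.cast_add, add_sub_cancel_right, hilbertSeries,
    PowerSeries.coeff_mk]

theorem KoszulExactAbove.exists_kPolynomial_sub_eq {D : ℕ} (h : KoszulExactAbove J J' D)
    (hle : J' ≤ J) : ∃ P : Polynomial ℕ, kPolynomial J - kPolynomial J' =
      ((Polynomial.X ^ D * (P.map (Nat.castRingHom ℤ)).comp (1 - Polynomial.X) +
        (1 - Polynomial.X) ^ n * PowerSeries.trunc D (idealSeries J - idealSeries J') :
        Polynomial ℤ) : PowerSeries ℤ) := by
  obtain ⟨P, hP⟩ := IsLinear.exists_one_sub_X_pow_mul_hilbertSeries_eq n K (RelativePart J J' D)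
    Finset.univ (relativeMul J J' D) (Finset.card_fin n) (pairwiseCommute_relativeMul J J' D)
    h.isLinear
  refine ⟨P, ?_⟩
  rw [kPolynomial, kPolynomial, ← mul_sub, idealSeries_sub_idealSeries hle D, mul_add,
    mul_left_comm, hP]
  simp only [Polynomial.coe_add, Polynomial.coe_mul, Polynomial.coe_pow, Polynomial.coe_sub,
    Polynomial.coe_one, Polynomial.coe_X, ← idealSeries_sub_idealSeries hle D]

theorem KoszulExactAbove.exists_coeff_kPolynomial_sub_eq {D : ℕ} (h : KoszulExactAbove J J' D)
    (hle : J' ≤ J) (hD : ∀ e < D, degreePart J e = ⊥) : ∃ P : Polynomial ℕ, ∀ i,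
      PowerSeries.coeff (D + i) (kPolynomial J) - PowerSeries.coeff (D + i) (kPolynomial J') =
        (-1) ^ i * (Polynomial.taylor 1 P).coeff i := by
  obtain ⟨P, hP⟩ := h.exists_kPolynomial_sub_eq hle
  have htrunc : PowerSeries.trunc D (idealSeries J - idealSeries J') = 0 := by
    ext e
    rw [PowerSeries.coeff_trunc, Polynomial.coeff_zero]
    split_ifs with he
    · have hJ' : degreePart J' e = ⊥ := eq_bot_mono (degreePart_mono hle e) (hD e he)
      rw [map_sub, coeff_idealSeries, coeff_idealSeries, hD e he, hJ', sub_self]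
    · rfl
  refine ⟨P, fun i => ?_⟩
  rw [← map_sub, hP, htrunc, mul_zero, add_zero, Polynomial.coeff_coe,
    Polynomial.coeff_X_pow_mul', if_pos (Nat.le_add_right D i), Nat.add_sub_cancel_left,
    coeff_comp_one_sub_X]

/-- The monomial ideal with exponents in `U` is generated by monomials of degree `D`. -/
def GeneratedInDegree (U : Set (Fin n →₀ ℕ)) (D : ℕ) : Prop :=
  ∀ u ∈ U, ∃ u₀ ∈ U, u₀ ≤ u ∧ u₀.degree = D

theorem GeneratedInDegree.generatedUpTo_eq {D : ℕ} (h : GeneratedInDegree U D)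
    (hU : IsUpperSet U) (v : Fin n) : generatedUpTo U v D = U := by
  refine (generatedUpTo_subset hU v D).antisymm fun u hu => ?_
  obtain ⟨u₀, h₀, hle, hdeg⟩ := h u hu
  exact ⟨u₀, h₀, hle, hdeg ▸ Finsupp.le_degree v u₀⟩

theorem GeneratedInDegree.degreePart_eq_bot {D e : ℕ} (h : GeneratedInDegree U D)
    (hJ : IsMonomialIdealOf J U) (he : e < D) : degreePart J e = ⊥ := by
  refine (Submodule.eq_bot_iff _).mpr fun p hp => ?_
  by_contra hne
  obtain ⟨u, hu⟩ := ne_zero_iff.mp hne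
  obtain ⟨u₀, -, hle, hdeg⟩ := h u ((hJ.2 p).mp hp.1 u hu)
  have := Finsupp.degree_mono hle
  rw [isHomogeneous_iff_degree.mp hp.2 u hu] at this
  omega

theorem GeneratedInDegree.betti_zero_zero {c : ℕ} (h : GeneratedInDegree U (c + 1))
    (hJ : IsMonomialIdealOf J U) : betti J 0 0 = 1 := by
  have hadd := betti_zero_zero_add_finrank_degreePart (J := J)
  rw [h.degreePart_eq_bot hJ c.succ_pos, finrank_bot, Nat.cast_zero, add_zero] at hadd
  exact_mod_cast hadd

/-- Multiplying the Betti numbers by their degrees amounts to applying `t * d / dt` to the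
K-polynomial of `J`, which is the sum of the K-polynomials of the modules `J / J' v c`, where
`J' v c` is generated by the monomials of `J` of degree at most `c` in the variable `v`. -/
theorem HasLinearResolution.exists_degree_mul_betti_eq {c : ℕ} (h : HasLinearResolution J (c + 1))
    (hJ : IsMonomialIdealOf J U) (hU : GeneratedInDegree U (c + 1)) :
    ∃ P : Polynomial ℕ, ∀ i,
      (c + 1 + i) * betti J (i + 1) (c + 1 + i) = (Polynomial.taylor 1 P).coeff i := by
  let J' (v : Fin n) (b : ℕ) : Ideal (MvPolynomial (Fin n) K) :=
    restrictSupportIdeal K (generatedUpTo U v b) (isUpperSet_generatedUpTo v b)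
  have hJ' (v : Fin n) (b : ℕ) : IsMonomialIdealOf (J' v b) (generatedUpTo U v b) :=
    isMonomialIdealOf_restrictSupportIdeal _
  choose P hP using fun v b => (h.koszulExactAbove.of_generatedUpTo hJ
    (hJ' v b)).exists_coeff_kPolynomial_sub_eq (hJ.le (hJ' v b) (generatedUpTo_subset hJ.1 v b))
      fun _ he => hU.degreePart_eq_bot hJ he
  refine ⟨∑ v, ∑ b ∈ Finset.range (c + 1), P v b, fun i => ?_⟩
  have hsum := hJ.sum_coeff_kPolynomial_sub (hU.generatedUpTo_eq hJ.1) hJ' (c + 1 + i)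
  simp only [hP, ← Finset.mul_sum] at hsum
  rw [h.coeff_kPolynomial (hU.betti_zero_zero hJ), mul_left_comm] at hsum
  simp only [map_sum, Polynomial.finsetSum_coeff]
  exact_mod_cast (mul_left_cancel₀ (pow_ne_zero i (neg_ne_zero.mpr one_ne_zero)) hsum).symm

theorem HasLinearResolution.sum_neg_one_pow_mul_betti_le_one {c : ℕ}
    (h : HasLinearResolution J (c + 1)) (h0 : betti J 0 0 = 1) :
    ∑ i ∈ Finset.range n, (-1 : ℤ) ^ i * betti J (i + 1) (c + 1 + i) ≤ 1 := by
  rcases Nat.eq_zero_or_pos n with rfl | hn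
  · exact zero_le_one
  obtain ⟨P, hP⟩ := h.koszulExactAbove.exists_kPolynomial_sub_eq le_top
  rw [kPolynomial_top, h.kPolynomial_eq h0, ← Polynomial.coe_one, ← Polynomial.coe_sub] at hP
  have heval := congrArg (Polynomial.eval 1) (Polynomial.coe_injective ℤ hP)
  simp only [Polynomial.eval_sub, Polynomial.eval_one, Polynomial.eval_mul, Polynomial.eval_pow,
    Polynomial.eval_X, one_pow, one_mul, Polynomial.eval_finsetSum, Polynomial.eval_C, mul_one,
    Polynomial.eval_add, Polynomial.eval_comp, sub_self, zero_pow hn.ne', zero_mul, add_zero,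
    Polynomial.eval_zero_map, eq_natCast] at heval
  linarith [(P.eval 0).cast_nonneg (α := ℤ)]

end LinearBetti

/-! ### Pure diagrams -/

section PureDiagrams

namespace DegreeSequence

variable (δ : DegreeSequence)

theorem pureDiagram_eq_zero_of_length_lt {i : ℕ} (h : δ.length < i) (j : ℕ) :
    δ.pureDiagram i j = 0 :=
  dif_neg (by omega)

theorem pureDiagram_eq_zero_of_ne (i : Fin (δ.length + 1)) {j : ℕ} (h : j ≠ δ.deg i) :
    δ.pureDiagram i j = 0 := by
  rw [pureDiagram, dif_pos i.2, if_neg h]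

theorem pureDiagram_deg (i : Fin (δ.length + 1)) :
    δ.pureDiagram i (δ.deg i) = ∏ r ∈ Finset.univ.filter (fun r => r ≠ 0 ∧ r ≠ i),
      (δ.deg r : ℝ) / |(δ.deg r : ℝ) - (δ.deg i : ℝ)| := by
  rw [pureDiagram, dif_pos i.2, if_pos rfl]

theorem deg_pos {r : Fin (δ.length + 1)} (hr : r ≠ 0) : 0 < δ.deg r :=
  δ.deg_zero ▸ δ.strictMono (Fin.pos_iff_ne_zero.mpr hr)

theorem pureDiagram_deg_pos (i : Fin (δ.length + 1)) : 0 < δ.pureDiagram i (δ.deg i) := by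
  rw [δ.pureDiagram_deg]
  refine Finset.prod_pos fun r hr => ?_
  obtain ⟨hr0, hri⟩ := (Finset.mem_filter.mp hr).2
  refine div_pos (Nat.cast_pos.mpr (δ.deg_pos hr0)) (abs_pos.mpr (sub_ne_zero.mpr ?_))
  exact Nat.cast_injective.ne (δ.strictMono.injective.ne hri)

theorem pureDiagram_nonneg (i j : ℕ) : 0 ≤ δ.pureDiagram i j := by
  rcases lt_or_ge δ.length i with hi | hi
  · rw [δ.pureDiagram_eq_zero_of_length_lt hi]
  · rcases eq_or_ne j (δ.deg ⟨i, by omega⟩) with rfl | hj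
    · exact (δ.pureDiagram_deg_pos ⟨i, by omega⟩).le
    · exact (δ.pureDiagram_eq_zero_of_ne ⟨i, by omega⟩ hj).ge

theorem pureDiagram_zero_zero : δ.pureDiagram 0 0 = 1 := by
  have h := δ.pureDiagram_deg 0
  rw [δ.deg_zero] at h
  refine h.trans (Finset.prod_eq_one fun r hr => ?_)
  have hpos : (0 : ℝ) < δ.deg r := Nat.cast_pos.mpr (δ.deg_pos (Finset.mem_filter.mp hr).2.1)
  rw [Nat.cast_zero, sub_zero, abs_of_pos hpos, div_self hpos.ne']

theorem pureDiagram_zero_of_ne {j : ℕ} (hj : j ≠ 0) : δ.pureDiagram 0 j = 0 :=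
  δ.pureDiagram_eq_zero_of_ne 0 (by rwa [δ.deg_zero])

theorem pureDiagram_succ (i : Fin δ.length) :
    δ.pureDiagram (i + 1) (δ.deg i.succ) = ∏ r ∈ Finset.univ.erase i,
      (δ.deg r.succ : ℝ) / |(δ.deg r.succ : ℝ) - δ.deg i.succ| := by
  refine (δ.pureDiagram_deg i.succ).trans ?_
  rw [Finset.prod_filter, Fin.prod_univ_succ, if_neg (fun h => h.1 rfl), one_mul,
    ← Finset.filter_ne', Finset.prod_filter]
  simp only [ne_eq, Fin.succ_ne_zero, not_false_eq_true, true_and, Fin.succ_inj]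

theorem prod_erase_deg_sub (i : Fin δ.length) :
    ∏ r ∈ Finset.univ.erase i, ((δ.deg r.succ : ℝ) - δ.deg i.succ) =
      (-1) ^ (i : ℕ) * ∏ r ∈ Finset.univ.erase i, |(δ.deg r.succ : ℝ) - δ.deg i.succ| := by
  have hsign (r : Fin δ.length) : (δ.deg r.succ : ℝ) - δ.deg i.succ =
      (if r < i then -1 else 1) * |(δ.deg r.succ : ℝ) - δ.deg i.succ| := by
    split_ifs with hr
    · have : (δ.deg r.succ : ℝ) < δ.deg i.succ :=
        Nat.cast_lt.mpr (δ.strictMono (Fin.succ_lt_succ_iff.mpr hr))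
      rw [abs_of_neg (sub_neg.mpr this), neg_one_mul, neg_neg]
    · have : (δ.deg i.succ : ℝ) ≤ δ.deg r.succ :=
        Nat.cast_le.mpr (δ.strictMono.monotone (Fin.succ_le_succ_iff.mpr (not_lt.mp hr)))
      rw [abs_of_nonneg (sub_nonneg.mpr this), one_mul]
  have hlt : (Finset.univ.erase i).filter (· < i) = Finset.Iio i := by
    ext r
    simp only [Finset.mem_filter, Finset.mem_erase, Finset.mem_univ, and_true, Finset.mem_Iio]
    exact ⟨And.right, fun h => ⟨h.ne, h⟩⟩
  rw [Finset.prod_congr rfl fun r _ => hsign r, Finset.prod_mul_distrib, Finset.prod_ite,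
    Finset.prod_const, Finset.prod_const_one, mul_one, hlt, Fin.card_Iio]

/-- Lagrange interpolation of the constant `1` at the nodes `d₁, …, d_p`, evaluated at `0`. -/
theorem sum_neg_one_pow_mul_pureDiagram_succ (h : δ.length ≠ 0) :
    ∑ i : Fin δ.length, (-1) ^ (i : ℕ) * δ.pureDiagram (i + 1) (δ.deg i.succ) = 1 := by
  have : Nonempty (Fin δ.length) := ⟨⟨0, Nat.pos_of_ne_zero h⟩⟩
  have hinj : Function.Injective fun r : Fin δ.length => (δ.deg r.succ : ℝ) :=
    Nat.cast_injective.comp (δ.strictMono.injective.comp (Fin.succ_injective _))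
  have hbasis := congrArg (Polynomial.eval 0) (Lagrange.sum_basis hinj.injOn Finset.univ_nonempty)
  rw [Polynomial.eval_finsetSum, Polynomial.eval_one] at hbasis
  refine (Finset.sum_congr rfl fun i _ => ?_).trans hbasis
  simp only [δ.pureDiagram_succ, Lagrange.basis, Lagrange.basisDivisor, Polynomial.eval_prod,
    Polynomial.eval_mul, Polynomial.eval_C, Polynomial.eval_sub, Polynomial.eval_X, zero_sub,
    mul_neg, ← neg_mul, ← inv_neg, neg_sub]
  rw [Finset.prod_div_distrib, Finset.prod_mul_distrib, Finset.prod_inv_distrib,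
    δ.prod_erase_deg_sub i, mul_inv, ← inv_pow, inv_neg_one, mul_assoc, div_eq_inv_mul]

end DegreeSequence

theorem linearIndepOn_pureDiagram {S : Set DegreeSequence} (hS : S.InjOn DegreeSequence.length) :
    LinearIndepOn ℝ DegreeSequence.pureDiagram S := by
  refine linearIndepOn_iff.mpr fun w hwS hw => ?_
  by_contra hne
  obtain ⟨δ, hδ, hmax⟩ := Finset.exists_max_image w.support DegreeSequence.length
    (Finsupp.support_nonempty_iff.mpr hne)
  have hlast := congrFun (congrFun hw δ.length) (δ.deg (Fin.last _))
  rw [Finsupp.linearCombination_apply, Finsupp.sum, Finset.sum_apply, Finset.sum_apply,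
    Finset.sum_eq_single_of_mem δ hδ] at hlast
  · exact mul_ne_zero (Finsupp.mem_support_iff.mp hδ) (δ.pureDiagram_deg_pos (Fin.last _)).ne' hlast
  · intro ε hε hεδ
    have hlt : ε.length < δ.length :=
      (hmax ε hε).lt_of_ne fun h => hεδ (hS (hwS hε) (hwS hδ) h)
    rw [Pi.smul_apply, Pi.smul_apply, ε.pureDiagram_eq_zero_of_length_lt hlt, smul_zero]

section Decompositions

variable {β : ℕ → ℕ → ℝ} {w : DegreeSequence →₀ ℝ}

theorem mem_decompositions_iff : w ∈ decompositions β ↔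
    (∀ δ, 0 ≤ w δ) ∧ Finsupp.linearCombination ℝ DegreeSequence.pureDiagram w = β := by
  refine and_congr_right fun _ => ?_
  simp only [funext_iff, Finsupp.linearCombination_apply, Finsupp.sum, Finset.sum_apply,
    Pi.smul_apply, smul_eq_mul]

theorem pos_of_mem_decompositions (hw : w ∈ decompositions β) {δ : DegreeSequence}
    (hδ : δ ∈ w.support) (i : Fin (δ.length + 1)) : 0 < β i (δ.deg i) := by
  have hpos : 0 < w δ := (hw.1 δ).lt_of_ne' (Finsupp.mem_support_iff.mp hδ)
  rw [← hw.2]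
  exact Finset.sum_pos' (fun ε _ => mul_nonneg (hw.1 ε) (ε.pureDiagram_nonneg _ _))
    ⟨δ, hδ, mul_pos hpos (δ.pureDiagram_deg_pos i)⟩

theorem occurringPure_eq_support (h : decompositions β = {w}) : occurringPure β = w.support := by
  have hw : w ∈ decompositions β := h ▸ rfl
  ext δ
  simp only [occurringPure, h, Set.mem_singleton_iff, exists_eq_left, Set.mem_ofPred_eq,
    Finset.mem_coe, Finsupp.mem_support_iff, (hw.1 δ).lt_iff_ne']

theorem decompositionPolytope_eq_singleton (h : decompositions β = {w}) {m : ℕ}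
    {π : Fin m → DegreeSequence} (hπ : Function.Injective π) (hw : ↑w.support ⊆ Set.range π) :
    decompositionPolytope β π = {fun s => w (π s)} := by
  have hmem : w ∈ decompositions β := h ▸ rfl
  classical
  refine Set.eq_singleton_iff_unique_mem.mpr ⟨⟨fun s => hmem.1 _, fun i j => ?_⟩, fun x hx => ?_⟩
  · rw [← hmem.2, ← Finset.sum_image (s := Finset.univ) (g := π)
      (f := fun δ => w δ * δ.pureDiagram i j) hπ.injOn]
    refine (Finset.sum_subset (fun δ hδ => ?_) fun δ _ hδ => ?_).symm
    · simpa only [Finset.mem_image, Finset.mem_univ, true_and, Set.mem_range] using hw hδ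
    · rw [Finsupp.notMem_support_iff.mp hδ, zero_mul]
  · let y : DegreeSequence →₀ ℝ := Finsupp.mapDomain π (Finsupp.equivFunOnFinite.symm x)
    have hy : y ∈ decompositions β := by
      refine mem_decompositions_iff.mpr ⟨fun δ => ?_, ?_⟩
      · by_cases hδ : δ ∈ Set.range π
        · obtain ⟨s, rfl⟩ := hδ
          exact (hx.1 s).trans_eq
            (Finsupp.mapDomain_apply hπ (Finsupp.equivFunOnFinite.symm x) s).symm
        · exact (Finsupp.mapDomain_of_notMem_range _ δ hδ).ge
      · ext i j
        rw [Finsupp.linearCombination_mapDomain, Finsupp.linearCombination_apply,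
          Finsupp.sum_fintype _ _ fun s => zero_smul ℝ ((_ ∘ π) s), Finset.sum_apply,
          Finset.sum_apply, ← hx.2 i j]
        rfl
    have hyw : y = w := Set.mem_singleton_iff.mp (h ▸ hy)
    exact funext fun s => (Finsupp.mapDomain_apply hπ _ s).symm.trans (DFunLike.congr_fun hyw _)

end Decompositions

/-- The degree sequence `0 < c + 1 < c + 2 < ⋯ < c + p` of a `(c + 1)`-linear resolution. -/
def linearSequence (c p : ℕ) : DegreeSequence where
  length := p
  deg := Fin.cons 0 fun i => c + 1 + i
  strictMono := by
    intro i j hij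
    induction j using Fin.cases with
    | zero => exact absurd hij (Fin.not_lt_zero i)
    | succ j =>
      induction i using Fin.cases with
      | zero => exact Nat.zero_lt_of_lt (Nat.lt_add_right j c.lt_succ_self)
      | succ i => exact Nat.add_lt_add_left (Fin.succ_lt_succ_iff.mp hij) (c + 1)
  deg_zero := rfl

theorem linearSequence_injective (c : ℕ) : Function.Injective (linearSequence c) :=
  fun _ _ h => congrArg DegreeSequence.length h

theorem linearSequence_pureDiagram_succ (c : ℕ) {p : ℕ} (i : Fin p) :
    (linearSequence c p).pureDiagram (i + 1) (c + 1 + i) =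
      ∏ r ∈ Finset.univ.erase i, ((c : ℝ) + 1 + r) / |(r : ℝ) - i| := by
  refine ((linearSequence c p).pureDiagram_succ i).trans (Finset.prod_congr rfl fun r _ => ?_)
  change ((c + 1 + r : ℕ) : ℝ) / |((c + 1 + r : ℕ) : ℝ) - (c + 1 + i : ℕ)| = _
  simp only [Nat.cast_add, Nat.cast_one, add_sub_add_left_eq_sub]

theorem linearSequence_pureDiagram_succ_of_ne (c p : ℕ) {s j : ℕ} (h : j ≠ c + 1 + s) :
    (linearSequence c p).pureDiagram (s + 1) j = 0 := by
  rcases lt_or_ge s p with hs | hs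
  · exact (linearSequence c p).pureDiagram_eq_zero_of_ne (Fin.succ ⟨s, hs⟩) h
  · exact (linearSequence c p).pureDiagram_eq_zero_of_length_lt (Nat.lt_succ_of_le hs) j

theorem prod_erase_range_abs_sub (s t : ℕ) :
    ∏ r ∈ (Finset.range (s + 1 + t)).erase s, |(r : ℝ) - s| = s.factorial * t.factorial := by
  rw [← Finset.filter_ne', Finset.prod_filter, Finset.prod_range_add, Finset.prod_range_succ,
    if_neg (not_not.mpr rfl), mul_one]
  congr 1
  · rw [← Finset.prod_range_add_one_eq_factorial, Nat.cast_prod, ← Finset.prod_range_reflect]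
    refine Finset.prod_congr rfl fun r hr => ?_
    have hr' := Finset.mem_range.mp hr
    rw [if_pos (by omega), Nat.sub_sub, Nat.cast_sub (by omega), sub_sub_cancel_left, abs_neg,
      Nat.abs_cast, add_comm]
  · rw [← Finset.prod_range_add_one_eq_factorial, Nat.cast_prod]
    refine Finset.prod_congr rfl fun r _ => ?_
    rw [if_pos (by omega), add_assoc, Nat.cast_add, add_sub_cancel_left, Nat.abs_cast, add_comm]

/-- The factor by which the binomial coefficients are multiplied in the pure diagram with the
degree sequence `0 < c + 1 < ⋯ < c + 1 + q`, once its entries are multiplied by their degrees. -/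
def linearFactor (c q : ℕ) : ℝ :=
  (∏ r ∈ Finset.range (q + 1), ((c : ℝ) + 1 + r)) / q.factorial

theorem linearFactor_pos (c q : ℕ) : 0 < linearFactor c q :=
  div_pos (Finset.prod_pos fun r _ => by positivity) (by positivity)

theorem degree_mul_linearSequence_pureDiagram (c q s : ℕ) :
    ((c : ℝ) + 1 + s) * (linearSequence c (q + 1)).pureDiagram (s + 1) (c + 1 + s) =
      linearFactor c q * q.choose s := by
  rcases lt_or_ge q s with hs | hs
  · rw [DegreeSequence.pureDiagram_eq_zero_of_length_lt _ (Nat.succ_lt_succ hs),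
      Nat.choose_eq_zero_of_lt hs, Nat.cast_zero, mul_zero, mul_zero]
  obtain ⟨t, rfl⟩ := Nat.exists_eq_add_of_le hs
  have hs' : s < s + t + 1 := Nat.lt_succ_of_le hs
  have hrange : (linearSequence c (s + t + 1)).pureDiagram (s + 1) (c + 1 + s) =
      ∏ r ∈ (Finset.range (s + 1 + t)).erase s, ((c : ℝ) + 1 + r) / |(r : ℝ) - s| := by
    rw [linearSequence_pureDiagram_succ c ⟨s, hs'⟩, ← Finset.filter_ne', ← Finset.filter_ne',
      Finset.prod_filter, Finset.prod_filter, Nat.add_right_comm s 1 t, Finset.prod_range]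
    simp only [ne_eq, Fin.ext_iff]
  rw [hrange, Finset.prod_div_distrib, prod_erase_range_abs_sub, ← mul_div_assoc,
    Finset.mul_prod_erase _ (fun r : ℕ => (c : ℝ) + 1 + r) (Finset.mem_range.mpr (by omega)),
    linearFactor, Nat.cast_add_choose, add_right_comm]
  have := Nat.cast_ne_zero (R := ℝ).mpr (s + t).factorial_ne_zero
  field_simp

theorem sum_neg_one_pow_mul_linearSequence_pureDiagram (c : ℕ) {q n : ℕ} (h : q < n) :
    ∑ s ∈ Finset.range n,
      (-1) ^ s * (linearSequence c (q + 1)).pureDiagram (s + 1) (c + 1 + s) = 1 := by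
  refine Eq.trans ?_
    ((linearSequence c (q + 1)).sum_neg_one_pow_mul_pureDiagram_succ q.succ_ne_zero)
  refine (Finset.sum_subset (Finset.range_subset_range.mpr h) fun s _ hs => ?_).symm.trans
    (Finset.sum_range _)
  rw [DegreeSequence.pureDiagram_eq_zero_of_length_lt, mul_zero]
  exact Nat.succ_lt_succ (not_lt.mp (Finset.mem_range.not.mp hs))

section LinearStrand

variable {β : ℕ → ℕ → ℝ} {c : ℕ} {w : DegreeSequence →₀ ℝ}

theorem support_subset_range_linearSequence (hβ : ∀ i j, β (i + 1) j ≠ 0 → j = c + 1 + i)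
    (hw : w ∈ decompositions β) : ↑w.support ⊆ Set.range (linearSequence c) := by
  intro δ hδ
  refine ⟨δ.length, DegreeSequence.ext rfl (heq_of_eq (funext fun i => ?_))⟩
  refine Fin.cases δ.deg_zero.symm (fun i => ?_) i
  exact (hβ _ _ (pos_of_mem_decompositions hw hδ i.succ).ne').symm

theorem decompositions_eq_singleton (hβ : ∀ i j, β (i + 1) j ≠ 0 → j = c + 1 + i)
    (hw : w ∈ decompositions β) : decompositions β = {w} := by
  have hinj : (Set.range (linearSequence c)).InjOn DegreeSequence.length := by
    rintro _ ⟨p, rfl⟩ _ ⟨q, rfl⟩ h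
    exact congrArg _ h
  refine Set.eq_singleton_iff_unique_mem.mpr ⟨hw, fun y hy => ?_⟩
  exact linearIndepOn_iffₛ.mp (linearIndepOn_pureDiagram hinj)
    y (support_subset_range_linearSequence hβ hy) w (support_subset_range_linearSequence hβ hw)
    ((mem_decompositions_iff.mp hy).2.trans (mem_decompositions_iff.mp hw).2.symm)

end LinearStrand

end PureDiagrams

/-! ### Weights of linear strands -/

section Weights

theorem coeff_taylor_one {R : Type*} [CommSemiring R] {f : Polynomial R} {N : ℕ}
    (hf : f.degree < N) (s : ℕ) :
    (Polynomial.taylor 1 f).coeff s = ∑ q ∈ Finset.range N, f.coeff q * q.choose s := by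
  rw [Polynomial.taylor_coeff, Polynomial.hasseDeriv_apply, Polynomial.sum_def,
    Polynomial.eval_finsetSum, Finset.sum_range,
    Polynomial.sum_fin (fun q a => a * (q.choose s : R)) (fun _ => zero_mul _) hf]
  refine Finset.sum_congr rfl fun q _ => ?_
  rw [Polynomial.eval_monomial, one_pow, mul_one, mul_comm]

/-- The generating polynomial of the numbers `B s`, placed in column `s + 1` and degree
`c + 1 + s` of a diagram, after multiplication by their degrees. This multiplication turns the pure
diagram of `linearSequence c (q + 1)` into a multiple of `(1 + X) ^ q`. -/
def strandPolynomial (n c : ℕ) (B : ℕ → ℝ) : Polynomial ℝ :=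
  ∑ s ∈ Finset.range n, Polynomial.C (((c : ℝ) + 1 + s) * B s) * Polynomial.X ^ s

theorem coeff_strandPolynomial (n c : ℕ) (B : ℕ → ℝ) (s : ℕ) :
    (strandPolynomial n c B).coeff s = if s < n then ((c : ℝ) + 1 + s) * B s else 0 := by
  simp only [strandPolynomial, Polynomial.finsetSum_coeff, Polynomial.coeff_C_mul_X_pow,
    Finset.sum_ite_eq, Finset.mem_range]

theorem coeff_taylor_strandPolynomial (n c : ℕ) (B : ℕ → ℝ) (r : ℝ) (q : ℕ) :
    (Polynomial.taylor r (strandPolynomial n c B)).coeff q =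
      ∑ s ∈ Finset.range n, ((c : ℝ) + 1 + s) * B s * (r ^ (s - q) * s.choose q) := by
  simp only [strandPolynomial, map_sum, Polynomial.taylor_mul, Polynomial.taylor_C,
    Polynomial.taylor_X_pow, Polynomial.finsetSum_coeff, Polynomial.coeff_C_mul,
    Polynomial.coeff_X_add_C_pow]

theorem degree_taylor_strandPolynomial_lt (n c : ℕ) (B : ℕ → ℝ) (r : ℝ) :
    (Polynomial.taylor r (strandPolynomial n c B)).degree < n := by
  rw [Polynomial.degree_taylor]
  refine (Polynomial.degree_lt_iff_coeff_zero _ _).mpr fun s hs => ?_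
  rw [coeff_strandPolynomial, if_neg hs.not_gt]

/-- The weights with which the pure diagrams of the degree sequences `linearSequence c p`, `p ≤ n`,
sum to the diagram with the entry `1` at `(0, 0)` and the linear strand `B`. -/
def linearWeight (n c : ℕ) (B : ℕ → ℝ) : ℕ → ℝ
  | 0 => 1 - ∑ s ∈ Finset.range n, (-1) ^ s * B s
  | q + 1 => (Polynomial.taylor (-1) (strandPolynomial n c B)).coeff q / linearFactor c q

theorem linearWeight_eq_zero_of_lt {n p : ℕ} (h : n < p) (c : ℕ) (B : ℕ → ℝ) :
    linearWeight n c B p = 0 := by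
  obtain ⟨q, rfl⟩ := Nat.exists_eq_add_of_lt h
  rw [linearWeight, (Polynomial.degree_lt_iff_coeff_zero _ _).mp
    (degree_taylor_strandPolynomial_lt n c B (-1)) _ (Nat.le_add_right n q), zero_div]

theorem sum_linearWeight_mul_pureDiagram_succ {n : ℕ} (c : ℕ) {B : ℕ → ℝ}
    (hB : ∀ s, n ≤ s → B s = 0) (s : ℕ) :
    ∑ q ∈ Finset.range n, linearWeight n c B (q + 1) *
      (linearSequence c (q + 1)).pureDiagram (s + 1) (c + 1 + s) = B s := by
  have hpos : 0 < (c : ℝ) + 1 + s := by positivity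
  have hstrand : (strandPolynomial n c B).coeff s = ((c : ℝ) + 1 + s) * B s := by
    rw [coeff_strandPolynomial]
    split_ifs with hs
    · rfl
    · rw [hB s (not_lt.mp hs), mul_zero]
  refine mul_left_cancel₀ hpos.ne' ?_
  rw [← hstrand, ← Polynomial.taylor_zero (strandPolynomial n c B), ← add_neg_cancel (1 : ℝ),
    ← Polynomial.taylor_taylor,
    coeff_taylor_one (degree_taylor_strandPolynomial_lt n c B (-1)), Finset.mul_sum]
  refine Finset.sum_congr rfl fun q _ => ?_
  rw [mul_left_comm, degree_mul_linearSequence_pureDiagram, linearWeight, ← mul_assoc,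
    div_mul_cancel₀ _ (linearFactor_pos c q).ne']

theorem sum_linearWeight {n : ℕ} (c : ℕ) {B : ℕ → ℝ} (hB : ∀ s, n ≤ s → B s = 0) :
    ∑ p ∈ Finset.range (n + 1), linearWeight n c B p = 1 := by
  have hsum : ∑ q ∈ Finset.range n, linearWeight n c B (q + 1) =
      ∑ s ∈ Finset.range n, (-1) ^ s * B s := by
    simp only [← sum_linearWeight_mul_pureDiagram_succ c hB, Finset.mul_sum]
    rw [Finset.sum_comm]
    refine Finset.sum_congr rfl fun q hq => ?_
    simp only [mul_left_comm, ← Finset.mul_sum]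
    rw [sum_neg_one_pow_mul_linearSequence_pureDiagram c (Finset.mem_range.mp hq), mul_one]
  rw [Finset.sum_range_succ', hsum, linearWeight, add_sub_cancel]

/-- The decomposition into pure diagrams of the diagram with the entry `1` at `(0, 0)` and the
linear strand `B`; its weights are non-negative for the Betti diagrams of interest. -/
def linearDecomposition (n c : ℕ) (B : ℕ → ℝ) : DegreeSequence →₀ ℝ :=
  Finsupp.mapDomain (linearSequence c) (Finsupp.onFinset (Finset.range (n + 1))
    (linearWeight n c B) fun _ hp => Finset.mem_range_succ_iff.mpr
      (not_lt.mp fun h => hp (linearWeight_eq_zero_of_lt h c B)))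

theorem linearDecomposition_linearSequence (n c : ℕ) (B : ℕ → ℝ) (p : ℕ) :
    linearDecomposition n c B (linearSequence c p) = linearWeight n c B p :=
  Finsupp.mapDomain_apply (linearSequence_injective c) _ p

theorem support_linearDecomposition (n c : ℕ) (B : ℕ → ℝ) :
    ((linearDecomposition n c B).support : Set DegreeSequence) =
      linearSequence c '' {p | linearWeight n c B p ≠ 0} := by
  ext δ
  rw [Finset.mem_coe, Finsupp.mem_support_iff]
  constructor
  · intro hδ
    obtain ⟨p, rfl⟩ := Finsupp.mem_range_of_mapDomain_ne_zero hδ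
    rw [linearDecomposition_linearSequence] at hδ
    exact ⟨p, hδ, rfl⟩
  · rintro ⟨p, hp, rfl⟩
    rwa [linearDecomposition_linearSequence]

theorem linearDecomposition_nonneg {n c : ℕ} {B : ℕ → ℝ} (h : ∀ p, 0 ≤ linearWeight n c B p)
    (δ : DegreeSequence) : 0 ≤ linearDecomposition n c B δ := by
  by_cases hδ : δ ∈ Set.range (linearSequence c)
  · obtain ⟨p, rfl⟩ := hδ
    exact (h p).trans_eq (linearDecomposition_linearSequence n c B p).symm
  · exact (Finsupp.mapDomain_of_notMem_range _ δ hδ).ge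

theorem linearDecomposition_mem_decompositions {n c : ℕ} {β : ℕ → ℕ → ℝ} (h0 : β 0 0 = 1)
    (h0' : ∀ j, j ≠ 0 → β 0 j = 0) (hβ : ∀ i j, β (i + 1) j ≠ 0 → j = c + 1 + i)
    (hn : ∀ i, n ≤ i → β (i + 1) (c + 1 + i) = 0)
    (hnonneg : ∀ p, 0 ≤ linearWeight n c (fun s => β (s + 1) (c + 1 + s)) p) :
    linearDecomposition n c (fun s => β (s + 1) (c + 1 + s)) ∈ decompositions β := by
  refine mem_decompositions_iff.mpr ⟨linearDecomposition_nonneg hnonneg, ?_⟩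
  ext i j
  rw [linearDecomposition, Finsupp.linearCombination_mapDomain, Finsupp.linearCombination_onFinset,
    Finset.sum_apply, Finset.sum_apply]
  simp only [Pi.smul_apply, Function.comp_apply, smul_eq_mul]
  rcases i with _ | s
  · rcases eq_or_ne j 0 with rfl | hj
    · simp only [DegreeSequence.pureDiagram_zero_zero, mul_one, sum_linearWeight c hn, h0]
    · simp only [DegreeSequence.pureDiagram_zero_of_ne _ hj, mul_zero, Finset.sum_const_zero,
        h0' j hj]
  · rcases eq_or_ne j (c + 1 + s) with rfl | hj
    · rw [Finset.sum_range_succ', DegreeSequence.pureDiagram_eq_zero_of_length_lt _ s.succ_pos,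
        mul_zero, add_zero, sum_linearWeight_mul_pureDiagram_succ c hn]
    · simp only [linearSequence_pureDiagram_succ_of_ne c _ hj, mul_zero, Finset.sum_const_zero]
      exact (of_not_not fun h => hj (hβ s j h)).symm

end Weights

section BettiWeights

universe u

variable {K : Type u} [Field K] {n c : ℕ} {J : Ideal (MvPolynomial (Fin n) K)}
  {U : Set (Fin n →₀ ℕ)}

theorem linearWeight_betti_nonneg (h : HasLinearResolution J (c + 1)) (hJ : IsMonomialIdealOf J U)
    (hU : GeneratedInDegree U (c + 1)) (p : ℕ) :
    0 ≤ linearWeight n c (fun s => (betti J (s + 1) (c + 1 + s) : ℝ)) p := by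
  rcases p with _ | q
  · have hle : ∑ s ∈ Finset.range n, (-1 : ℝ) ^ s * (betti J (s + 1) (c + 1 + s) : ℝ) ≤ 1 := by
      exact_mod_cast h.sum_neg_one_pow_mul_betti_le_one (hU.betti_zero_zero hJ)
    exact sub_nonneg.mpr hle
  obtain ⟨P, hP⟩ := h.exists_degree_mul_betti_eq hJ hU
  have hstrand : strandPolynomial n c (fun s => (betti J (s + 1) (c + 1 + s) : ℝ)) =
      Polynomial.taylor 1 (P.map (Nat.castRingHom ℝ)) := by
    ext s
    have hs : ((Polynomial.taylor 1 P).map (Nat.castRingHom ℝ)).coeff s =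
        ((c : ℝ) + 1 + s) * betti J (s + 1) (c + 1 + s) := by
      rw [Polynomial.coeff_map, ← hP, eq_natCast]
      push_cast
      rfl
    rw [coeff_strandPolynomial, ← map_one (Nat.castRingHom ℝ), ← Polynomial.map_taylor, hs]
    split_ifs with hsn
    · rw [map_one]
    · rw [betti_eq_zero_of_card_lt (by omega), Nat.cast_zero, mul_zero]
  rw [linearWeight, hstrand, Polynomial.taylor_taylor, neg_add_cancel, Polynomial.taylor_zero,
    Polynomial.coeff_map]
  exact div_nonneg (Nat.cast_nonneg _) (linearFactor_pos c q).le

theorem decompositions_bettiDiagram (h : HasLinearResolution J (c + 1))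
    (hJ : IsMonomialIdealOf J U) (hU : GeneratedInDegree U (c + 1)) :
    decompositions (bettiDiagram J) =
      {linearDecomposition n c fun s => (betti J (s + 1) (c + 1 + s) : ℝ)} := by
  have hβ (i j : ℕ) (hij : bettiDiagram J (i + 1) j ≠ 0) : j = c + 1 + i :=
    of_not_not fun hj => hij (Nat.cast_eq_zero.mpr (h.betti_succ_eq_zero hj))
  refine decompositions_eq_singleton hβ (linearDecomposition_mem_decompositions ?_ ?_ hβ ?_
    (linearWeight_betti_nonneg h hJ hU))
  · exact Nat.cast_eq_one.mpr (hU.betti_zero_zero hJ)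
  · exact fun j hj => Nat.cast_eq_zero.mpr (betti_zero_eq_zero (Nat.pos_of_ne_zero hj))
  · exact fun i hi => Nat.cast_eq_zero.mpr (betti_eq_zero_of_card_lt (Nat.lt_succ_of_le hi) _)

end BettiWeights

/-! ### Betti numbers of powers -/

section EventuallyPolynomial

open Filter

/-- `f` agrees with a polynomial for all large arguments. -/
def EventuallyPolynomial (f : ℕ → ℝ) : Prop :=
  ∃ P : Polynomial ℝ, ∀ᶠ k in atTop, f k = P.eval (k : ℝ)

namespace EventuallyPolynomial

variable {f g : ℕ → ℝ}

theorem congr (hf : EventuallyPolynomial f) (h : ∀ᶠ k in atTop, g k = f k) :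
    EventuallyPolynomial g :=
  hf.imp fun _ hP => EventuallyEq.trans h hP

theorem const (c : ℝ) : EventuallyPolynomial fun _ => c :=
  ⟨Polynomial.C c, .of_forall fun _ => Polynomial.eval_C.symm⟩

theorem natCast : EventuallyPolynomial fun k => (k : ℝ) :=
  ⟨Polynomial.X, .of_forall fun _ => Polynomial.eval_X.symm⟩

theorem add (hf : EventuallyPolynomial f) (hg : EventuallyPolynomial g) :
    EventuallyPolynomial fun k => f k + g k := by
  obtain ⟨P, hP⟩ := hf
  obtain ⟨Q, hQ⟩ := hg
  refine ⟨P + Q, ?_⟩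
  filter_upwards [hP, hQ] with k hPk hQk
  rw [hPk, hQk, Polynomial.eval_add]

theorem sub (hf : EventuallyPolynomial f) (hg : EventuallyPolynomial g) :
    EventuallyPolynomial fun k => f k - g k := by
  obtain ⟨P, hP⟩ := hf
  obtain ⟨Q, hQ⟩ := hg
  refine ⟨P - Q, ?_⟩
  filter_upwards [hP, hQ] with k hPk hQk
  rw [hPk, hQk, Polynomial.eval_sub]

theorem mul (hf : EventuallyPolynomial f) (hg : EventuallyPolynomial g) :
    EventuallyPolynomial fun k => f k * g k := by
  obtain ⟨P, hP⟩ := hf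
  obtain ⟨Q, hQ⟩ := hg
  refine ⟨P * Q, ?_⟩
  filter_upwards [hP, hQ] with k hPk hQk
  rw [hPk, hQk, Polynomial.eval_mul]

theorem sum {ι : Type*} {s : Finset ι} {f : ι → ℕ → ℝ}
    (h : ∀ i ∈ s, EventuallyPolynomial (f i)) : EventuallyPolynomial fun k => ∑ i ∈ s, f i k := by
  choose! P hP using h
  refine ⟨∑ i ∈ s, P i, ?_⟩
  filter_upwards [(Finset.eventually_all s).mpr hP] with k hk
  rw [Polynomial.eval_finsetSum, Finset.sum_congr rfl hk]

theorem prod {ι : Type*} {s : Finset ι} {f : ι → ℕ → ℝ}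
    (h : ∀ i ∈ s, EventuallyPolynomial (f i)) : EventuallyPolynomial fun k => ∏ i ∈ s, f i k := by
  choose! P hP using h
  refine ⟨∏ i ∈ s, P i, ?_⟩
  filter_upwards [(Finset.eventually_all s).mpr hP] with k hk
  rw [Polynomial.eval_prod, Finset.prod_congr rfl hk]

theorem comp_sub (hf : EventuallyPolynomial f) (a : ℕ) :
    EventuallyPolynomial fun k => f (k - a) := by
  obtain ⟨P, hP⟩ := hf
  refine ⟨P.comp (Polynomial.X - Polynomial.C (a : ℝ)), ?_⟩
  filter_upwards [(tendsto_sub_atTop_nat a).eventually hP, eventually_ge_atTop a] with k hk hak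
  rw [hk, Polynomial.eval_comp, Polynomial.eval_sub, Polynomial.eval_X, Polynomial.eval_C,
    Nat.cast_sub hak]

end EventuallyPolynomial

end EventuallyPolynomial

section HilbertFunction

open Filter

variable {r : ℕ}

theorem eventuallyPolynomial_card_univ :
    EventuallyPolynomial fun k =>
      ((exponentsOfDegree (Set.univ : Set (Fin r →₀ ℕ)) k).card : ℝ) := by
  have hcount (k : ℕ) :
      (exponentsOfDegree (Set.univ : Set (Fin r →₀ ℕ)) k).card = (r + k - 1).choose k := by
    simp only [exponentsOfDegree, Set.mem_univ, Finset.filter_true,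
      Finset.card_finsuppAntidiag_nat_eq_choose, Finset.card_fin]
  simp only [hcount]
  rcases r with _ | d
  · refine (EventuallyPolynomial.const 0).congr ?_
    filter_upwards [eventually_gt_atTop 0] with k hk
    rw [Nat.choose_eq_zero_of_lt (by omega), Nat.cast_zero]
  · refine ⟨Polynomial.preHilbertPoly ℝ d 0, .of_forall fun k => ?_⟩
    dsimp only
    rw [Polynomial.preHilbertPoly_eq_choose_sub_add ℝ d k.zero_le, Nat.sub_zero,
      Nat.add_right_comm, Nat.add_sub_cancel, add_comm k d, Nat.choose_symm_add]

/-- The exponents that lie above no element of `G`. -/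
def avoiding (G : Finset (Fin r →₀ ℕ)) : Set (Fin r →₀ ℕ) := {h | ∀ g ∈ G, ¬ g ≤ h}

theorem avoiding_empty : avoiding (∅ : Finset (Fin r →₀ ℕ)) = Set.univ :=
  Set.eq_univ_of_forall fun _ _ hg => absurd hg (Finset.notMem_empty _)

theorem mem_avoiding_insert {g h : Fin r →₀ ℕ} {G : Finset (Fin r →₀ ℕ)} :
    h ∈ avoiding (insert g G) ↔ h ∈ avoiding G ∧ ¬ g ≤ h :=
  (Finset.forall_mem_insert g G (¬ · ≤ h)).trans and_comm

theorem mem_avoiding_image_tsub {g h : Fin r →₀ ℕ} {G : Finset (Fin r →₀ ℕ)} :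
    h ∈ avoiding (G.image (· - g)) ↔ g + h ∈ avoiding G := by
  simp only [avoiding, Set.mem_ofPred_eq, Finset.forall_mem_image, tsub_le_iff_left]

theorem card_exponentsOfDegree_avoiding_insert_add (g : Fin r →₀ ℕ) (G : Finset (Fin r →₀ ℕ))
    {k : ℕ} (hk : g.degree ≤ k) :
    (exponentsOfDegree (avoiding (insert g G)) k).card +
      (exponentsOfDegree (avoiding (G.image (· - g))) (k - g.degree)).card =
        (exponentsOfDegree (avoiding G) k).card := by
  have hfilter : exponentsOfDegree (avoiding (insert g G)) k =
      (exponentsOfDegree (avoiding G) k).filter (¬ g ≤ ·) := by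
    ext h
    rw [Finset.mem_filter, mem_exponentsOfDegree, mem_exponentsOfDegree, mem_avoiding_insert,
      and_assoc]
  rw [hfilter, ← Finset.card_filter_add_card_filter_not (s := exponentsOfDegree (avoiding G) k)
    (¬ g ≤ ·), Nat.add_left_cancel_iff]
  simp only [not_not]
  refine Finset.card_bij' (fun h _ => g + h) (fun h _ => h - g) (fun h hh => ?_) (fun h hh => ?_)
    (fun h _ => add_tsub_cancel_left g h) (fun h hh => ?_)
  · rw [mem_exponentsOfDegree, mem_avoiding_image_tsub] at hh
    rw [Finset.mem_filter, mem_exponentsOfDegree, map_add, hh.1]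
    exact ⟨⟨Nat.add_sub_cancel' hk, hh.2⟩, le_self_add⟩
  · rw [Finset.mem_filter, mem_exponentsOfDegree] at hh
    obtain ⟨⟨hdeg, hG⟩, hgh⟩ := hh
    have hadd := add_tsub_cancel_of_le hgh
    rw [mem_exponentsOfDegree, mem_avoiding_image_tsub, hadd]
    refine ⟨?_, hG⟩
    rw [← hdeg, ← hadd, map_add, add_tsub_cancel_left, Nat.add_sub_cancel_left]
  · exact add_tsub_cancel_of_le (Finset.mem_filter.mp hh).2

theorem eventuallyPolynomial_card_avoiding (G : Finset (Fin r →₀ ℕ)) :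
    EventuallyPolynomial fun k => ((exponentsOfDegree (avoiding G) k).card : ℝ) := by
  induction hm : G.card using Nat.strong_induction_on generalizing G with
  | _ m ih =>
    rcases G.eq_empty_or_nonempty with rfl | ⟨g, hg⟩
    · rw [avoiding_empty]
      exact eventuallyPolynomial_card_univ
    · have hlt : (G.erase g).card < m := hm ▸ Finset.card_erase_lt_of_mem hg
      have himage : ((G.erase g).image (· - g)).card < m := Finset.card_image_le.trans_lt hlt
      refine ((ih _ hlt _ rfl).sub ((ih _ himage _ rfl).comp_sub g.degree)).congr ?_
      filter_upwards [eventually_ge_atTop g.degree] with k hk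
      rw [← card_exponentsOfDegree_avoiding_insert_add g (G.erase g) hk, Finset.insert_erase hg,
        Nat.cast_add, add_sub_cancel_right]

/-- Dickson's lemma, for the minimal elements of an upper set. -/
theorem exists_compl_eq_avoiding {B : Set (Fin r →₀ ℕ)} (hB : IsUpperSet B) :
    ∃ G : Finset (Fin r →₀ ℕ), Bᶜ = avoiding G := by
  have hfin : {g | Minimal (· ∈ B) g}.Finite :=
    WellQuasiOrderedLE.finite_of_isAntichain (setOfPred_minimal_antichain _)
  refine ⟨hfin.toFinset, Set.ext fun h => ⟨fun hh g hg hle => ?_, fun hh hhB => ?_⟩⟩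
  · exact hh (hB hle (hfin.mem_toFinset.mp hg).prop)
  · obtain ⟨g, hle, hg⟩ := exists_minimal_le_of_wellFoundedLT (· ∈ B) h hhB
    exact hh g (hfin.mem_toFinset.mpr hg) hle

theorem eventuallyPolynomial_card_compl {B : Set (Fin r →₀ ℕ)} (hB : IsUpperSet B) :
    EventuallyPolynomial fun k => ((exponentsOfDegree Bᶜ k).card : ℝ) := by
  obtain ⟨G, hG⟩ := exists_compl_eq_avoiding hB
  rw [hG]
  exact eventuallyPolynomial_card_avoiding G

end HilbertFunction

section PowerExponents

variable {n d r : ℕ}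

/-- The exponents of the monomials in the `k`-th power of the ideal generated by the monomials
with exponents `a i`. -/
def powerExponents (a : Fin r → (Fin n →₀ ℕ)) (k : ℕ) : Set (Fin n →₀ ℕ) :=
  {u | ∃ h : Fin r →₀ ℕ, h.degree = k ∧ Finsupp.linearCombination ℕ a h ≤ u}

theorem degree_linearCombination {a : Fin r → (Fin n →₀ ℕ)} (ha : ∀ i, (a i).degree = d)
    (h : Fin r →₀ ℕ) : (Finsupp.linearCombination ℕ a h).degree = d * h.degree := by
  rw [Finsupp.linearCombination_apply, Finsupp.sum_fintype _ _ fun i => zero_smul ℕ (a i), map_sum,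
    Finsupp.degree_eq_sum, Finset.mul_sum]
  refine Finset.sum_congr rfl fun i _ => ?_
  rw [map_nsmul, ha, smul_eq_mul, mul_comm]

/-- The factorisations `h` such that the exponent `∑ h i • a i + b` has a factorisation of the same
degree that is smaller in the lexicographic order. -/
def reducible (a : Fin r → (Fin n →₀ ℕ)) (b : Fin n →₀ ℕ) : Set (Fin r →₀ ℕ) :=
  {h | ∃ (h' : Fin r →₀ ℕ) (b' : Fin n →₀ ℕ), h'.degree = h.degree ∧
    Finsupp.linearCombination ℕ a h' + b' = Finsupp.linearCombination ℕ a h + b ∧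
    toLex h' < toLex h}

theorem isUpperSet_reducible (a : Fin r → (Fin n →₀ ℕ)) (b : Fin n →₀ ℕ) :
    IsUpperSet (reducible a b) := by
  rintro h g hle ⟨h', b', hdeg, heq, hlt⟩
  obtain ⟨c, rfl⟩ := exists_add_of_le hle
  refine ⟨h' + c, b', by rw [map_add, map_add, hdeg], ?_, ?_⟩
  · rw [map_add, map_add, add_right_comm, heq, add_right_comm]
  · rw [toLex_add, toLex_add]
    exact add_lt_add_left hlt _

theorem eq_of_notMem_reducible {a : Fin r → (Fin n →₀ ℕ)} {b b' : Fin n →₀ ℕ}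
    {h h' : Fin r →₀ ℕ} (hh : h ∉ reducible a b) (hh' : h' ∉ reducible a b')
    (hdeg : h.degree = h'.degree)
    (heq : Finsupp.linearCombination ℕ a h + b = Finsupp.linearCombination ℕ a h' + b') :
    h = h' ∧ b = b' := by
  rcases lt_trichotomy (toLex h) (toLex h') with hlt | hlex | hlt
  · exact absurd ⟨h, b, hdeg, heq, hlt⟩ hh'
  · obtain rfl : h = h' := toLex.injective hlex
    exact ⟨rfl, add_left_cancel heq⟩
  · exact absurd ⟨h', b', hdeg.symm, heq.symm, hlt⟩ hh

theorem exists_notMem_reducible {a : Fin r → (Fin n →₀ ℕ)} {k : ℕ} {u : Fin n →₀ ℕ}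
    (hu : u ∈ powerExponents a k) : ∃ (h : Fin r →₀ ℕ) (b : Fin n →₀ ℕ),
      h.degree = k ∧ h ∉ reducible a b ∧ Finsupp.linearCombination ℕ a h + b = u := by
  obtain ⟨h₀, hdeg₀, hle₀⟩ := hu
  obtain ⟨h, hF, hmin⟩ := Finset.exists_min_image ((Finset.univ.finsuppAntidiag k).filter
    fun h => Finsupp.linearCombination ℕ a h ≤ u) toLex
    ⟨h₀, Finset.mem_filter.mpr ⟨mem_finsuppAntidiag_univ.mpr hdeg₀, hle₀⟩⟩
  rw [Finset.mem_filter, mem_finsuppAntidiag_univ] at hF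
  have hadd := add_tsub_cancel_of_le hF.2
  refine ⟨h, u - Finsupp.linearCombination ℕ a h, hF.1, ?_, hadd⟩
  rintro ⟨h', b', hdeg', heq, hlt⟩
  rw [hadd] at heq
  refine (hmin h' (Finset.mem_filter.mpr ⟨?_, heq ▸ le_self_add⟩)).not_gt hlt
  exact mem_finsuppAntidiag_univ.mpr (hdeg'.trans hF.1)

theorem card_exponentsOfDegree_powerExponents {a : Fin r → (Fin n →₀ ℕ)}
    (ha : ∀ i, (a i).degree = d) (k e : ℕ) :
    (exponentsOfDegree (powerExponents a k) (d * k + e)).card =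
      ∑ b ∈ Finset.univ.finsuppAntidiag e, (exponentsOfDegree (reducible a b)ᶜ k).card := by
  rw [← Finset.card_sigma]
  refine (Finset.card_bij (fun x _ => Finsupp.linearCombination ℕ a x.2 + x.1) ?_ ?_ ?_).symm
  · rintro ⟨b, h⟩ hx
    rw [Finset.mem_sigma, mem_finsuppAntidiag_univ, mem_exponentsOfDegree] at hx
    rw [mem_exponentsOfDegree, map_add, degree_linearCombination ha, hx.1, hx.2.1]
    exact ⟨rfl, h, hx.2.1, le_self_add⟩
  · rintro ⟨b, h⟩ hx ⟨b', h'⟩ hx' heq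
    rw [Finset.mem_sigma, mem_finsuppAntidiag_univ, mem_exponentsOfDegree] at hx hx'
    obtain ⟨rfl, rfl⟩ := eq_of_notMem_reducible hx.2.2 hx'.2.2 (hx.2.1.trans hx'.2.1.symm) heq
    rfl
  · intro u hu
    rw [mem_exponentsOfDegree] at hu
    obtain ⟨h, b, hdeg, hred, rfl⟩ := exists_notMem_reducible hu.2
    rw [map_add, degree_linearCombination ha, hdeg, Nat.add_left_cancel_iff] at hu
    refine ⟨⟨b, h⟩, ?_, rfl⟩
    rw [Finset.mem_sigma, mem_finsuppAntidiag_univ, mem_exponentsOfDegree]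
    exact ⟨hu.1, hdeg, hred⟩

theorem eventuallyPolynomial_card_powerExponents {a : Fin r → (Fin n →₀ ℕ)}
    (ha : ∀ i, (a i).degree = d) (e : ℕ) :
    EventuallyPolynomial fun k =>
      ((exponentsOfDegree (powerExponents a k) (d * k + e)).card : ℝ) := by
  simp only [card_exponentsOfDegree_powerExponents ha, Nat.cast_sum]
  exact .sum fun b _ => eventuallyPolynomial_card_compl (isUpperSet_reducible a b)

theorem generatedInDegree_powerExponents {a : Fin r → (Fin n →₀ ℕ)}
    (ha : ∀ i, (a i).degree = d) (k : ℕ) : GeneratedInDegree (powerExponents a k) (d * k) := by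
  rintro u ⟨h, hk, hle⟩
  exact ⟨_, ⟨h, hk, le_rfl⟩, hle, by rw [degree_linearCombination ha, hk]⟩

end PowerExponents

section BettiPowersOfMonomialIdeal

open MvPolynomial Filter
open scoped Pointwise

universe u

variable {K : Type u} [Field K] {n d r : ℕ} {I J : Ideal (MvPolynomial (Fin n) K)}

theorem isMonomialIdealOf_span (B : Set (Fin n →₀ ℕ)) :
    IsMonomialIdealOf (Ideal.span ((fun b => monomial b (1 : K)) '' B)) {u | ∃ b ∈ B, b ≤ u} := by
  refine ⟨fun u v huv ⟨b, hb, hbu⟩ => ⟨b, hb, hbu.trans huv⟩, fun p => ?_⟩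
  rw [mem_ideal_span_monomial_image]
  simp only [mem_support_iff, Set.mem_ofPred_eq]

theorem image_linearCombination_degree_succ (a : Fin r → (Fin n →₀ ℕ)) (k : ℕ) :
    Finsupp.linearCombination ℕ a '' {h | h.degree = k + 1} =
      Finsupp.linearCombination ℕ a '' {h | h.degree = k} + Set.range a := by
  ext u
  constructor
  · rintro ⟨h, hk, rfl⟩
    have h0 : h ≠ 0 := fun h0 => k.succ_ne_zero (hk.symm.trans (h0 ▸ map_zero Finsupp.degree))
    obtain ⟨i, hi⟩ := Finsupp.ne_iff.mp h0
    obtain ⟨h', rfl⟩ := exists_add_of_le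
      (Finsupp.single_le_iff.mpr (Nat.one_le_iff_ne_zero.mpr hi))
    rw [Set.mem_ofPred_eq, map_add, Finsupp.degree_single, add_comm] at hk
    refine Set.mem_add.mpr ⟨_, ⟨h', Nat.succ_injective hk, rfl⟩, a i, ⟨i, rfl⟩, ?_⟩
    rw [map_add, Finsupp.linearCombination_single, one_smul, add_comm]
  · rintro ⟨_, ⟨h, hk, rfl⟩, _, ⟨i, rfl⟩, rfl⟩
    refine ⟨h + Finsupp.single i 1, ?_, ?_⟩
    · rw [Set.mem_ofPred_eq, map_add, Finsupp.degree_single, hk]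
    · rw [map_add, Finsupp.linearCombination_single, one_smul]

theorem image_monomial_mul_image_monomial (A B : Set (Fin n →₀ ℕ)) :
    (fun b => monomial b (1 : K)) '' A * (fun b => monomial b (1 : K)) '' B =
      (fun b => monomial b (1 : K)) '' (A + B) :=
  (Set.image_image2_distrib (g := fun b => monomial b (1 : K)) fun a b => by
    rw [monomial_mul, one_mul]).symm

theorem span_monomial_range_pow (a : Fin r → (Fin n →₀ ℕ)) (k : ℕ) :
    Ideal.span ((fun b => monomial b (1 : K)) '' Set.range a) ^ k =
      Ideal.span ((fun b => monomial b (1 : K)) ''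
        (Finsupp.linearCombination ℕ a '' {h | h.degree = k})) := by
  induction k with
  | zero =>
    simp only [Finsupp.degree_eq_zero_iff, Set.ofPred_eq_eq_singleton, Set.image_singleton,
      map_zero, pow_zero]
    rw [← C_apply, C_1, Ideal.span_singleton_one, Ideal.one_eq_top]
  | succ k ih =>
    rw [pow_succ, ih, Ideal.span_mul_span', image_monomial_mul_image_monomial,
      image_linearCombination_degree_succ]

theorem isMonomialIdealOf_pow (a : Fin r → (Fin n →₀ ℕ)) (k : ℕ) :
    IsMonomialIdealOf (Ideal.span ((fun b => monomial b (1 : K)) '' Set.range a) ^ k)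
      (powerExponents a k) := by
  rw [span_monomial_range_pow]
  convert isMonomialIdealOf_span (K := K) (Finsupp.linearCombination ℕ a '' {h | h.degree = k})
    using 1
  simp only [Set.exists_mem_image, Set.mem_ofPred_eq, powerExponents]

theorem IsMonomialGeneratedInDegree.exists_powerExponents
    (hI : IsMonomialGeneratedInDegree I d) : ∃ (r : ℕ) (a : Fin r → (Fin n →₀ ℕ)),
      (∀ i, (a i).degree = d) ∧ ∀ k, IsMonomialIdealOf (I ^ k) (powerExponents a k) := by
  obtain ⟨A, hA, rfl⟩ := hI
  obtain ⟨r, a, -, rfl⟩ := ((Finsupp.finite_of_degree_eq (σ := Fin n) d).subset hA).fin_param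
  exact ⟨r, a, fun i => hA _ ⟨i, rfl⟩, isMonomialIdealOf_pow a⟩

theorem HasLinearResolution.betti_succ_eq_sum {D : ℕ} (h : HasLinearResolution J D) (hD : 0 < D)
    (h0 : betti J 0 0 = 1) (i : ℕ) : (betti J (i + 1) (D + i) : ℝ) =
      ∑ l ∈ Finset.range (n + 1), (-1) ^ i * (-1) ^ l *
        ((if l ≤ D + i then n.choose l * Module.finrank K (degreePart J (D + i - l)) else 0 : ℕ) :
          ℝ) := by
  obtain ⟨c, rfl⟩ := Nat.exists_eq_succ_of_ne_zero hD.ne'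
  have hcoeff := congrArg (fun m : ℤ => (-1) ^ i * (m : ℝ)) (h.coeff_kPolynomial h0 i)
  simp only [kPolynomial, coeff_one_sub_X_pow_mul, coeff_idealSeries] at hcoeff
  push_cast at hcoeff ⊢
  rw [← mul_assoc, ← mul_pow, neg_one_mul, neg_neg, one_pow, one_mul] at hcoeff
  rw [← hcoeff, Finset.mul_sum]
  exact Finset.sum_congr rfl fun l _ => (mul_assoc _ _ _).symm

theorem eventuallyPolynomial_finrank_degreePart_pow {a : Fin r → (Fin n →₀ ℕ)}
    (ha : ∀ i, (a i).degree = d) (hI : ∀ k, IsMonomialIdealOf (I ^ k) (powerExponents a k))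
    (i l : ℕ) : EventuallyPolynomial fun k =>
      ((if l ≤ d * k + i then
        n.choose l * Module.finrank K (degreePart (I ^ k) (d * k + i - l)) else 0 : ℕ) : ℝ) := by
  rcases le_or_gt l i with hl | hl
  · refine ((EventuallyPolynomial.const (n.choose l : ℝ)).mul
      (eventuallyPolynomial_card_powerExponents ha (i - l))).congr (.of_forall fun k => ?_)
    rw [if_pos (hl.trans (Nat.le_add_left i _)), (hI k).finrank_degreePart, Nat.add_sub_assoc hl,
      Nat.cast_mul]
  · refine (EventuallyPolynomial.const 0).congr (.of_forall fun k => ?_)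
    split_ifs with hlk
    · have hbot := (generatedInDegree_powerExponents ha k).degreePart_eq_bot (hI k)
        (show d * k + i - l < d * k by omega)
      rw [hbot, finrank_bot, mul_zero, Nat.cast_zero]
    · exact Nat.cast_zero

theorem eventuallyPolynomial_betti_pow (hI : IsMonomialGeneratedInDegree I d) (hd : 0 < d)
    (hlin : ∀ᶠ k in atTop, HasLinearResolution (I ^ k) (d * k)) (i : ℕ) :
    EventuallyPolynomial fun k => (betti (I ^ k) (i + 1) (d * k + i) : ℝ) := by
  obtain ⟨r, a, ha, hpow⟩ := hI.exists_powerExponents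
  refine (EventuallyPolynomial.sum (s := Finset.range (n + 1)) fun l _ =>
    (EventuallyPolynomial.const ((-1) ^ i * (-1) ^ l)).mul
      (eventuallyPolynomial_finrank_degreePart_pow ha hpow i l)).congr ?_
  filter_upwards [hlin, eventually_gt_atTop 0] with k hk hk0
  have hdk : 0 < d * k := Nat.mul_pos hd hk0
  refine hk.betti_succ_eq_sum hdk ?_ i
  obtain ⟨c, hc⟩ := Nat.exists_eq_succ_of_ne_zero hdk.ne'
  exact (hc ▸ generatedInDegree_powerExponents ha k).betti_zero_zero (hpow k)

end BettiPowersOfMonomialIdeal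

/-! ### Decompositions of the Betti diagrams of powers -/

section EventuallyRational

open Filter

/-- `f` agrees with a rational function, without poles, for all large arguments. -/
def EventuallyRational (f : ℕ → ℝ) : Prop :=
  ∃ P Q : Polynomial ℝ, ∀ᶠ k : ℕ in atTop,
    Q.eval (k : ℝ) ≠ 0 ∧ f k = P.eval (k : ℝ) / Q.eval (k : ℝ)

theorem EventuallyPolynomial.div {f g : ℕ → ℝ} (hf : EventuallyPolynomial f)
    (hg : EventuallyPolynomial g) (hg0 : ∀ᶠ k in atTop, g k ≠ 0) :
    EventuallyRational fun k => f k / g k := by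
  obtain ⟨P, hP⟩ := hf
  obtain ⟨Q, hQ⟩ := hg
  refine ⟨P, Q, ?_⟩
  filter_upwards [hP, hQ, hg0] with k hPk hQk hk
  rw [← hPk, ← hQk]
  exact ⟨hk, rfl⟩

theorem EventuallyPolynomial.eventuallyRational {f : ℕ → ℝ} (hf : EventuallyPolynomial f) :
    EventuallyRational f := by
  simpa only [div_one] using hf.div (.const 1) (.of_forall fun _ => one_ne_zero)

/-- A polynomial vanishes identically or has finitely many roots, so the set of indices at which
the weights do not vanish is eventually constant. -/
theorem exists_eventually_ne_zero_iff_mem_range {v : ℕ → ℕ → ℝ} {N : ℕ}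
    (hv : ∀ p, EventuallyRational fun k => v k p) (hN : ∀ k p, N < p → v k p = 0) :
    ∃ (m : ℕ) (e : Fin m → ℕ) (P Q : Fin m → Polynomial ℝ), Function.Injective e ∧
      ∀ᶠ k in atTop, (∀ p, v k p ≠ 0 ↔ p ∈ Set.range e) ∧
        ∀ s, (Q s).eval (k : ℝ) ≠ 0 ∧ v k (e s) = (P s).eval (k : ℝ) / (Q s).eval (k : ℝ) := by
  choose P Q hPQ using hv
  let T := (Finset.range (N + 1)).filter fun p => P p ≠ 0
  let e := T.orderEmbOfFin rfl
  have hroot (p : ℕ) (hp : P p ≠ 0) : ∀ᶠ k : ℕ in atTop, (P p).eval (k : ℝ) ≠ 0 :=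
    tendsto_natCast_atTop_atTop.eventually (Polynomial.eventually_atTop_not_isRoot (P p) hp)
  refine ⟨T.card, e, fun s => P (e s), fun s => Q (e s), e.injective, ?_⟩
  filter_upwards [(Finset.eventually_all (Finset.range (N + 1))).mpr fun p _ => hPQ p,
    (Finset.eventually_all T).mpr fun p hp => hroot p (Finset.mem_filter.mp hp).2] with k hk hkT
  refine ⟨fun p => ?_, fun s => hk _ (Finset.mem_filter.mp (T.orderEmbOfFin_mem rfl s)).1⟩
  rw [Finset.range_orderEmbOfFin, Finset.mem_coe]
  constructor
  · intro hvp
    have hp : p ∈ Finset.range (N + 1) :=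
      Finset.mem_range_succ_iff.mpr (not_lt.mp fun hlt => hvp (hN k p hlt))
    refine Finset.mem_filter.mpr ⟨hp, fun hP => hvp ?_⟩
    rw [(hk p hp).2, hP, Polynomial.eval_zero, zero_div]
  · intro hp
    obtain ⟨hQ, heq⟩ := hk p (Finset.mem_filter.mp hp).1
    rw [heq]
    exact div_ne_zero (hkT p hp) hQ

variable {c : ℕ → ℕ}

theorem eventuallyPolynomial_linearFactor (hc : EventuallyPolynomial fun k => (c k : ℝ)) (q : ℕ) :
    EventuallyPolynomial fun k => linearFactor (c k) q := by
  simp only [linearFactor, div_eq_mul_inv]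
  exact (EventuallyPolynomial.prod (f := fun (r k : ℕ) => (c k + 1 + r : ℝ)) fun (r : ℕ) _ =>
    (hc.add (.const 1)).add (.const r)).mul (.const _)

theorem eventuallyRational_linearWeight (n : ℕ) (hc : EventuallyPolynomial fun k => (c k : ℝ))
    {B : ℕ → ℕ → ℝ} (hB : ∀ s, EventuallyPolynomial fun k => B k s) (p : ℕ) :
    EventuallyRational fun k => linearWeight n (c k) (B k) p := by
  rcases p with _ | q
  · exact ((EventuallyPolynomial.const 1).sub
      (.sum fun s _ => (EventuallyPolynomial.const _).mul (hB s))).eventuallyRational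
  · refine EventuallyPolynomial.div ?_ (eventuallyPolynomial_linearFactor hc q)
      (.of_forall fun k => (linearFactor_pos (c k) q).ne')
    simp only [coeff_taylor_strandPolynomial]
    exact .sum fun s _ => (((hc.add (.const 1)).add (.const (s : ℝ))).mul (hB s)).mul (.const _)

end EventuallyRational

section RationalDecomposition

open Filter

variable {n d : ℕ}

theorem isTranslation_linearSequence (hd : 0 < d) (p : ℕ) :
    IsTranslation fun k => linearSequence (d * k - 1) p := by
  refine ⟨p, d, -1, fun _ => 0, fun k hk => ⟨rfl, fun i hi => ?_⟩⟩
  have hdk : 1 ≤ d * k := Nat.mul_pos hd hk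
  obtain ⟨j, rfl⟩ := Fin.exists_succ_eq.mpr hi
  change ((d * k - 1 + 1 + j : ℕ) : ℤ) - (j + 1 : ℕ) = _
  push_cast [Nat.sub_add_cancel hdk]
  ring

/-- For large `k` the diagram `β k` has a unique decomposition, whose pure diagrams vary in `k` by
translations and whose weights are rational functions of `k`. -/
def HasRationalDecomposition (β : ℕ → ℕ → ℕ → ℝ) : Prop :=
  ∃ (k₀ m : ℕ) (π : Fin m → ℕ → DegreeSequence) (p q : Fin m → Polynomial ℝ),
    (∀ s, IsTranslation (π s)) ∧
    ∀ k, k₀ < k →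
      Function.Injective (fun s => π s k) ∧
      occurringPure (β k) = Set.range (fun s => π s k) ∧
      (∀ s, (q s).eval (k : ℝ) ≠ 0) ∧
      decompositionPolytope (β k) (fun s => π s k) =
        {fun s => (p s).eval (k : ℝ) / (q s).eval (k : ℝ)}

theorem hasRationalDecomposition_of_decompositions_eq (hd : 0 < d) {β : ℕ → ℕ → ℕ → ℝ}
    {B : ℕ → ℕ → ℝ} (hB : ∀ s, EventuallyPolynomial fun k => B k s)
    (hβ : ∀ᶠ k in atTop, decompositions (β k) = {linearDecomposition n (d * k - 1) (B k)}) :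
    HasRationalDecomposition β := by
  have hc : EventuallyPolynomial fun k => ((d * k - 1 : ℕ) : ℝ) := by
    refine ((EventuallyPolynomial.const d).mul .natCast |>.sub (.const 1)).congr ?_
    filter_upwards [eventually_gt_atTop 0] with k hk
    rw [Nat.cast_pred (Nat.mul_pos hd hk), Nat.cast_mul]
  obtain ⟨m, e, P, Q, he, hPQ⟩ := exists_eventually_ne_zero_iff_mem_range
    (eventuallyRational_linearWeight n hc hB) fun k p hp =>
      linearWeight_eq_zero_of_lt hp (d * k - 1) (B k)
  obtain ⟨k₀, hk₀⟩ := eventually_atTop.mp (hβ.and hPQ)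
  refine ⟨k₀, m, fun s k => linearSequence (d * k - 1) (e s), P, Q,
    fun s => isTranslation_linearSequence hd _, fun k hk => ?_⟩
  obtain ⟨hdec, hsupp, hweight⟩ := hk₀ k hk.le
  have hrange : ((linearDecomposition n (d * k - 1) (B k)).support : Set DegreeSequence) =
      Set.range fun s => linearSequence (d * k - 1) (e s) := by
    rw [support_linearDecomposition, Set.range_comp' (linearSequence (d * k - 1)) e]
    exact congrArg _ (Set.ext hsupp)
  have hinj : Function.Injective fun s => linearSequence (d * k - 1) (e s) :=
    (linearSequence_injective _).comp he
  refine ⟨hinj, (occurringPure_eq_support hdec).trans hrange, fun s => (hweight s).1, ?_⟩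
  rw [decompositionPolytope_eq_singleton hdec hinj hrange.subset]
  simp only [linearDecomposition_linearSequence, (hweight _).2]

theorem decompositions_zero : decompositions 0 = {0} :=
  decompositions_eq_singleton (c := 0) (fun _ _ h => absurd rfl h)
    (mem_decompositions_iff.mpr ⟨fun _ => le_rfl, map_zero _⟩)

theorem hasRationalDecomposition_zero : HasRationalDecomposition 0 := by
  refine ⟨0, 0, finZeroElim, finZeroElim, finZeroElim, finZeroElim, fun k _ =>
    ⟨Function.injective_of_subsingleton _, ?_, finZeroElim, ?_⟩⟩
  · rw [Pi.zero_apply, occurringPure_eq_support decompositions_zero, Finsupp.support_zero,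
      Finset.coe_empty, Set.range_eq_empty]
  · rw [Pi.zero_apply, decompositionPolytope_eq_singleton decompositions_zero
      (Function.injective_of_subsingleton _) (Finset.coe_empty.trans_subset (Set.empty_subset _))]
    exact congrArg _ (Subsingleton.elim _ _)

end RationalDecomposition

section BettiDiagramPow

open MvPolynomial Filter

universe u

variable {K : Type u} [Field K] {n d : ℕ} {I J : Ideal (MvPolynomial (Fin n) K)}

theorem hasRationalDecomposition_bettiDiagram_pow (hI : IsMonomialGeneratedInDegree I d)
    (hd : 0 < d) (hlin : ∀ᶠ k in atTop, HasLinearResolution (I ^ k) (d * k)) :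
    HasRationalDecomposition fun k => bettiDiagram (I ^ k) := by
  have hcancel (k : ℕ) (hk : 0 < k) : d * k - 1 + 1 = d * k :=
    Nat.sub_add_cancel (Nat.mul_pos hd hk)
  obtain ⟨r, a, ha, hpow⟩ := hI.exists_powerExponents
  refine hasRationalDecomposition_of_decompositions_eq (n := n) hd
    (B := fun k s => (betti (I ^ k) (s + 1) (d * k - 1 + 1 + s) : ℝ)) (fun s => ?_) ?_
  · refine (eventuallyPolynomial_betti_pow hI hd hlin s).congr ?_
    filter_upwards [eventually_gt_atTop 0] with k hk
    rw [hcancel k hk]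
  · filter_upwards [hlin, eventually_gt_atTop 0] with k hlink hk
    rw [← hcancel k hk] at hlink
    exact decompositions_bettiDiagram hlink (hpow k)
      ((hcancel k hk).symm ▸ generatedInDegree_powerExponents ha k)

theorem bettiDiagram_top : bettiDiagram (⊤ : Ideal (MvPolynomial (Fin n) K)) = 0 := by
  have : Subsingleton (MvPolynomial (Fin n) K ⧸ (⊤ : Ideal (MvPolynomial (Fin n) K))) :=
    Ideal.Quotient.subsingleton_iff.mpr rfl
  funext i j
  exact Nat.cast_eq_zero.mpr (betti_eq_zero_of_koszulChains_eq_bot (Subsingleton.elim _ _))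

theorem IsMonomialGeneratedInDegree.eq_bot_or_eq_top (hI : IsMonomialGeneratedInDegree I 0) :
    I = ⊥ ∨ I = ⊤ := by
  obtain ⟨A, hA, rfl⟩ := hI
  rcases A.eq_empty_or_nonempty with rfl | ⟨a, ha⟩
  · rw [Set.image_empty, Ideal.span_empty]
    exact .inl rfl
  · refine .inr ((Ideal.eq_top_iff_one _).mpr (Ideal.subset_span ⟨a, ha, ?_⟩))
    rw [(Finsupp.degree_eq_zero_iff a).mp (hA a ha)]
    rfl

theorem isMonomialGeneratedInDegree_bot (d : ℕ) :
    IsMonomialGeneratedInDegree (⊥ : Ideal (MvPolynomial (Fin n) K)) d :=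
  ⟨∅, fun _ ha => absurd ha (Set.notMem_empty _), by rw [Set.image_empty, Ideal.span_empty]⟩

theorem HasLinearResolution.of_zero (h : HasLinearResolution J 0) (D : ℕ) :
    HasLinearResolution J D := fun i j hi hne =>
  absurd (betti_eq_zero_of_lt (by have := h i j hi hne; omega)) hne

end BettiDiagramPow

end BettiPowers

end

theorem mainTheorem1 {K : Type*} [Field K] (n d : ℕ)
    (I : Ideal (MvPolynomial (Fin n) K))
    (hI : IsMonomialGeneratedInDegree I d)
    (hlin : ∃ k₁ : ℕ, ∀ k : ℕ, k₁ < k → HasLinearResolution (I ^ k) (d * k)) :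
    ∃ (k₀ m : ℕ) (π : Fin m → ℕ → DegreeSequence) (p q : Fin m → Polynomial ℝ),
      (∀ s, IsTranslation (π s)) ∧
      ∀ k : ℕ, k₀ < k →
        Function.Injective (fun s => π s k) ∧
        occurringPure (bettiDiagram (I ^ k)) = Set.range (fun s => π s k) ∧
        (∀ s, (q s).eval (k : ℝ) ≠ 0) ∧
        decompositionPolytope (bettiDiagram (I ^ k)) (fun s => π s k) =
          {fun s => (p s).eval (k : ℝ) / (q s).eval (k : ℝ)} := by
  obtain ⟨k₁, hk₁⟩ := hlin
  have hlin : ∀ᶠ k in Filter.atTop, HasLinearResolution (I ^ k) (d * k) :=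
    (Filter.eventually_gt_atTop k₁).mono hk₁
  rcases Nat.eq_zero_or_pos d with rfl | hd
  · rcases hI.eq_bot_or_eq_top with rfl | rfl
    · exact hasRationalDecomposition_bettiDiagram_pow (isMonomialGeneratedInDegree_bot 1) one_pos
        (hlin.mono fun k hk => (zero_mul k ▸ hk).of_zero _)
    · simp only [Ideal.top_pow, bettiDiagram_top]
      exact hasRationalDecomposition_zero
  · exact hasRationalDecomposition_bettiDiagram_pow hI hd hlin
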